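/- Let $G$ be a compact, connected, simply connected, simple Lie group with Lie algebra $\mathbf g$, let $T\subset G$ be a Cartan subgroup (maximal torus) with Cartan algebra $\mathbf t$, whose elements $\tau$ are written in the convention in which $e^{2\pi i\tau}\in T$, and fix simple roots $\alpha_1,\dots,\alpha_r$ with highest root $\phi=\sum_i k_i\alpha_i$. Let $\mathrm{tr}\,XY$ be the invariant form on $\mathbf g$ normalized so that the long roots have length squared $2$; it identifies $\mathbf g$ with its dual. Let $\mathcal A=\{\tau\in\mathbf t:\ \mathrm{tr}\,\alpha_i\tau\ge 0\ (1\le i\le r),\ \mathrm{tr}\,\phi\tau\le 1\}$ be the Weyl alcove, with vertices $\tau_0=0$ and $\tau_i=\lambda_i^\vee/k_i$, where $\lambda_i^\vee$ are the fundamental coweights. For $i,j\in\{0,\dots,r\}$ let $G_{ij}$ be the stabilizer, under the adjoint action of $G$ on itself, of the elements $e^{2\pi i\tau}$ with $\tau$ in the open simplex spanned by $\tau_i$ and $\tau_j$, and let $G_i=G_{ii}$. Let $\widetilde G_{ij}$, $\widetilde G_i$ be the universal covers, realized as groups of homotopy classes of paths starting at $1$, and let $\mathcal Z_i$ be the kernel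 of $\widetilde G_i\to G_i$. With $\mathrm e_i$ the exponential map of $\widetilde G_i$, let $\chi_i$ be the character of $\mathcal Z_i$ given by $\chi_i(\mathrm e_i^{2\pi ip})=e^{2\pi i\,\mathrm{tr}\,\tau_ip}$ for $p$ in the coroot lattice $Q^\vee$, and let $\chi_{ij}:\widetilde G_{ij}\to U(1)$ be given by $\chi_{ij}(\widetilde\gamma)=\exp\big[\frac1i\int_{\widetilde\gamma}a_{ij}\big]$, where $a_{ij}=i\,\mathrm{tr}\,(\tau_j-\tau_i)(\gamma^{-1}d\gamma)$. Let $Z$ be a subgroup of the centre of $G$. An element $z\in Z$ acts on $\mathcal A$ by the affine transformation $\tau\mapsto z\tau$ such that $z\,e^{2\pi i\tau}=w_z^{-1}e^{2\pi i\,z\tau}w_z$ for an element $w_z$ of the normalizer $N(T)$, and it permutes the vertices, $z\tau_i=\tau_{zi}$. Put $i_z=z^{-1}i$, and let $\widetilde\gamma\mapsto\widetilde\gamma_z=w_z^{-1}\widetilde\gamma w_z$ denote the lift to the universal covers $\widetilde G_{ij}\to\widetilde G_{i_zj_z}$ (in particular $\mathcal Z_i\to\mathcal Z_{i_z}$) of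 the conjugation by $w_z^{-1}$. **Lemma 1.** For all $z\in Z$, all $i,j\in\{0,\dots,r\}$, all $\zeta\in\mathcal Z_i$ and all $\widetilde\gamma\in\widetilde G_{ij}$, $$\chi_{i_z}(\zeta_z)=\chi_i(\zeta),\qquad \chi_{i_zj_z}(\widetilde\gamma_z)=\chi_{ij}(\widetilde\gamma).$$ -/

import Mathlib

open scoped Manifold ContDiff TensorProduct

/-- A smooth real Lie group is regular enough to carry Mathlib's Lie algebra structure. -/
instance instLEInftyMinSmoothnessReal : ENat.LEInfty (minSmoothness ℝ 3) :=
  ⟨by simpa using WithTop.coe_le_coe.2 (le_top : (3 : ℕ∞) ≤ ⊤)⟩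

noncomputable section

namespace BasicGerbe

/-! ### Universal covers as homotopy classes of paths starting at the identity -/

section UniversalCover

variable (K : Type*) [TopologicalSpace K] [Group K] [IsTopologicalGroup K]

/-- The group of continuous paths in `K` that start at `1`, with pointwise multiplication. -/
def BasedPath : Subgroup C(unitInterval, K) where
  carrier := {γ | γ 0 = 1}
  mul_mem' := by
    intro a b ha hb
    simp only [Set.mem_ofPred_eq] at ha hb ⊢
    simp [ha, hb]
  one_mem' := by simp
  inv_mem' := by
    intro a ha
    simp only [Set.mem_ofPred_eq] at ha ⊢
    simp [ha]

/-- Homotopy of based paths relative to the end points, as a congruence. -/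
def homotopyCon : Con (BasedPath K) where
  r γ δ := ContinuousMap.HomotopicRel γ.1 δ.1 {0, 1}
  iseqv :=
    ⟨fun γ => ContinuousMap.HomotopicRel.refl γ.1,
      fun h => ContinuousMap.HomotopicRel.symm h,
      fun h h' => ContinuousMap.HomotopicRel.trans h h'⟩
  mul' := by
    rintro a b c d ⟨F⟩ ⟨F'⟩
    exact ⟨{ toFun := fun x => F x * F' x
             continuous_toFun := by fun_prop
             map_zero_left := fun x => by simp
             map_one_left := fun x => by simp
             prop' := fun t x hx => by
               have h1 := F.eq_fst t hx
               have h2 := F'.eq_fst t hx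
               simp [h1, h2] }⟩

/-- The universal covering group of a connected Lie group `K`: homotopy classes (with fixed end
points) of paths starting at `1`, multiplied pointwise. -/
abbrev UniversalCover : Type _ := (homotopyCon K).Quotient

/-- The covering homomorphism, sending the class of a path to its end point. -/
def coverProj : UniversalCover K →* K :=
  Con.lift (homotopyCon K)
    { toFun := fun γ => γ.1 1
      map_one' := by simp
      map_mul' := fun a b => by simp }
    (fun a b h => ContinuousMap.HomotopicRel.fst_eq_snd (S := {0, 1}) h (by simp))

variable {K} {K' : Type*} [TopologicalSpace K'] [Group K'] [IsTopologicalGroup K']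

/-- A continuous homomorphism acts on paths. -/
def basedPathMap (f : K →ₜ* K') : BasedPath K →* BasedPath K' where
  toFun γ := ⟨(f : C(K, K')).comp γ.1, by
    have h : γ.1 0 = 1 := γ.2
    change f (γ.1 0) = 1
    rw [h, map_one]⟩
  map_one' := by
    ext s
    simp
  map_mul' a b := by
    ext s
    simp

/-- The homomorphism of universal covers that lifts a continuous homomorphism. -/
def coverMap (f : K →ₜ* K') : UniversalCover K →* UniversalCover K' :=
  Con.lift (homotopyCon K) ((homotopyCon K').mk'.comp (basedPathMap f))
    (fun a b h => (Con.eq (homotopyCon K')).2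
      (ContinuousMap.HomotopicRel.comp_continuousMap
        (show ContinuousMap.HomotopicRel a.1 b.1 {0, 1} from h) (f : C(K, K'))))

theorem coverProj_coverMap (f : K →ₜ* K') (x : UniversalCover K) :
    coverProj K' (coverMap f x) = f (coverProj K x) := by
  induction x using Con.induction_on with
  | H γ => rfl

end UniversalCover

/-! ### Exponential map, tori, roots -/

section LieTheory

variable {E : Type*} [NormedAddCommGroup E] [NormedSpace ℝ E]
  {G : Type*} [TopologicalSpace G] [ChartedSpace E G] [Group G]

/-- `φ` is the one-parameter subgroup of `G` with velocity `X` at time `0`. -/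
def IsOneParameterSubgroup (X : GroupLieAlgebra 𝓘(ℝ, E) G) (φ : ℝ → G) : Prop :=
  (∀ s t : ℝ, φ (s + t) = φ s * φ t) ∧
    HasMFDerivAt 𝓘(ℝ, ℝ) 𝓘(ℝ, E) φ 0 (ContinuousLinearMap.toSpanSingleton ℝ (X : E))

open Classical in
/-- The exponential map of `G`: the value at time `1` of the one-parameter subgroup with
velocity `X`. -/
def expG (X : GroupLieAlgebra 𝓘(ℝ, E) G) : G :=
  if h : ∃! φ : ℝ → G, IsOneParameterSubgroup X φ then h.choose 1 else 1

/-- The adjoint action of `G` on its Lie algebra. -/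
def Ad (g : G) : GroupLieAlgebra 𝓘(ℝ, E) G →L[ℝ] GroupLieAlgebra 𝓘(ℝ, E) G :=
  (mfderiv 𝓘(ℝ, E) 𝓘(ℝ, E) (fun x : G => g * x * g⁻¹) 1 : E →L[ℝ] E)

/-- The left logarithmic derivative `c⁻¹ dc/ds` of a curve in `G`, an element of the Lie algebra:
the velocity at `t = s` of the curve `t ↦ c(s)⁻¹ c(t)`, which is at `1` for `t = s`. -/
def leftLogDeriv (c : ℝ → G) (s : ℝ) : GroupLieAlgebra 𝓘(ℝ, E) G :=
  (mfderiv 𝓘(ℝ, ℝ) 𝓘(ℝ, E) (fun t : ℝ => (c s)⁻¹ * c t) s : ℝ →L[ℝ] E) 1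

/-- Closed connected commutative subgroups; in a compact Lie group these are the tori. -/
def IsTorus (T : Subgroup G) : Prop :=
  IsClosed (T : Set G) ∧ IsConnected (T : Set G) ∧ ∀ x ∈ T, ∀ y ∈ T, x * y = y * x

/-- A maximal torus. -/
def IsMaximalTorus (T : Subgroup G) : Prop :=
  IsTorus T ∧ ∀ T' : Subgroup G, IsTorus T' → T ≤ T' → T' = T

/-- The Lie algebra of `T`: it consists of the velocities of the one-parameter subgroups that lie
in `T` (the span of these vectors is taken only to have a linear subspace by construction). -/
def torusLieAlgebra (T : Subgroup G) : Submodule ℝ (GroupLieAlgebra 𝓘(ℝ, E) G) :=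
  Submodule.span ℝ {X | ∃ φ : ℝ → G, IsOneParameterSubgroup X φ ∧ ∀ s, φ s ∈ T}

variable [CompleteSpace E] [LieGroup 𝓘(ℝ, E) ∞ G]

/-- `α` is a root: a nonzero functional on the Cartan algebra with a nonzero root vector `e` in the
complexified Lie algebra. The element `τ` here is the velocity in the real Lie algebra, i.e. it
stands for `iτ` in the convention in which Cartan elements are hermitian; hence the factor `i` in
`[τ, e] = i α(τ) e`. -/
def IsRoot (T : Subgroup G) (α : Module.Dual ℝ (torusLieAlgebra (E := E) T)) : Prop :=
  α ≠ 0 ∧ ∃ e : ℂ ⊗[ℝ] (GroupLieAlgebra 𝓘(ℝ, E) G), e ≠ 0 ∧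
    ∀ τ : torusLieAlgebra (E := E) T,
      ⁅(1 : ℂ) ⊗ₜ[ℝ] (τ : GroupLieAlgebra 𝓘(ℝ, E) G), e⁆ = ((α τ : ℂ) * Complex.I) • e

variable (E G)

/-- The standard choices for a compact simple Lie group: a Cartan subgroup, simple roots, the
highest root, and the normalized invariant form.

The form `form X Y` is `- tr XY` on the real Lie algebra, i.e. `tr τ τ'` for `X = iτ`, `Y = iτ'`;
it is positive definite. It is normalized so that the long roots, the highest root among them,
have length squared `2`. Here a functional on the Cartan algebra is identified with the vector that
represents it with respect to the form. -/
structure CartanData where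
  /-- the Cartan subgroup -/
  T : Subgroup G
  isMaximalTorus : IsMaximalTorus T
  /-- the rank -/
  r : ℕ
  /-- the simple roots `α₁, …, αᵣ` -/
  simpleRoot : Module.Basis (Fin r) ℝ (Module.Dual ℝ (torusLieAlgebra (E := E) T))
  isRoot_simpleRoot : ∀ i, IsRoot T (simpleRoot i)
  root_eq : ∀ β, IsRoot T β →
    ∃ n : Fin r → ℕ, β = ∑ i, n i • simpleRoot i ∨ β = -∑ i, n i • simpleRoot i
  /-- the highest root `φ` -/
  highestRoot : Module.Dual ℝ (torusLieAlgebra (E := E) T)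
  isRoot_highestRoot : IsRoot T highestRoot
  le_highestRoot : ∀ β, IsRoot T β →
    ∃ n : Fin r → ℕ, highestRoot - β = ∑ i, n i • simpleRoot i
  /-- the invariant form `tr` -/
  form : LinearMap.BilinForm ℝ (GroupLieAlgebra 𝓘(ℝ, E) G)
  form_symm : ∀ X Y, form X Y = form Y X
  form_pos : ∀ X, X ≠ 0 → 0 < form X X
  form_Ad : ∀ (g : G) X Y, form (Ad g X) (Ad g Y) = form X Y
  length_root_le : ∀ β, IsRoot T β → ∀ h : torusLieAlgebra (E := E) T,
    (∀ τ : torusLieAlgebra (E := E) T, form h τ = β τ) → form h h ≤ 2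
  length_highestRoot : ∀ h : torusLieAlgebra (E := E) T,
    (∀ τ : torusLieAlgebra (E := E) T, form h τ = highestRoot τ) → form h h = 2

end LieTheory

namespace CartanData

variable {E : Type*} [NormedAddCommGroup E] [NormedSpace ℝ E] [FiniteDimensional ℝ E]
  [CompleteSpace E]
  {G : Type*} [TopologicalSpace G] [ChartedSpace E G] [Group G] [LieGroup 𝓘(ℝ, E) ∞ G]
  (D : CartanData E G)

/-- The Cartan algebra. -/
abbrev cartan : Submodule ℝ (GroupLieAlgebra 𝓘(ℝ, E) G) := torusLieAlgebra D.T

instance : FiniteDimensional ℝ (GroupLieAlgebra 𝓘(ℝ, E) G) :=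
  inferInstanceAs (FiniteDimensional ℝ E)

/-- The element `e^{2πiτ}` of the Cartan subgroup. -/
def e (τ : D.cartan) : G := expG ((2 * Real.pi) • (τ : GroupLieAlgebra 𝓘(ℝ, E) G))

/-- The fundamental coweights, the basis of the Cartan algebra dual to the simple roots. -/
def coweight (i : Fin D.r) : D.cartan :=
  (Module.evalEquiv ℝ D.cartan).symm (D.simpleRoot.dualBasis i)

theorem simpleRoot_coweight (i j : Fin D.r) :
    D.simpleRoot j (D.coweight i) = if j = i then 1 else 0 := by
  have h : Module.Dual.eval ℝ D.cartan (D.coweight i) = D.simpleRoot.dualBasis i :=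
    (Module.evalEquiv ℝ D.cartan).apply_symm_apply _
  have h' := congrArg (fun f => f (D.simpleRoot j)) h
  simpa [Finsupp.single_apply] using h'

/-- The mark `kᵢ`, the coefficient of the highest root at the simple root `αᵢ`. -/
def mark (i : Fin D.r) : ℝ := D.simpleRoot.repr D.highestRoot i

/-- The vertices `τ₀ = 0` and `τᵢ = λᵢ^∨ / kᵢ` of the Weyl alcove. -/
def vertex : Fin (D.r + 1) → D.cartan :=
  Fin.cases 0 (fun i => (D.mark i)⁻¹ • D.coweight i)

/-- The Weyl alcove. -/
def alcove : Set D.cartan :=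
  {τ | (∀ i, 0 ≤ D.simpleRoot i τ) ∧ D.highestRoot τ ≤ 1}

/-- The coroot lattice, generated by the simple coroots `αᵢ^∨ = 2 αᵢ / tr αᵢ²`, where `αᵢ` is
identified with the vector `h` that represents it. -/
def corootLattice : AddSubgroup D.cartan :=
  AddSubgroup.closure {c | ∃ (i : Fin D.r) (h : D.cartan),
    (∀ τ : D.cartan, D.form h τ = D.simpleRoot i τ) ∧ c = (2 / D.form h h) • h}

/-- The group `Gᵢⱼ`: the adjoint action stabilizer of the elements `e^{2πiτ}` with `τ` in the open
simplex spanned by `τᵢ` and `τⱼ`. In particular `Gᵢᵢ = Gᵢ` is the stabilizer of `e^{2πiτᵢ}`. -/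
def stab (i j : Fin (D.r + 1)) : Subgroup G :=
  Subgroup.centralizer (D.e '' openSegment ℝ (D.vertex i) (D.vertex j))

theorem mark_nonneg (j : Fin D.r) : 0 ≤ D.mark j := by
  obtain ⟨n, hn⟩ := D.le_highestRoot _ (D.isRoot_simpleRoot j)
  have h : D.highestRoot = D.simpleRoot j + ∑ i, n i • D.simpleRoot i := by
    rw [← hn]
    abel
  have h2 : D.mark j = 1 + (n j : ℝ) := by
    simp [mark, h, Finsupp.single_apply]
  rw [h2]
  positivity

theorem vertex_mem_alcove (i : Fin (D.r + 1)) : D.vertex i ∈ D.alcove := by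
  refine Fin.cases ?_ (fun i => ?_) i
  · exact ⟨fun j => by simp [vertex], by simp [vertex]⟩
  · have hφ : D.highestRoot (D.coweight i) = D.mark i := by
      have h := congrArg (fun f => f (D.coweight i)) (D.simpleRoot.sum_repr D.highestRoot)
      simp only [LinearMap.sum_apply, LinearMap.smul_apply, simpleRoot_coweight] at h
      simpa [mark] using h.symm
    refine ⟨fun j => ?_, ?_⟩
    · have h := D.mark_nonneg i
      simp only [vertex, Fin.cases_succ, map_smul, simpleRoot_coweight, smul_eq_mul]
      split_ifs <;> simp [h]
    · simp only [vertex, Fin.cases_succ, map_smul, hφ, smul_eq_mul]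
      exact inv_mul_le_one

theorem convex_alcove : Convex ℝ D.alcove := by
  intro x hx y hy a b ha hb hab
  refine ⟨fun i => ?_, ?_⟩
  · have h1 := hx.1 i
    have h2 := hy.1 i
    simp only [map_add, map_smul, smul_eq_mul]
    positivity
  · have h1 := hx.2
    have h2 := hy.2
    simp only [map_add, map_smul, smul_eq_mul]
    nlinarith

section Characters

variable [IsTopologicalGroup G]

/-- The universal cover of `Gᵢⱼ`; the universal cover of `Gᵢ` is the case `j = i`. -/
abbrev cover (i j : Fin (D.r + 1)) : Type _ := UniversalCover (D.stab i j)

/-- The group `𝒵ᵢ`, the kernel of the covering of `Gᵢ` by its universal cover. -/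
def deck (i : Fin (D.r + 1)) : Subgroup (D.cover i i) := (coverProj (D.stab i i)).ker

/-- `x = e_{ij}^{2πiτ}`: the element `x` of the universal cover of `Gᵢⱼ` is the class of the path
`s ↦ e^{2πisτ}`, `0 ≤ s ≤ 1`, in `Gᵢⱼ`. -/
def IsCoverExp (i j : Fin (D.r + 1)) (τ : D.cartan) (x : D.cover i j) : Prop :=
  ∃ γ : BasedPath (D.stab i j),
    (∀ s : unitInterval, ((γ.1 s : D.stab i j) : G) = D.e ((s : ℝ) • τ)) ∧
      (γ : D.cover i j) = x

open Classical in
/-- The character `χᵢ` of `𝒵ᵢ`: the one given by `χᵢ(eᵢ^{2πip}) = e^{2πi tr τᵢ p}` for `p` in the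
coroot lattice. -/
def chi (i : Fin (D.r + 1)) : D.deck i →* Circle :=
  if h : ∃! χ : D.deck i →* Circle, ∀ p ∈ D.corootLattice, ∀ ζ : D.deck i,
      D.IsCoverExp i i p ζ → χ ζ = Circle.exp (2 * Real.pi * D.form (D.vertex i) p)
  then h.choose else 1

open Classical in
/-- The function `χᵢⱼ` on the universal cover of `Gᵢⱼ`: the one given by
`χᵢⱼ([γ]) = exp ((1/i) ∫_γ aᵢⱼ)` for every `C¹` path `γ` in `Gᵢⱼ` that starts at `1`, with the one
form `aᵢⱼ = i tr (τⱼ - τᵢ)(γ⁻¹dγ)`. In terms of velocities in the real Lie algebra (on which `form`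
is `-tr` and `τ` stands for `iτ`), `(1/i) aᵢⱼ = i form (τⱼ - τᵢ) (γ⁻¹dγ)`. -/
def chi₂ (i j : Fin (D.r + 1)) : D.cover i j → Circle :=
  if h : ∃! χ : D.cover i j → Circle,
      ∀ (c : ℝ → G) (γ : BasedPath (D.stab i j)),
        ContMDiff 𝓘(ℝ, ℝ) 𝓘(ℝ, E) 1 c →
        (∀ s : unitInterval, ((γ.1 s : D.stab i j) : G) = c s) →
        χ (γ : D.cover i j) =
          Circle.exp (∫ s in (0 : ℝ)..1,
            D.form ((D.vertex j - D.vertex i : D.cartan) : GroupLieAlgebra 𝓘(ℝ, E) G)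
              (leftLogDeriv c s))
  then h.choose else 1

end Characters

/-- The action of a central element `z` on the Weyl alcove by an affine transformation
`τ ↦ zτ`, with the element `w = w_z` of the normalizer of the Cartan subgroup such that
`z e^{2πiτ} = w⁻¹ e^{2πi zτ} w` for `τ` in the alcove, and the permutation `i ↦ zi` with
`zτᵢ = τ_{zi}`. -/
structure CentreAction (z : G) where
  /-- the affine transformation `τ ↦ zτ` -/
  act : D.cartan →ᵃ[ℝ] D.cartan
  /-- the element `w_z`, determined up to multiplication by elements of the Cartan subgroup -/
  w : G
  /-- the permutation `i ↦ zi` -/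
  perm : Equiv.Perm (Fin (D.r + 1))
  act_alcove : act '' D.alcove = D.alcove
  w_mem : w ∈ Subgroup.normalizer (D.T : Set G)
  mul_e : ∀ τ ∈ D.alcove, z * D.e τ = w⁻¹ * D.e (act τ) * w
  act_vertex : ∀ i, act (D.vertex i) = D.vertex (perm i)

namespace CentreAction

variable {D} {z : G} (a : D.CentreAction z)

/-- The index `i_z = z⁻¹i`. -/
def idx (i : Fin (D.r + 1)) : Fin (D.r + 1) := a.perm.symm i

theorem conj_mem (hz : z ∈ Subgroup.center G) (i j : Fin (D.r + 1)) {γ : G}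
    (hγ : γ ∈ D.stab i j) : a.w⁻¹ * γ * a.w ∈ D.stab (a.idx i) (a.idx j) := by
  rw [stab, Subgroup.mem_centralizer_iff] at hγ ⊢
  rintro _ ⟨τ, hτ, rfl⟩
  have hA : τ ∈ D.alcove :=
    D.convex_alcove.openSegment_subset (D.vertex_mem_alcove _) (D.vertex_mem_alcove _) hτ
  have hact : a.act τ ∈ openSegment ℝ (D.vertex i) (D.vertex j) := by
    have h : a.act τ ∈ a.act '' openSegment ℝ (D.vertex (a.idx i)) (D.vertex (a.idx j)) :=
      ⟨τ, hτ, rfl⟩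
    rw [image_openSegment, a.act_vertex, a.act_vertex] at h
    simpa [idx] using h
  have hc := hγ _ ⟨_, hact, rfl⟩
  have he : D.e τ = z⁻¹ * (a.w⁻¹ * D.e (a.act τ) * a.w) := by
    rw [← a.mul_e τ hA]
    group
  have hz' : ∀ g, g * z⁻¹ = z⁻¹ * g :=
    Subgroup.mem_center_iff.1 (inv_mem hz)
  rw [he]
  calc z⁻¹ * (a.w⁻¹ * D.e (a.act τ) * a.w) * (a.w⁻¹ * γ * a.w)
      = z⁻¹ * (a.w⁻¹ * (D.e (a.act τ) * γ) * a.w) := by group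
    _ = z⁻¹ * ((a.w⁻¹ * γ * a.w) * (a.w⁻¹ * D.e (a.act τ) * a.w)) := by
        rw [hc]
        group
    _ = (a.w⁻¹ * γ * a.w) * (z⁻¹ * (a.w⁻¹ * D.e (a.act τ) * a.w)) := by
        rw [← mul_assoc, ← hz', mul_assoc]

variable [IsTopologicalGroup G]

/-- The isomorphism `γ ↦ γ_z = w⁻¹ γ w` from `Gᵢⱼ` to `G_{i_z j_z}`. -/
def conj (hz : z ∈ Subgroup.center G) (i j : Fin (D.r + 1)) :
    D.stab i j →ₜ* D.stab (a.idx i) (a.idx j) where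
  toFun γ := ⟨a.w⁻¹ * γ * a.w, a.conj_mem hz i j γ.2⟩
  map_one' := by
    ext
    simp
  map_mul' x y := by
    ext
    simp [mul_assoc]
  continuous_toFun := by fun_prop

/-- The lift `γ̃ ↦ γ̃_z = w⁻¹ γ̃ w` of the conjugation to the universal covers. -/
def conjCover (hz : z ∈ Subgroup.center G) (i j : Fin (D.r + 1)) :
    D.cover i j →* D.cover (a.idx i) (a.idx j) :=
  coverMap (a.conj hz i j)

/-- Its restriction `ζ ↦ ζ_z` to `𝒵ᵢ`, with values in `𝒵_{i_z}`. -/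
def conjDeck (hz : z ∈ Subgroup.center G) (i : Fin (D.r + 1)) :
    D.deck i →* D.deck (a.idx i) :=
  ((a.conjCover hz i i).comp (D.deck i).subtype).codRestrict (D.deck (a.idx i)) (by
    intro ζ
    have h : coverProj (D.stab i i) ζ.1 = 1 := ζ.2
    change coverProj _ (coverMap (a.conj hz i i) ζ.1) = 1
    rw [coverProj_coverMap, h, map_one])

end CentreAction

end CartanData

end BasicGerbe

end

/-! Write `w` for `w_z`. Everything rests on `CentreAction.vertex_eq`: `τ_i = Ad_w τ_{i_z} + z0`,
where `z0` is the image of the origin and its exponential is `z` (`CentreAction.e_act_zero`). For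
`χ_ij` the shift `z0` cancels in `τ_j - τ_i`; conjugating a path transforms `γ⁻¹dγ` by the adjoint
action, and the form is invariant, so the two integrands agree. For `χ_i` the shift leaves `tr (z0)
p` with `p` in the coroot lattice, and this is an integer because `e^{2πi z0}` is central
(`exists_int_form`).

Both characters are defined by unique choice with default `1`. Conjugation by `w⁻¹` is a bijection
of the universal covers and of their kernels, and it carries one defining property to the other, so
the choices correspond (`choose_transport`). Whether the unique choice exists does not enter: the
defaults correspond as well. For `χ_i` the transport also requires that `w` preserves the coroot
lattice (`weyl_mem_corootLattice`).

The integrality has two factors, since `tr (z0) α_i^∨ = (2 / (α_i, α_i)) α_i(z0)`. The value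
`α_i(z0)` is an integer because a central element acts trivially on root vectors. The factor `2 /
(α_i, α_i)` is an integer by the normalization of the form, because some long root is not orthogonal
to `α_i` (`exists_long_root`). Invariance of the coroot lattice means that every indivisible root
has its coroot in the span of the simple ones, proved by induction on the height with simple
reflections.

The facts about roots come from the group. A root vector spans with its conjugate a copy of the
complexified Lie algebra of `SU(2)`; exponentiating its real part realizes the reflection, and the
`SU(2)` relations give `e^{2πi β^∨} = 1` (`exists_reflection`). Three foundations are needed: the
bracket of left-invariant fields is the derivative of `Ad`; every Lie algebra element generates a
one-parameter subgroup; and the Lie algebra of a maximal torus is its own centralizer. The last two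
come from limits of powers of small elements in a chart, the argument behind the closed subgroup
theorem. -/

noncomputable section

open Set Filter Topology VectorField

set_option linter.unusedSectionVars false

namespace BasicGerbe

/-! ### The chart at the identity, recentred at the origin -/

section Chart

variable {E : Type*} [NormedAddCommGroup E] [NormedSpace ℝ E]
  {G : Type*} [TopologicalSpace G] [ChartedSpace E G] [Group G]

variable (E) in
/-- The coordinates at the identity, vanishing at the identity. -/
def logChart (g : G) : E := extChartAt 𝓘(ℝ, E) (1 : G) g - extChartAt 𝓘(ℝ, E) (1 : G) 1

variable (G) in
/-- The inverse of `logChart` near the origin. -/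
def expChart (v : E) : G := (extChartAt 𝓘(ℝ, E) (1 : G)).symm (v + extChartAt 𝓘(ℝ, E) (1 : G) 1)

@[simp] theorem logChart_one : logChart E (1 : G) = 0 := sub_self _

@[simp] theorem expChart_zero : expChart G (0 : E) = 1 := by
  simp [expChart]

theorem continuousAt_logChart : ContinuousAt (logChart E) (1 : G) :=
  (continuousAt_extChartAt (I := 𝓘(ℝ, E)) (1 : G)).sub continuousAt_const

theorem continuousAt_expChart : ContinuousAt (expChart G) (0 : E) := by
  have h := continuousAt_extChartAt_symm (I := 𝓘(ℝ, E)) (1 : G)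
  refine ContinuousAt.comp (g := (extChartAt 𝓘(ℝ, E) (1 : G)).symm)
    (f := fun v : E => v + extChartAt 𝓘(ℝ, E) (1 : G) 1) ?_ (by fun_prop)
  simpa using h

theorem expChart_logChart : ∀ᶠ g in 𝓝 (1 : G), expChart G (logChart E g) = g := by
  filter_upwards [extChartAt_source_mem_nhds (I := 𝓘(ℝ, E)) (1 : G)] with g hg
  simp only [expChart, logChart, sub_add_cancel]
  exact (extChartAt 𝓘(ℝ, E) (1 : G)).left_inv hg

theorem logChart_expChart : ∀ᶠ v in 𝓝 (0 : E), logChart E (expChart G v) = v := by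
  have h : ∀ᶠ v in 𝓝 (0 : E), v + extChartAt 𝓘(ℝ, E) (1 : G) 1 ∈
      (extChartAt 𝓘(ℝ, E) (1 : G)).target := by
    have hc : ContinuousAt (fun v : E => v + extChartAt 𝓘(ℝ, E) (1 : G) 1) 0 := by fun_prop
    apply hc
    simpa using extChartAt_target_mem_nhds (I := 𝓘(ℝ, E)) (1 : G)
  filter_upwards [h] with v hv
  simp only [expChart, logChart]
  rw [(extChartAt 𝓘(ℝ, E) (1 : G)).right_inv hv, add_sub_cancel_right]

theorem contMDiffAt_logChart [IsManifold 𝓘(ℝ, E) ∞ G] :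
    ContMDiffAt 𝓘(ℝ, E) 𝓘(ℝ, E) ∞ (logChart E) (1 : G) := by
  have h := contMDiffAt_extChartAt (I := 𝓘(ℝ, E)) (n := ∞) (x := (1 : G))
  exact h.sub contMDiffAt_const

theorem contMDiffAt_expChart [IsManifold 𝓘(ℝ, E) ∞ G] :
    ContMDiffAt 𝓘(ℝ, E) 𝓘(ℝ, E) ∞ (expChart G) (0 : E) := by
  have h : ContMDiffAt 𝓘(ℝ, E) 𝓘(ℝ, E) ∞ (extChartAt 𝓘(ℝ, E) (1 : G)).symm
      (0 + extChartAt 𝓘(ℝ, E) (1 : G) 1) := by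
    rw [zero_add]
    exact (contMDiffOn_extChartAt_symm (1 : G)).contMDiffAt
      (extChartAt_target_mem_nhds (1 : G))
  have h2 : ContMDiffAt 𝓘(ℝ, E) 𝓘(ℝ, E) ∞
      (fun v : E => v + extChartAt 𝓘(ℝ, E) (1 : G) 1) 0 := by
    rw [contMDiffAt_iff_contDiffAt]
    fun_prop
  exact ContMDiffAt.comp (0 : E) h h2

/-- The tangent space at the identity is read through this very chart, so the chart is the identity
in its own coordinates. -/
theorem hasMFDerivAt_extChartAt_one :
    HasMFDerivAt 𝓘(ℝ, E) 𝓘(ℝ, E) (extChartAt 𝓘(ℝ, E) (1 : G)) (1 : G)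
      (ContinuousLinearMap.id ℝ E : E →L[ℝ] E) := by
  refine ⟨continuousAt_extChartAt (1 : G), ?_⟩
  have h : writtenInExtChartAt 𝓘(ℝ, E) 𝓘(ℝ, E) (1 : G) (extChartAt 𝓘(ℝ, E) (1 : G))
      =ᶠ[𝓝 (extChartAt 𝓘(ℝ, E) (1 : G) 1)] id := by
    filter_upwards [extChartAt_target_mem_nhds (I := 𝓘(ℝ, E)) (1 : G)] with v hv
    simp only [writtenInExtChartAt, extChartAt_model_space_eq_id, PartialEquiv.refl_coe, id,
      Function.comp]
    rw [(extChartAt 𝓘(ℝ, E) (1 : G)).right_inv hv]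
  exact ((hasFDerivAt_id _).congr_of_eventuallyEq h).hasFDerivWithinAt

theorem hasMFDerivAt_logChart {g : G} (hg : g = 1) :
    HasMFDerivAt 𝓘(ℝ, E) 𝓘(ℝ, E) (logChart E) g (ContinuousLinearMap.id ℝ E : E →L[ℝ] E) := by
  subst hg
  refine ⟨continuousAt_logChart, ?_⟩
  have h : writtenInExtChartAt 𝓘(ℝ, E) 𝓘(ℝ, E) (1 : G) (logChart E) =ᶠ[𝓝 (extChartAt 𝓘(ℝ, E) (1 : G) 1)]
      fun v => v - extChartAt 𝓘(ℝ, E) (1 : G) 1 := by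
    filter_upwards [extChartAt_target_mem_nhds (I := 𝓘(ℝ, E)) (1 : G)] with v hv
    simp only [writtenInExtChartAt, extChartAt_model_space_eq_id, PartialEquiv.refl_coe, id,
      Function.comp, logChart]
    rw [(extChartAt 𝓘(ℝ, E) (1 : G)).right_inv hv]
  exact (((hasFDerivAt_id _).sub_const _).congr_of_eventuallyEq h).hasFDerivWithinAt

theorem hasMFDerivAt_expChart :
    HasMFDerivAt 𝓘(ℝ, E) 𝓘(ℝ, E) (expChart G) (0 : E) (ContinuousLinearMap.id ℝ E : E →L[ℝ] E) := by
  refine ⟨continuousAt_expChart, ?_⟩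
  have h : writtenInExtChartAt 𝓘(ℝ, E) 𝓘(ℝ, E) (0 : E) (expChart G) =ᶠ[𝓝 (0 : E)]
      fun v => v + extChartAt 𝓘(ℝ, E) (1 : G) 1 := by
    filter_upwards [logChart_expChart (E := E) (G := G)] with v hv
    simp only [writtenInExtChartAt, extChartAt_model_space_eq_id, PartialEquiv.refl_symm,
      PartialEquiv.refl_coe, Function.comp, id, expChart_zero]
    rw [← sub_eq_iff_eq_add]
    exact hv
  exact (((hasFDerivAt_id _).add_const _).congr_of_eventuallyEq h).hasFDerivWithinAt

/-- A curve through the identity is differentiable iff it is so in the chart. -/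
theorem hasMFDerivAt_iff_logChart {φ : ℝ → G} (h0 : φ 0 = 1) (X : E) :
    HasMFDerivAt 𝓘(ℝ, ℝ) 𝓘(ℝ, E) φ 0 (ContinuousLinearMap.toSpanSingleton ℝ X : ℝ →L[ℝ] E) ↔
      ContinuousAt φ 0 ∧ HasDerivAt (fun s => logChart E (φ s)) X 0 := by
  have h : writtenInExtChartAt 𝓘(ℝ, ℝ) 𝓘(ℝ, E) (0 : ℝ) φ =
      fun s => logChart E (φ s) + extChartAt 𝓘(ℝ, E) (1 : G) 1 := by
    ext s
    simp only [writtenInExtChartAt, h0, logChart, Function.comp, sub_add_cancel]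
    rfl
  change (ContinuousAt φ 0 ∧ HasFDerivWithinAt (writtenInExtChartAt 𝓘(ℝ, ℝ) 𝓘(ℝ, E) (0 : ℝ) φ)
    (ContinuousLinearMap.toSpanSingleton ℝ X) (range (id : ℝ → ℝ)) 0) ↔ _
  rw [h, range_id, hasFDerivWithinAt_univ, hasDerivAt_iff_hasFDerivAt, hasFDerivAt_add_const_iff]

end Chart

/-! ### The adjoint action and one-parameter subgroups -/

section Adjoint

variable {E : Type*} [NormedAddCommGroup E] [NormedSpace ℝ E]
  {G : Type*} [TopologicalSpace G] [ChartedSpace E G] [Group G] [LieGroup 𝓘(ℝ, E) ∞ G]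

theorem contMDiff_conj (g : G) :
    ContMDiff 𝓘(ℝ, E) 𝓘(ℝ, E) ∞ (fun x : G => g * x * g⁻¹) :=
  (contMDiff_mul_right (I := 𝓘(ℝ, E)) (n := ∞) (a := g⁻¹)).comp
    (contMDiff_mul_left (I := 𝓘(ℝ, E)) (n := ∞) (a := g))

theorem hasMFDerivAt_conj (g : G) {x : G} (hx : x = 1) :
    HasMFDerivAt 𝓘(ℝ, E) 𝓘(ℝ, E) (fun x : G => g * x * g⁻¹) x
      (Ad (E := E) g : E →L[ℝ] E) := by
  subst hx
  exact (((contMDiff_conj (E := E) g).mdifferentiable (by simp)) 1).hasMFDerivAt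

theorem Ad_mul (g h : G) : (Ad (E := E) (g * h) : E →L[ℝ] E) =
    (Ad (E := E) g : E →L[ℝ] E).comp (Ad (E := E) h : E →L[ℝ] E) := by
  have h1 := HasMFDerivAt.comp (1 : G) (hasMFDerivAt_conj (E := E) g (x := h * 1 * h⁻¹) (by simp))
    (hasMFDerivAt_conj (E := E) h rfl)
  have h2 : ((fun x : G => g * x * g⁻¹) ∘ fun x : G => h * x * h⁻¹) =
      fun x : G => (g * h) * x * (g * h)⁻¹ := by
    ext x
    simp [mul_assoc]
  rw [h2] at h1
  exact h1.mfderiv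

@[simp] theorem Ad_mul_apply (g h : G) (X : GroupLieAlgebra 𝓘(ℝ, E) G) :
    Ad (g * h) X = Ad g (Ad h X) :=
  congrArg (fun f : E →L[ℝ] E => f X) (Ad_mul (E := E) g h)

theorem Ad_one_apply (X : GroupLieAlgebra 𝓘(ℝ, E) G) : Ad (1 : G) X = X := by
  have h2 : (fun x : G => (1 : G) * x * 1⁻¹) = id := by
    ext x
    simp
  have h : (Ad (E := E) (1 : G) : E →L[ℝ] E) = ContinuousLinearMap.id ℝ E := by
    have h1 := hasMFDerivAt_conj (E := E) (1 : G) rfl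
    rw [h2] at h1
    exact hasMFDerivAt_unique h1 (hasMFDerivAt_id 1)
  exact congrArg (fun f : E →L[ℝ] E => f X) h

@[simp] theorem Ad_inv_Ad (g : G) (X : GroupLieAlgebra 𝓘(ℝ, E) G) : Ad g⁻¹ (Ad g X) = X := by
  rw [← Ad_mul_apply, inv_mul_cancel, Ad_one_apply]

@[simp] theorem Ad_Ad_inv (g : G) (X : GroupLieAlgebra 𝓘(ℝ, E) G) : Ad g (Ad g⁻¹ X) = X := by
  rw [← Ad_mul_apply, mul_inv_cancel, Ad_one_apply]

theorem Ad_of_mem_center {z : G} (hz : z ∈ Subgroup.center G) (X : GroupLieAlgebra 𝓘(ℝ, E) G) :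
    Ad z X = X := by
  have h2 : (fun x : G => z * x * z⁻¹) = fun x : G => 1 * x * 1⁻¹ := by
    ext x
    rw [← Subgroup.mem_center_iff.1 hz x]
    simp
  have h : Ad (E := E) z = Ad (1 : G) := by
    unfold Ad
    rw [h2]
  rw [h, Ad_one_apply]

variable (E) in
/-- The adjoint action on the model space. -/
def modelAd (g : G) : E →L[ℝ] E := Ad (E := E) g

theorem hasFDerivAt_conj_chart (g : G) :
    HasFDerivAt (fun v : E => logChart E (g * expChart G v * g⁻¹)) (modelAd E g) 0 := by
  have h1 := HasMFDerivAt.comp (0 : E) (hasMFDerivAt_conj (E := E) g (x := expChart G (0 : E))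
    (by simp)) hasMFDerivAt_expChart
  exact hasMFDerivAt_iff_hasFDerivAt.1
    (HasMFDerivAt.comp (0 : E) (hasMFDerivAt_logChart (E := E) (by simp)) h1)

theorem IsOneParameterSubgroup.map_zero {X : GroupLieAlgebra 𝓘(ℝ, E) G} {φ : ℝ → G}
    (h : IsOneParameterSubgroup X φ) : φ 0 = 1 := by
  have := h.1 0 0
  simpa using this

theorem IsOneParameterSubgroup.map_neg {X : GroupLieAlgebra 𝓘(ℝ, E) G} {φ : ℝ → G}
    (h : IsOneParameterSubgroup X φ) (s : ℝ) : φ (-s) = (φ s)⁻¹ := by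
  have := h.1 (-s) s
  rw [neg_add_cancel, h.map_zero] at this
  exact eq_inv_of_mul_eq_one_left this.symm

theorem IsOneParameterSubgroup.conj {X : GroupLieAlgebra 𝓘(ℝ, E) G} {φ : ℝ → G}
    (h : IsOneParameterSubgroup X φ) (g : G) :
    IsOneParameterSubgroup (Ad g X) (fun s => g * φ s * g⁻¹) := by
  refine ⟨fun s t => ?_, ?_⟩
  · beta_reduce
    rw [h.1]
    group
  · have h1 := HasMFDerivAt.comp (0 : ℝ) (hasMFDerivAt_conj (E := E) g h.map_zero) h.2
    have h2 (A : E →L[ℝ] E) (Y : E) : A.comp (ContinuousLinearMap.toSpanSingleton ℝ Y) =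
        ContinuousLinearMap.toSpanSingleton ℝ (A Y) := by
      ext
      simp
    exact (congrArg (fun L : ℝ →L[ℝ] E => HasMFDerivAt 𝓘(ℝ, ℝ) 𝓘(ℝ, E)
      (fun s => g * φ s * g⁻¹) 0 L) (h2 (modelAd E g) X)).mp h1

theorem isOneParameterSubgroup_iff {X : GroupLieAlgebra 𝓘(ℝ, E) G} {φ : ℝ → G} :
    IsOneParameterSubgroup X φ ↔ (∀ s t : ℝ, φ (s + t) = φ s * φ t) ∧
      ContinuousAt φ 0 ∧ HasDerivAt (F := E) (fun s => logChart E (φ s)) X 0 := by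
  refine and_congr_right fun h => ?_
  have h0 : φ 0 = 1 := by
    have := h 0 0
    simpa using this
  exact hasMFDerivAt_iff_logChart (E := E) h0 X

theorem IsOneParameterSubgroup.smul {X : GroupLieAlgebra 𝓘(ℝ, E) G} {φ : ℝ → G}
    (h : IsOneParameterSubgroup X φ) (c : ℝ) :
    IsOneParameterSubgroup (c • X) (fun s => φ (c * s)) := by
  rw [isOneParameterSubgroup_iff] at h ⊢
  obtain ⟨h1, h2, h3⟩ := h
  refine ⟨fun s t => by rw [mul_add, h1], ?_, ?_⟩
  · exact ContinuousAt.comp (g := φ) (f := fun s => c * s) (by simpa using h2) (by fun_prop)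
  · have h4 : HasDerivAt (fun s : ℝ => c * s) c 0 := by
      simpa using (hasDerivAt_id (0 : ℝ)).const_mul c
    exact HasDerivAt.scomp (g₁ := fun s => logChart E (φ s)) (h := fun s => c * s) (0 : ℝ)
      (by simpa using h3) h4

/-- The local multiplication in the chart at the identity. -/
def chartMul (G : Type*) [TopologicalSpace G] [ChartedSpace E G] [Group G] (q : E × E) : E :=
  logChart E (expChart G q.1 * expChart G q.2)

theorem contDiffAt_chartMul : ContDiffAt ℝ ∞ (chartMul (E := E) G) 0 := by
  rw [← contMDiffAt_iff_contDiffAt]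
  have h1 : ContMDiffAt 𝓘(ℝ, E × E) 𝓘(ℝ, E) ∞ (fun q : E × E => expChart G q.1) 0 :=
    ContMDiffAt.comp (0 : E × E) (g := expChart G) (f := Prod.fst)
      (contMDiffAt_expChart (E := E) (G := G))
      (contMDiffAt_iff_contDiffAt.2 contDiff_fst.contDiffAt)
  have h2 : ContMDiffAt 𝓘(ℝ, E × E) 𝓘(ℝ, E) ∞ (fun q : E × E => expChart G q.2) 0 :=
    ContMDiffAt.comp (0 : E × E) (g := expChart G) (f := Prod.snd)
      (contMDiffAt_expChart (E := E) (G := G))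
      (contMDiffAt_iff_contDiffAt.2 contDiff_snd.contDiffAt)
  refine ContMDiffAt.comp (0 : E × E) (g := logChart E) (I' := 𝓘(ℝ, E)) ?_ (h1.mul h2)
  simpa using contMDiffAt_logChart (E := E) (G := G)

theorem chartMul_zero_right : ∀ᶠ v in 𝓝 (0 : E), chartMul G (v, 0) = v := by
  filter_upwards [logChart_expChart (E := E) (G := G)] with v hv
  simpa [chartMul] using hv

theorem chartMul_zero_left : ∀ᶠ v in 𝓝 (0 : E), chartMul G (0, v) = v := by
  filter_upwards [logChart_expChart (E := E) (G := G)] with v hv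
  simpa [chartMul] using hv

/-- The unit laws `v·1 = v` and `1·v = v` determine the two partial derivatives. -/
theorem hasFDerivAt_chartMul_zero :
    HasFDerivAt (chartMul (E := E) G)
      (ContinuousLinearMap.fst ℝ E E + ContinuousLinearMap.snd ℝ E E) 0 := by
  have h : HasFDerivAt (chartMul (E := E) G) (fderiv ℝ (chartMul (E := E) G) 0) 0 :=
    (contDiffAt_chartMul.differentiableAt (by simp)).hasFDerivAt
  have h1 : (fderiv ℝ (chartMul (E := E) G) 0).comp (ContinuousLinearMap.inl ℝ E E) =
      ContinuousLinearMap.id ℝ E := by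
    refine HasFDerivAt.unique (f := fun v : E => chartMul G (v, 0)) (x := 0) ?_
      ((hasFDerivAt_id _).congr_of_eventuallyEq chartMul_zero_right)
    exact HasFDerivAt.comp (0 : E) (g := chartMul (E := E) G) (f := fun v : E => (v, (0 : E))) h
      (ContinuousLinearMap.inl ℝ E E).hasFDerivAt
  have h2 : (fderiv ℝ (chartMul (E := E) G) 0).comp (ContinuousLinearMap.inr ℝ E E) =
      ContinuousLinearMap.id ℝ E := by
    refine HasFDerivAt.unique (f := fun v : E => chartMul G (0, v)) (x := 0) ?_
      ((hasFDerivAt_id _).congr_of_eventuallyEq chartMul_zero_left)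
    exact HasFDerivAt.comp (0 : E) (g := chartMul (E := E) G) (f := fun v : E => ((0 : E), v)) h
      (ContinuousLinearMap.inr ℝ E E).hasFDerivAt
  convert h using 1
  ext v
  · simpa using (congrArg (fun f : E →L[ℝ] E => f v) h1).symm
  · simpa using (congrArg (fun f : E →L[ℝ] E => f v) h2).symm

theorem IsOneParameterSubgroup.mul {X Y : GroupLieAlgebra 𝓘(ℝ, E) G} {φ ψ : ℝ → G}
    [ContinuousMul G] (hφ : IsOneParameterSubgroup X φ) (hψ : IsOneParameterSubgroup Y ψ)
    (hc : ∀ s t, φ s * ψ t = ψ t * φ s) :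
    IsOneParameterSubgroup (X + Y) (fun s => φ s * ψ s) := by
  have hφ0 := hφ.map_zero
  have hψ0 := hψ.map_zero
  rw [isOneParameterSubgroup_iff] at hφ hψ ⊢
  obtain ⟨h1, h2, h3⟩ := hφ
  obtain ⟨k1, k2, k3⟩ := hψ
  refine ⟨fun s t => ?_, h2.mul k2, ?_⟩
  · rw [h1, k1, mul_assoc, mul_assoc, ← mul_assoc (φ t), hc t s]
    group
  · have h4 : HasDerivAt (fun s => (logChart E (φ s), logChart E (ψ s))) ((X : E), (Y : E)) 0 :=
      h3.prodMk k3
    have h5 := HasFDerivAt.comp_hasDerivAt (0 : ℝ) (l := chartMul (E := E) G)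
      (l' := ContinuousLinearMap.fst ℝ E E + ContinuousLinearMap.snd ℝ E E)
      (f := fun s => (logChart E (φ s), logChart E (ψ s))) (by
        rw [hφ0, hψ0, logChart_one]
        exact hasFDerivAt_chartMul_zero (E := E) (G := G)) h4
    refine HasDerivAt.congr_of_eventuallyEq h5 ?_
    have e1 : ∀ᶠ s in 𝓝 (0 : ℝ), expChart G (logChart E (φ s)) = φ s := by
      refine h2.eventually (p := fun g => expChart G (logChart E g) = g) ?_
      rw [hφ0]
      exact expChart_logChart
    have e2 : ∀ᶠ s in 𝓝 (0 : ℝ), expChart G (logChart E (ψ s)) = ψ s := by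
      refine k2.eventually (p := fun g => expChart G (logChart E g) = g) ?_
      rw [hψ0]
      exact expChart_logChart
    filter_upwards [e1, e2] with s h6 h7
    simp [chartMul, h6, h7]

end Adjoint

/-! ### The bracket as the derivative of the adjoint action -/

section Bracket

variable {E : Type*} [NormedAddCommGroup E] [NormedSpace ℝ E] [CompleteSpace E]
  {G : Type*} [TopologicalSpace G] [ChartedSpace E G] [Group G] [LieGroup 𝓘(ℝ, E) ∞ G]

theorem hasMFDerivAt_mul_left (g : G) {x : G} (hx : x = 1) :
    HasMFDerivAt 𝓘(ℝ, E) 𝓘(ℝ, E) (fun x : G => g * x) x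
      (mfderiv 𝓘(ℝ, E) 𝓘(ℝ, E) (fun x : G => g * x) 1 : E →L[ℝ] E) := by
  subst hx
  exact ((contMDiff_mul_left (I := 𝓘(ℝ, E)) (n := ∞) (a := g)).mdifferentiable (by simp)
    1).hasMFDerivAt

/-- Since `φ s = φ t * φ (s - t)`, the velocity at `t` is the left translate of the velocity at `0`.
Uniqueness of one-parameter subgroups then becomes uniqueness of integral curves. -/
theorem IsOneParameterSubgroup.isMIntegralCurve {X : GroupLieAlgebra 𝓘(ℝ, E) G} {φ : ℝ → G}
    (h : IsOneParameterSubgroup X φ) : IsMIntegralCurve φ (mulInvariantVectorField X) := by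
  intro t
  have h0 : HasMFDerivAt 𝓘(ℝ, ℝ) 𝓘(ℝ, ℝ) (fun s : ℝ => s - t) t
      (ContinuousLinearMap.id ℝ ℝ : ℝ →L[ℝ] ℝ) :=
    hasMFDerivAt_iff_hasFDerivAt.2 ((hasFDerivAt_id t).sub_const t)
  have h1 : HasMFDerivAt 𝓘(ℝ, ℝ) 𝓘(ℝ, E) φ (t - t)
      (ContinuousLinearMap.toSpanSingleton ℝ (X : E) : ℝ →L[ℝ] E) := by
    rw [sub_self]
    exact h.2
  have h2 := HasMFDerivAt.comp t (hasMFDerivAt_mul_left (E := E) (φ t) (x := φ (t - t))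
    (by rw [sub_self, h.map_zero])) (HasMFDerivAt.comp t (f := fun s : ℝ => s - t) h1 h0)
  have h3 : (fun x : G => φ t * x) ∘ φ ∘ (fun s : ℝ => s - t) = φ := by
    ext s
    simp only [Function.comp]
    rw [← h.1, add_sub_cancel]
  rw [h3] at h2
  have h4 (A : E →L[ℝ] E) (Y : E) : (A.comp ((ContinuousLinearMap.toSpanSingleton ℝ Y).comp
      (ContinuousLinearMap.id ℝ ℝ))) = (1 : ℝ →L[ℝ] ℝ).smulRight (A Y) := by
    ext
    simp
  exact (congrArg (fun L : ℝ →L[ℝ] E => HasMFDerivAt 𝓘(ℝ, ℝ) 𝓘(ℝ, E) φ t L)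
    (h4 (mfderiv 𝓘(ℝ, E) 𝓘(ℝ, E) (fun x : G => φ t * x) 1 : E →L[ℝ] E) X)).mp h2

theorem IsOneParameterSubgroup.unique [T2Space G] {X : GroupLieAlgebra 𝓘(ℝ, E) G} {φ ψ : ℝ → G}
    (hφ : IsOneParameterSubgroup X φ) (hψ : IsOneParameterSubgroup X ψ) : φ = ψ := by
  have : IsManifold 𝓘(ℝ, E) 1 G := IsManifold.of_le (n := ∞) (by exact_mod_cast le_top)
  refine isMIntegralCurve_Ioo_eq_of_contMDiff_boundaryless (I := 𝓘(ℝ, E)) (t₀ := 0) ?_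
    hφ.isMIntegralCurve hψ.isMIntegralCurve (by rw [hφ.map_zero, hψ.map_zero])
  refine (contMDiff_mulInvariantVectorField (I := 𝓘(ℝ, E)) X).of_le ?_
  rw [minSmoothness_of_isRCLikeNormedField]
  norm_num

theorem IsOneParameterSubgroup.continuous {X : GroupLieAlgebra 𝓘(ℝ, E) G} {φ : ℝ → G}
    (h : IsOneParameterSubgroup X φ) : Continuous φ :=
  continuous_iff_continuousAt.2 fun t => (h.isMIntegralCurve t).1

variable (G) in
/-- The left-invariant vector field in the chart at the identity. -/
def chartField (X : E) : E → E :=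
  mpullbackWithin 𝓘(ℝ, E) 𝓘(ℝ, E) (extChartAt 𝓘(ℝ, E) (1 : G)).symm
    (mulInvariantVectorField (I := 𝓘(ℝ, E)) (G := G) X) (range 𝓘(ℝ, E))

/-- A left-invariant field at `g` is the derivative of `x ↦ g x` at the identity applied to `X`,
hence the partial derivative of the local product in its second argument. -/
theorem chartField_eventuallyEq (X : E) :
    chartField G X =ᶠ[𝓝 (extChartAt 𝓘(ℝ, E) (1 : G) 1)]
    fun v => fderiv ℝ (chartMul (E := E) G) (v - extChartAt 𝓘(ℝ, E) (1 : G) 1, 0) (0, X) := by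
  have hd : ∀ᶠ q in 𝓝 (0 : E × E), DifferentiableAt ℝ (chartMul (E := E) G) q :=
    ((contDiffAt_chartMul (E := E) (G := G)).of_le (m := 1) (by exact_mod_cast le_top)).eventually
      (by simp) |>.mono fun q hq => hq.differentiableAt (by simp)
  have ht : Tendsto (fun v : E => (v - extChartAt 𝓘(ℝ, E) (1 : G) 1, (0 : E)))
      (𝓝 (extChartAt 𝓘(ℝ, E) (1 : G) 1)) (𝓝 0) := by
    refine Continuous.tendsto' (by fun_prop) _ _ ?_
    simp
  filter_upwards [extChartAt_target_mem_nhds (I := 𝓘(ℝ, E)) (1 : G), ht.eventually hd]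
    with v hv hvd
  have : IsManifold 𝓘(ℝ, E) 1 G := IsManifold.of_le (n := ∞) (by exact_mod_cast le_top)
  set p := extChartAt 𝓘(ℝ, E) (1 : G) 1 with hp
  set g := (extChartAt 𝓘(ℝ, E) (1 : G)).symm v with hg
  have hgs : g ∈ (chartAt E (1 : G)).source := by
    rw [← extChartAt_source 𝓘(ℝ, E)]
    exact (extChartAt 𝓘(ℝ, E) (1 : G)).map_target hv
  have hinv := ContinuousLinearMap.inverse_eq
    (mfderivWithin_extChartAt_symm_comp_mfderiv_extChartAt hv)
    (mfderiv_extChartAt_comp_mfderivWithin_extChartAt_symm hv)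
  rw [chartField, mpullbackWithin_apply, hinv, ← hg]
  have hge : expChart G (v - p) = g := by simp [expChart, hg, hp]
  have h1 := HasMFDerivAt.comp (0 : E) (hasMFDerivAt_mul_left (E := E) g (x := expChart G (0 : E))
    (by simp)) hasMFDerivAt_expChart
  have h2 : HasMFDerivAt 𝓘(ℝ, E) 𝓘(ℝ, E) (extChartAt 𝓘(ℝ, E) (1 : G)) (g * expChart G (0 : E))
      (mfderiv 𝓘(ℝ, E) 𝓘(ℝ, E) (extChartAt 𝓘(ℝ, E) (1 : G)) g : E →L[ℝ] E) := by
    have h3 : g * expChart G (0 : E) = g := by simp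
    rw [h3]
    exact (mdifferentiableAt_extChartAt hgs).hasMFDerivAt
  have h4 := hasMFDerivAt_iff_hasFDerivAt.1 (HasMFDerivAt.comp (0 : E) h2 h1)
  have h5 := HasFDerivAt.comp (0 : E) (g := chartMul (E := E) G) (f := fun t : E => (v - p, t))
    hvd.hasFDerivAt (hasFDerivAt_prodMk_right (v - p) 0)
  have h6 : chartMul (E := E) G ∘ (fun t : E => (v - p, t)) =
      fun t => extChartAt 𝓘(ℝ, E) (1 : G) (g * expChart G t) - p := by
    ext t
    simp only [Function.comp, chartMul, hge]
    rfl
  rw [h6] at h5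
  have h7 := h5.unique (HasFDerivAt.sub_const (F := E) p h4)
  have h8 := congrArg (fun f : E →L[ℝ] E => f X) h7
  refine Eq.trans ?_ h8.symm
  rfl

theorem two_le_infty : (1 + 1 : ℕ∞ω) ≤ ∞ := by
  rw [one_add_one_eq_two]
  exact WithTop.coe_le_coe.2 (le_top : (2 : ℕ∞) ≤ ⊤)

theorem fderiv_chartMul_differentiableAt :
    DifferentiableAt ℝ (fderiv ℝ (chartMul (E := E) G)) 0 :=
  ((contDiffAt_chartMul (E := E) (G := G)).fderiv_right (m := 1) two_le_infty).differentiableAt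
    (by simp)

variable (G) in
/-- The Lie bracket on the model space. -/
def modelBracket (X Y : E) : E :=
  Bracket.bracket (L := GroupLieAlgebra 𝓘(ℝ, E) G) (M := GroupLieAlgebra 𝓘(ℝ, E) G) X Y

/-- In the chart the left-invariant field of `X` is `v ↦ D₂m(v, 0) X`, with `m` the local product
and value `X` at the origin. The bracket of two such fields is thus the antisymmetrized mixed second
derivative of `m`. -/
theorem modelBracket_eq_chart (X Y : E) :
    modelBracket G X Y = fderiv ℝ (fderiv ℝ (chartMul (E := E) G)) 0 (X, 0) (0, Y) -
      fderiv ℝ (fderiv ℝ (chartMul (E := E) G)) 0 (Y, 0) (0, X) := by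
  have hM : HasFDerivAt (fderiv ℝ (chartMul (E := E) G))
      (fderiv ℝ (fderiv ℝ (chartMul (E := E) G)) 0) ((0 : E), (0 : E)) :=
    fderiv_chartMul_differentiableAt.hasFDerivAt
  set p := extChartAt 𝓘(ℝ, E) (1 : G) 1 with hp
  have h6 : fderiv ℝ (chartMul (E := E) G) ((0 : E), (0 : E)) =
    ContinuousLinearMap.fst ℝ E E + ContinuousLinearMap.snd ℝ E E :=
    (hasFDerivAt_chartMul_zero (E := E) (G := G)).fderiv
  have h1 (X Y : E) :
      fderiv ℝ (fun v => fderiv ℝ (chartMul (E := E) G) (v - p, 0) (0, X)) p Y =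
        fderiv ℝ (fderiv ℝ (chartMul (E := E) G)) 0 (Y, 0) (0, X) := by
    have h2 : HasFDerivAt (fun v : E => (v - p, (0 : E))) (ContinuousLinearMap.inl ℝ E E) p :=
      ((hasFDerivAt_id p).sub_const p).prodMk (hasFDerivAt_const (0 : E) p)
    have h3 := (HasFDerivAt.comp p (f := fun v : E => (v - p, (0 : E)))
      (by simpa using hM) h2).clm_apply (hasFDerivAt_const ((0 : E), X) p)
    refine (congrArg (fun f : E →L[ℝ] E => f Y) h3.fderiv).trans ?_
    simp
  let A : E →L[ℝ] E := mfderiv 𝓘(ℝ, E) 𝓘(ℝ, E) (extChartAt 𝓘(ℝ, E) (1 : G)) 1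
  let L : E := lieBracketWithin ℝ (chartField G X) (chartField G Y)
    ((extChartAt 𝓘(ℝ, E) (1 : G)).symm ⁻¹' univ ∩ range (id : E → E)) p
  have hbr : modelBracket G X Y = A.inverse L := rfl
  have hinv : A = ContinuousLinearMap.id ℝ E :=
    (hasMFDerivAt_extChartAt_one (E := E) (G := G)).mfderiv
  have hL : L = lieBracket ℝ (chartField G X) (chartField G Y) p := by
    simp only [L, preimage_univ, univ_inter, range_id, lieBracketWithin_univ]
  rw [hbr, hinv, ContinuousLinearMap.inverse_id, hL,
    (chartField_eventuallyEq (G := G) X).lieBracket_vectorField_eq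
      (chartField_eventuallyEq (G := G) Y)]
  simp only [lieBracket, ← hp, h1, sub_self, h6]
  simp

/-- The local conjugation in the chart at the identity. -/
def chartConj (G : Type*) [TopologicalSpace G] [ChartedSpace E G] [Group G] (q : E × E) : E :=
  logChart E (expChart G q.1 * expChart G q.2 * (expChart G q.1)⁻¹)

theorem contDiffAt_chartConj : ContDiffAt ℝ ∞ (chartConj (E := E) G) 0 := by
  rw [← contMDiffAt_iff_contDiffAt]
  have h1 : ContMDiffAt 𝓘(ℝ, E × E) 𝓘(ℝ, E) ∞ (fun q : E × E => expChart G q.1) 0 :=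
    ContMDiffAt.comp (0 : E × E) (g := expChart G) (f := Prod.fst)
      (contMDiffAt_expChart (E := E) (G := G))
      (contMDiffAt_iff_contDiffAt.2 contDiff_fst.contDiffAt)
  have h2 : ContMDiffAt 𝓘(ℝ, E × E) 𝓘(ℝ, E) ∞ (fun q : E × E => expChart G q.2) 0 :=
    ContMDiffAt.comp (0 : E × E) (g := expChart G) (f := Prod.snd)
      (contMDiffAt_expChart (E := E) (G := G))
      (contMDiffAt_iff_contDiffAt.2 contDiff_snd.contDiffAt)
  refine ContMDiffAt.comp (0 : E × E) (g := logChart E) (I' := 𝓘(ℝ, E)) ?_ ((h1.mul h2).mul h1.inv)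
  simpa using contMDiffAt_logChart (E := E) (G := G)

theorem modelAd_expChart : ∀ᶠ v in 𝓝 (0 : E), ∀ X : E,
    modelAd E (expChart G v) X = fderiv ℝ (chartConj (E := E) G) (v, 0) (0, X) := by
  have h1 : ∀ᶠ q in 𝓝 (0 : E × E), DifferentiableAt ℝ (chartConj (E := E) G) q :=
    ((contDiffAt_chartConj (E := E) (G := G)).of_le (m := 1) (by exact_mod_cast le_top)).eventually
      (by simp) |>.mono fun q hq => hq.differentiableAt (by simp)
  have h2 : Tendsto (fun v : E => (v, (0 : E))) (𝓝 0) (𝓝 0) :=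
    (continuous_id.prodMk continuous_const).tendsto' _ _ rfl
  filter_upwards [h2.eventually h1] with v hv X
  have h3 := HasFDerivAt.comp (0 : E) (g := chartConj (E := E) G) (f := fun t : E => (v, t))
    hv.hasFDerivAt (hasFDerivAt_prodMk_right v 0)
  have h4 := h3.unique (hasFDerivAt_conj_chart (E := E) (expChart G v))
  rw [← h4]
  simp

/-- The identity `(g x g⁻¹) g = g x`, differentiated in `x` at the identity. It expresses `Ad g` by
derivatives of the product alone. -/
theorem chart_conj_relation : ∀ᶠ v in 𝓝 (0 : E), ∀ X : E,
    fderiv ℝ (chartMul (E := E) G) (0, v) (modelAd E (expChart G v) X, 0) =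
      fderiv ℝ (chartMul (E := E) G) (v, 0) (0, X) := by
  have h1 : ∀ᶠ q in 𝓝 (0 : E × E), DifferentiableAt ℝ (chartMul (E := E) G) q :=
    ((contDiffAt_chartMul (E := E) (G := G)).of_le (m := 1) (by exact_mod_cast le_top)).eventually
      (by simp) |>.mono fun q hq => hq.differentiableAt (by simp)
  have h2 : Tendsto (fun v : E => (v, (0 : E))) (𝓝 0) (𝓝 0) :=
    (continuous_id.prodMk continuous_const).tendsto' _ _ rfl
  have h2' : Tendsto (fun v : E => ((0 : E), v)) (𝓝 0) (𝓝 0) :=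
    (continuous_const.prodMk continuous_id).tendsto' _ _ rfl
  filter_upwards [h2.eventually h1, h2'.eventually h1] with v hv hv' X
  have h3 := HasFDerivAt.comp (0 : E) (g := chartMul (E := E) G) (f := fun t : E => (v, t))
    hv.hasFDerivAt (hasFDerivAt_prodMk_right v 0)
  have h4 : HasFDerivAt (fun t : E => chartMul G
      (logChart E (expChart G v * expChart G t * (expChart G v)⁻¹), v))
      ((fderiv ℝ (chartMul (E := E) G) (0, v)).comp
        ((modelAd E (expChart G v)).prod (0 : E →L[ℝ] E))) 0 := by
    refine HasFDerivAt.comp (0 : E) (g := chartMul (E := E) G)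
      (f := fun t : E => (logChart E (expChart G v * expChart G t * (expChart G v)⁻¹), v)) ?_
      ((hasFDerivAt_conj_chart (E := E) (expChart G v)).prodMk (hasFDerivAt_const v 0))
    simpa using hv'.hasFDerivAt
  have h5 : (fun t : E => chartMul G
      (logChart E (expChart G v * expChart G t * (expChart G v)⁻¹), v)) =ᶠ[𝓝 0]
      chartMul (E := E) G ∘ fun t : E => (v, t) := by
    have hc : Tendsto (fun t : E => expChart G v * expChart G t * (expChart G v)⁻¹) (𝓝 0)
        (𝓝 1) := by
      have := ((contMDiff_conj (E := E) (expChart G v)).continuous.continuousAt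
        (x := expChart G (0 : E))).comp (continuousAt_expChart (E := E) (G := G))
      simpa [ContinuousAt, Function.comp_def] using this
    filter_upwards [hc.eventually (expChart_logChart (E := E) (G := G))] with t ht
    simp [chartMul, ht]
  have h6 := (h4.congr_of_eventuallyEq h5.symm).unique h3
  simpa using congrArg (fun f : E →L[ℝ] E => f X) h6

/-- Differentiating `chart_conj_relation` once more, now in `v` at the origin, expresses the
derivative of `Ad` by mixed second derivatives of the product. Their symmetry identifies it with
`modelBracket_eq_chart`. -/
theorem hasFDerivAt_modelAd_expChart (X Y : E) : ∃ A : E →L[ℝ] E,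
    HasFDerivAt (fun v : E => modelAd E (expChart G v) X) A 0 ∧
      A Y = modelBracket G Y X := by
  have hd : DifferentiableAt ℝ (fun v : E => modelAd E (expChart G v) X) 0 := by
    have h1 : DifferentiableAt ℝ (fun v : E => fderiv ℝ (chartConj (E := E) G) (v, 0) (0, X)) 0 := by
      have h2 : DifferentiableAt ℝ (fderiv ℝ (chartConj (E := E) G)) ((0 : E), (0 : E)) :=
        ((contDiffAt_chartConj (E := E) (G := G)).fderiv_right (m := 1)
          two_le_infty).differentiableAt (by simp)
      have h3 : DifferentiableAt ℝ (fun v : E => (v, (0 : E))) 0 := by fun_prop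
      exact (DifferentiableAt.comp (0 : E) (f := fun v : E => (v, (0 : E))) h2 h3).clm_apply
        (differentiableAt_const _)
    exact h1.congr_of_eventuallyEq ((modelAd_expChart (E := E) (G := G)).mono fun v hv => hv X)
  refine ⟨_, hd.hasFDerivAt, ?_⟩
  have hM : HasFDerivAt (fderiv ℝ (chartMul (E := E) G))
      (fderiv ℝ (fderiv ℝ (chartMul (E := E) G)) 0) ((0 : E), (0 : E)) :=
    fderiv_chartMul_differentiableAt.hasFDerivAt
  have hR := HasFDerivAt.comp (0 : E) (f := fun v : E => ((0 : E), v)) hM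
    (hasFDerivAt_prodMk_right 0 0)
  have hL := HasFDerivAt.comp (0 : E) (f := fun v : E => (v, (0 : E))) hM
    (hasFDerivAt_prodMk_left 0 0)
  have h1 := hR.clm_apply (hd.hasFDerivAt.prodMk (hasFDerivAt_const (0 : E) 0))
  have h2 := hL.clm_apply (hasFDerivAt_const ((0 : E), X) (0 : E))
  have h3 := (h1.congr_of_eventuallyEq
    ((chart_conj_relation (E := E) (G := G)).mono fun v hv => (hv X).symm)).unique h2
  have h4 := congrArg (fun f : E →L[ℝ] E => f Y) h3
  have h5 : modelAd E (1 : G) X = X := Ad_one_apply (E := E) X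
  have h6 : fderiv ℝ (chartMul (E := E) G) ((0 : E), (0 : E)) =
    ContinuousLinearMap.fst ℝ E E + ContinuousLinearMap.snd ℝ E E :=
    (hasFDerivAt_chartMul_zero (E := E) (G := G)).fderiv
  have hs : IsSymmSndFDerivAt ℝ (chartMul (E := E) G) 0 :=
    (contDiffAt_chartMul (E := E) (G := G)).isSymmSndFDerivAt (by
      rw [minSmoothness_of_isRCLikeNormedField, ← one_add_one_eq_two]; exact two_le_infty)
  rw [modelBracket_eq_chart, hs (X, 0) (0, Y)]
  simp [h5, h6] at h4
  rw [← h4]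
  abel

theorem IsOneParameterSubgroup.hasDerivAt_Ad_zero {Y : GroupLieAlgebra 𝓘(ℝ, E) G} {φ : ℝ → G}
    (h : IsOneParameterSubgroup Y φ) (X : E) :
    HasDerivAt (fun s => modelAd E (φ s) X) (modelBracket G Y X) 0 := by
  obtain ⟨A, hA, hY⟩ := hasFDerivAt_modelAd_expChart (E := E) (G := G) X Y
  have h0 := h.map_zero
  obtain ⟨-, h2, h3⟩ := isOneParameterSubgroup_iff.1 h
  have h4 := HasFDerivAt.comp_hasDerivAt (0 : ℝ) (l := fun v : E => modelAd E (expChart G v) X)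
    (l' := A) (f := fun s => logChart E (φ s)) (by
      rw [h0, logChart_one]
      exact hA) h3
  rw [hY] at h4
  refine HasDerivAt.congr_of_eventuallyEq h4 ?_
  have e1 : ∀ᶠ s in 𝓝 (0 : ℝ), expChart G (logChart E (φ s)) = φ s := by
    refine h2.eventually (p := fun g => expChart G (logChart E g) = g) ?_
    rw [h0]
    exact expChart_logChart
  filter_upwards [e1] with s h6
  simp [h6]

theorem IsOneParameterSubgroup.hasDerivAt_Ad {Y : GroupLieAlgebra 𝓘(ℝ, E) G} {φ : ℝ → G}
    (h : IsOneParameterSubgroup Y φ) (X : E) (s : ℝ) :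
    HasDerivAt (fun s => modelAd E (φ s) X) (modelAd E (φ s) (modelBracket G Y X)) s := by
  have h1 : HasDerivAt (fun t => modelAd E (φ (t - s)) X) (modelBracket G Y X) s := by
    have h2 : HasDerivAt (fun t : ℝ => t - s) 1 s := (hasDerivAt_id s).sub_const s
    have := HasDerivAt.scomp (F := E) (g₁ := fun s => modelAd E (φ s) X) (h := fun t => t - s) s
      (by rw [sub_self]; exact h.hasDerivAt_Ad_zero X) h2
    rw [one_smul] at this
    exact this
  have h2 := (modelAd E (φ s)).hasFDerivAt.comp_hasDerivAt s h1
  refine h2.congr_of_eventuallyEq (Eventually.of_forall fun t => ?_)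
  have h3 : φ t = φ s * φ (t - s) := by rw [← h.1, add_sub_cancel]
  simp only [Function.comp]
  conv_lhs => rw [h3]
  exact Ad_mul_apply (E := E) _ _ _

end Bracket

/-! ### One-parameter subgroups as limits of powers -/

section Powers

variable {E : Type*} [NormedAddCommGroup E] [NormedSpace ℝ E] [CompleteSpace E]
  {G : Type*} [TopologicalSpace G] [ChartedSpace E G] [Group G] [LieGroup 𝓘(ℝ, E) ∞ G]

/-- The function `y ↦ m(x, y) - y` has value `x` at `y = 0`, and its derivative vanishes for `x =
0`. A Lipschitz bound on the derivative of `m` makes that derivative `O(‖x‖)`, and the mean value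
inequality gives the bilinear error. -/
theorem norm_chartMul_sub_le : ∃ C > 0, ∃ r > 0, ∀ x y : E, ‖x‖ ≤ r → ‖y‖ ≤ r →
    ‖chartMul G (x, y) - x - y‖ ≤ C * ‖x‖ * ‖y‖ := by
  have hc1 : ContDiffAt ℝ 1 (fderiv ℝ (chartMul (E := E) G)) 0 :=
    (contDiffAt_chartMul (E := E) (G := G)).fderiv_right (m := 1) two_le_infty
  obtain ⟨K, t, ht, hK⟩ := hc1.exists_lipschitzOnWith
  have h1 : ∀ᶠ q in 𝓝 (0 : E × E), DifferentiableAt ℝ (chartMul (E := E) G) q :=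
    ((contDiffAt_chartMul (E := E) (G := G)).of_le (m := 1) (by exact_mod_cast le_top)).eventually
      (by simp) |>.mono fun q hq => hq.differentiableAt (by simp)
  obtain ⟨r₁, hr₁, h₁⟩ := Metric.eventually_nhds_iff_ball.1 (h1.and ht)
  obtain ⟨r₂, hr₂, h₂⟩ := Metric.eventually_nhds_iff_ball.1
    (chartMul_zero_left (E := E) (G := G))
  obtain ⟨r₃, hr₃, h₃⟩ := Metric.eventually_nhds_iff_ball.1
    (chartMul_zero_right (E := E) (G := G))
  -- The Lipschitz constant `K` may be zero, and a positive constant is wanted; halving the radius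
  -- turns the closed bounds into strict ones.
  refine ⟨K + 1, by positivity, min r₁ (min r₂ r₃) / 2, by positivity, fun x y hx hy => ?_⟩
  have hr : 0 < min r₁ (min r₂ r₃) := by positivity
  have hlt (x : E) (hx : ‖x‖ ≤ min r₁ (min r₂ r₃) / 2) : ‖x‖ < r₁ ∧ ‖x‖ < r₂ ∧ ‖x‖ < r₃ := by
    have : ‖x‖ < min r₁ (min r₂ r₃) := by linarith
    simpa [lt_min_iff] using this
  have hmem (x y : E) (hx : ‖x‖ < r₁) (hy : ‖y‖ < r₁) : (x, y) ∈ Metric.ball (0 : E × E) r₁ := by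
    simp [Prod.norm_def, hx, hy]
  have hder : ∀ u ∈ Metric.closedBall (0 : E) (min r₁ (min r₂ r₃) / 2),
      HasFDerivWithinAt (fun u => chartMul G (x, u) - u)
        ((fderiv ℝ (chartMul (E := E) G) (x, u)).comp (ContinuousLinearMap.inr ℝ E E) -
          ContinuousLinearMap.id ℝ E) (Metric.closedBall (0 : E) (min r₁ (min r₂ r₃) / 2)) u := by
    intro u hu
    have hu' := hlt u (by simpa using hu)
    have h4 := (h₁ _ (hmem x u (hlt x hx).1 hu'.1)).1.hasFDerivAt
    exact ((HasFDerivAt.comp u (g := chartMul (E := E) G) (f := fun t : E => (x, t)) h4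
      (hasFDerivAt_prodMk_right x u)).sub (hasFDerivAt_id u)).hasFDerivWithinAt
  have hbound : ∀ u ∈ Metric.closedBall (0 : E) (min r₁ (min r₂ r₃) / 2),
      ‖(fderiv ℝ (chartMul (E := E) G) (x, u)).comp (ContinuousLinearMap.inr ℝ E E) -
          ContinuousLinearMap.id ℝ E‖ ≤ (K + 1) * ‖x‖ := by
    intro u hu
    have hu' := hlt u (by simpa using hu)
    have h4 := (h₁ _ (hmem 0 u (by simpa using hr₁) hu'.1)).1.hasFDerivAt
    have h5 : (fderiv ℝ (chartMul (E := E) G) (0, u)).comp (ContinuousLinearMap.inr ℝ E E) =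
        ContinuousLinearMap.id ℝ E := by
      refine (HasFDerivAt.comp u (g := chartMul (E := E) G) (f := fun t : E => ((0 : E), t)) h4
        (hasFDerivAt_prodMk_right 0 u)).unique ((hasFDerivAt_id u).congr_of_eventuallyEq ?_)
      have : Metric.ball (0 : E) r₂ ∈ 𝓝 u := Metric.isOpen_ball.mem_nhds (by simpa using hu'.2.1)
      filter_upwards [this] with w hw
      exact h₂ w hw
    rw [← h5, ← ContinuousLinearMap.sub_comp]
    have h6 := hK.dist_le_mul _ (h₁ _ (hmem x u (hlt x hx).1 hu'.1)).2 _
      (h₁ _ (hmem 0 u (by simpa using hr₁) hu'.1)).2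
    rw [dist_eq_norm, dist_eq_norm] at h6
    have h7 : ‖((x, u) : E × E) - (0, u)‖ = ‖x‖ := by simp [Prod.norm_def]
    rw [h7] at h6
    calc _ ≤ ‖fderiv ℝ (chartMul (E := E) G) (x, u) - fderiv ℝ (chartMul (E := E) G) (0, u)‖ *
          ‖ContinuousLinearMap.inr ℝ E E‖ := ContinuousLinearMap.opNorm_comp_le _ _
      _ ≤ (K * ‖x‖) * 1 := by
          gcongr
          exact ContinuousLinearMap.norm_inr_le_one ℝ E E
      _ ≤ _ := by nlinarith [norm_nonneg x]
  have h8 := (convex_closedBall (0 : E) (min r₁ (min r₂ r₃) / 2)).norm_image_sub_le_of_norm_hasFDerivWithin_le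
    hder hbound (x := 0) (y := y) (by simp; positivity) (by simpa using hy)
  have h9 := h₃ x (by simpa using (hlt x hx).2.2)
  rw [h9] at h8
  calc _ = ‖chartMul G (x, y) - y - (x - 0)‖ := by congr 1; abel
    _ ≤ _ := by simpa using h8

variable [ContinuousMul G]

/-- A ball in the chart at the identity on which the multiplication is controlled. -/
theorem exists_chart_ball : ∃ C > 0, ∃ r > 0,
    (∀ x : E, ‖x‖ ≤ r → logChart E (expChart G x) = x ∧ ContinuousAt (expChart G) x) ∧
    ∀ x y : E, ‖x‖ ≤ r → ‖y‖ ≤ r →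
      expChart G x * expChart G y = expChart G (chartMul G (x, y)) ∧
      ‖chartMul G (x, y) - x - y‖ ≤ C * ‖x‖ * ‖y‖ := by
  obtain ⟨C, hC, r₁, hr₁, h₁⟩ := norm_chartMul_sub_le (E := E) (G := G)
  have hm : ∀ᶠ q in 𝓝 (0 : E × E),
      expChart G (chartMul G (q.1, q.2)) = expChart G q.1 * expChart G q.2 := by
    have h2 : Tendsto (fun q : E × E => expChart G q.1 * expChart G q.2) (𝓝 0) (𝓝 1) := by
      have h3 : ContinuousAt (fun q : E × E => expChart G q.1) 0 :=
        ContinuousAt.comp (g := expChart G) (f := Prod.fst) continuousAt_expChart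
          continuous_fst.continuousAt
      have h4 : ContinuousAt (fun q : E × E => expChart G q.2) 0 :=
        ContinuousAt.comp (g := expChart G) (f := Prod.snd) continuousAt_expChart
          continuous_snd.continuousAt
      have h5 : ContinuousAt (fun q : E × E => expChart G q.1 * expChart G q.2) 0 := h3.mul h4
      simpa [ContinuousAt] using h5
    exact h2.eventually expChart_logChart
  obtain ⟨r₂, hr₂, h₂⟩ := Metric.eventually_nhds_iff_ball.1 hm
  obtain ⟨r₃, hr₃, h₃⟩ := Metric.eventually_nhds_iff_ball.1
    (logChart_expChart (E := E) (G := G))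
  have ht : ∀ᶠ v in 𝓝 (0 : E), ContinuousAt (expChart G) v := by
    have h : ∀ᶠ v in 𝓝 (0 : E), v + extChartAt 𝓘(ℝ, E) (1 : G) 1 ∈
        (extChartAt 𝓘(ℝ, E) (1 : G)).target := by
      have hc : Tendsto (fun v : E => v + extChartAt 𝓘(ℝ, E) (1 : G) 1) (𝓝 0)
          (𝓝 (extChartAt 𝓘(ℝ, E) (1 : G) 1)) :=
        (by fun_prop : Continuous fun v : E => v + extChartAt 𝓘(ℝ, E) (1 : G) 1).tendsto' _ _
          (zero_add _)
      exact hc.eventually (extChartAt_target_mem_nhds (I := 𝓘(ℝ, E)) (1 : G))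
    filter_upwards [h] with v hv
    exact ContinuousAt.comp (g := (extChartAt 𝓘(ℝ, E) (1 : G)).symm)
      (f := fun v : E => v + extChartAt 𝓘(ℝ, E) (1 : G) 1)
      (continuousAt_extChartAt_symm'' hv) (by fun_prop)
  obtain ⟨r₄, hr₄, h₄⟩ := Metric.eventually_nhds_iff_ball.1 ht
  refine ⟨C, hC, min (min r₁ r₂) (min r₃ r₄) / 2, by positivity, fun x hx => ?_,
    fun x y hx hy => ?_⟩
  all_goals
    have hr : 0 < min (min r₁ r₂) (min r₃ r₄) := by positivity
    have hlt (x : E) (hx : ‖x‖ ≤ min (min r₁ r₂) (min r₃ r₄) / 2) :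
        (‖x‖ < r₁ ∧ ‖x‖ < r₂) ∧ ‖x‖ < r₃ ∧ ‖x‖ < r₄ := by
      have : ‖x‖ < min (min r₁ r₂) (min r₃ r₄) := by linarith
      simpa [lt_min_iff] using this
  · exact ⟨h₃ x (by simpa using (hlt x hx).2.1), h₄ x (by simpa using (hlt x hx).2.2)⟩
  · refine ⟨(h₂ (x, y) ?_).symm, h₁ x y (hlt x hx).1.1.le (hlt y hy).1.1.le⟩
    simp [Prod.norm_def, (hlt x hx).1.2, (hlt y hy).1.2]

/-- As long as `k‖v‖` is small, the `k`-th power stays in the chart and equals `k v` up to a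
quadratic error, uniformly in `k`. This uniformity is what survives the limit `v → 0`, `k → ∞`. -/
theorem exists_pow_expChart : ∃ C > 0, ∃ δ > 0, ∃ r > 0,
    (∀ x : E, ‖x‖ ≤ r → logChart E (expChart G x) = x ∧ ContinuousAt (expChart G) x) ∧
    ∀ (v : E) (k : ℕ), k * ‖v‖ ≤ δ →
      ∃ q : E, expChart G v ^ k = expChart G q ∧ ‖q‖ ≤ r ∧ ‖q - (k : ℝ) • v‖ ≤ C * (k * ‖v‖) ^ 2 := by
  obtain ⟨C, hC, r, hr, h1, h2⟩ := exists_chart_ball (E := E) (G := G)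
  -- If `k‖v‖ ≤ 1/(2C)`, the error bound forces `‖q‖ ≤ 2k‖v‖`. One more factor then costs at most
  -- `2Ck‖v‖²`, which is absorbed since `k² + k ≤ (k + 1)²`. The bound `r / 2` keeps `q` in the ball
  -- of radius `r`.
  refine ⟨2 * C, by positivity, min (r / 2) (1 / (2 * C)), by positivity, r, hr, h1, fun v k => ?_⟩
  have hnorm (k : ℕ) (q : E) (hk : k * ‖v‖ ≤ min (r / 2) (1 / (2 * C)))
      (hq : ‖q - (k : ℝ) • v‖ ≤ 2 * C * (k * ‖v‖) ^ 2) : ‖q‖ ≤ 2 * (k * ‖v‖) := by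
    obtain ⟨-, hk2⟩ := le_min_iff.1 hk
    rw [le_div_iff₀ (by positivity)] at hk2
    have h3 : ‖q‖ ≤ ‖q - (k : ℝ) • v‖ + ‖(k : ℝ) • v‖ := by
      simpa using norm_add_le (q - (k : ℝ) • v) ((k : ℝ) • v)
    rw [norm_smul, Real.norm_natCast] at h3
    have h4 : 0 ≤ k * ‖v‖ := by positivity
    nlinarith
  induction k with
  | zero => exact fun _ => ⟨0, by simp, by simpa using hr.le, by simp⟩
  | succ k ih =>
    intro hk
    have hk' : k * ‖v‖ ≤ min (r / 2) (1 / (2 * C)) := by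
      refine le_trans ?_ hk
      push_cast
      nlinarith [norm_nonneg v]
    obtain ⟨q, hq1, hq2, hq3⟩ := ih hk'
    have hqn := hnorm k q hk' hq3
    have hv : ‖v‖ ≤ r := by
      have h5 := (le_min_iff.1 hk).1
      push_cast at h5
      have h6 : 0 ≤ k * ‖v‖ := by positivity
      linarith
    obtain ⟨h6, h7⟩ := h2 q v hq2 hv
    have h8 : ‖chartMul G (q, v) - ((k + 1 : ℕ) : ℝ) • v‖ ≤
        2 * C * (((k + 1 : ℕ) : ℝ) * ‖v‖) ^ 2 := by
      have h9 : chartMul G (q, v) - ((k + 1 : ℕ) : ℝ) • v =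
          (chartMul G (q, v) - q - v) + (q - (k : ℝ) • v) := by
        push_cast
        rw [add_smul, one_smul]
        abel
      rw [h9]
      refine (norm_add_le _ _).trans ((add_le_add h7 hq3).trans ?_)
      have h10 : C * ‖q‖ * ‖v‖ ≤ C * (2 * (k * ‖v‖)) * ‖v‖ := by gcongr
      push_cast
      have h11 : 0 ≤ C * (‖v‖ * ‖v‖) := by positivity
      have h12 : 0 ≤ (k : ℝ) * (C * (‖v‖ * ‖v‖)) := by positivity
      nlinarith
    refine ⟨_, by rw [pow_succ, hq1, h6], ?_, h8⟩
    refine (hnorm (k + 1) _ hk h8).trans ?_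
    have := (le_min_iff.1 hk).1
    linarith

end Powers

section PowerLimit

variable {E : Type*} [NormedAddCommGroup E] [NormedSpace ℝ E] [CompleteSpace E]
  {G : Type*} [TopologicalSpace G] [ChartedSpace E G] [Group G] [LieGroup 𝓘(ℝ, E) ∞ G]

theorem hasFDerivAt_inv_chart [IsTopologicalGroup G] :
    HasFDerivAt (fun v : E => logChart E (expChart G v)⁻¹) (-ContinuousLinearMap.id ℝ E) 0 := by
  have hd : ContDiffAt ℝ ∞ (fun v : E => logChart E (expChart G v)⁻¹) 0 := by
    rw [← contMDiffAt_iff_contDiffAt]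
    refine ContMDiffAt.comp (0 : E) (g := logChart E) (I' := 𝓘(ℝ, E)) ?_
      (contMDiffAt_expChart (E := E) (G := G)).inv
    simpa using contMDiffAt_logChart (E := E) (G := G)
  have h1 := (hd.differentiableAt (by simp)).hasFDerivAt
  have h2 := HasFDerivAt.comp (0 : E) (g := chartMul (E := E) G)
    (f := fun v : E => (v, logChart E (expChart G v)⁻¹)) (by
      rw [expChart_zero, inv_one, logChart_one]
      exact hasFDerivAt_chartMul_zero (E := E) (G := G)) ((hasFDerivAt_id (0 : E)).prodMk h1)
  have h3 : (chartMul (E := E) G ∘ fun v : E => (v, logChart E (expChart G v)⁻¹)) =ᶠ[𝓝 0]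
      fun _ => (0 : E) := by
    have hc : Tendsto (fun v : E => (expChart G v)⁻¹) (𝓝 0) (𝓝 1) := by
      have h4 : ContinuousAt (fun v : E => (expChart G v)⁻¹) 0 := continuousAt_expChart.inv
      simpa [ContinuousAt] using h4
    filter_upwards [hc.eventually (expChart_logChart (E := E) (G := G))] with v hv
    simp [chartMul, hv]
  have h4 := (h2.congr_of_eventuallyEq h3.symm).unique (hasFDerivAt_const (0 : E) (0 : E))
  convert h1 using 1
  ext v
  have h5 := congrArg (fun f : E →L[ℝ] E => f v) h4
  simp at h5
  simpa using (eq_neg_of_add_eq_zero_right h5).symm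

/-- A homomorphism from the reals with the right one-sided behaviour at the origin is a
one-parameter subgroup. -/
theorem isOneParameterSubgroup_of_right [IsTopologicalGroup G] {φ : ℝ → G} {V : E}
    (hadd : ∀ s t, φ (s + t) = φ s * φ t)
    (hc : ContinuousWithinAt φ (Ici 0) 0)
    (hd : HasDerivWithinAt (fun s => logChart E (φ s)) V (Ici 0) 0) :
    IsOneParameterSubgroup (E := E) (G := G) V φ := by
  have h0 : φ 0 = 1 := by simpa using hadd 0 0
  have hneg (s : ℝ) : φ s = (φ (-s))⁻¹ := by
    have := hadd s (-s)
    rw [add_neg_cancel, h0] at this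
    exact eq_inv_of_mul_eq_one_left this.symm
  have hm : MapsTo (fun s : ℝ => -s) (Iic 0) (Ici 0) := fun s hs => by simpa using hs
  have hcneg : ContinuousWithinAt (fun s => φ (-s)) (Iic 0) 0 :=
    ContinuousWithinAt.comp (g := φ) (f := fun s : ℝ => -s) (t := Ici 0) (by simpa using hc)
      (by fun_prop) hm
  have hc' : ContinuousWithinAt φ (Iic 0) 0 := by
    have := hcneg.inv
    refine this.congr (fun s _ => hneg s) (hneg 0)
  have hu : (Iic 0 ∪ Ici 0 : Set ℝ) = univ := Iic_union_Ici
  have hcont : ContinuousAt φ 0 := by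
    rw [← continuousWithinAt_univ, ← hu]
    exact hc'.union hc
  refine isOneParameterSubgroup_iff.2 ⟨hadd, hcont, ?_⟩
  have hd1 : HasDerivWithinAt (fun s => logChart E (φ (-s))) (-V) (Iic 0) 0 := by
    have := HasDerivWithinAt.scomp (g₁ := fun s => logChart E (φ s)) (h := fun s : ℝ => -s)
      (t' := Ici 0) (0 : ℝ) (by simpa using hd) (hasDerivAt_neg (0 : ℝ)).hasDerivWithinAt hm
    simpa [Function.comp_def] using this
  have hd2 := HasFDerivAt.comp_hasDerivWithinAt (0 : ℝ)
    (l := fun v : E => logChart E (expChart G v)⁻¹) (l' := -ContinuousLinearMap.id ℝ E)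
    (f := fun s => logChart E (φ (-s))) (by
      simpa [h0] using hasFDerivAt_inv_chart (E := E) (G := G)) hd1
  have hd3 : HasDerivWithinAt (fun s => logChart E (φ s)) V (Iic 0) 0 := by
    have e1 : ∀ᶠ s in 𝓝[Iic 0] (0 : ℝ), expChart G (logChart E (φ (-s))) = φ (-s) := by
      refine hcneg.eventually (p := fun g => expChart G (logChart E g) = g) ?_
      beta_reduce
      rw [neg_zero, h0]
      exact expChart_logChart
    have h6 : (-ContinuousLinearMap.id ℝ E) (-V) = V := by simp
    rw [h6] at hd2
    refine hd2.congr_of_eventuallyEq ?_ (by simp [h0])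
    filter_upwards [e1] with s hs
    simp only [Function.comp, hs]
    rw [← hneg]
  rw [← hasDerivWithinAt_univ, ← hu]
  exact hd3.union hd

variable [IsTopologicalGroup G] [CompactSpace G] [T2Space G] [FiniteDimensional ℝ E]

/-- If small elements of a closed subgroup have directions converging to `V`, then their powers
`⌊s/ε⌋` converge to a one-parameter subgroup with velocity `V` inside that subgroup. An ultrafilter
with compactness of `G` supplies all limits at once, without subsequences. -/
theorem exists_isOneParameterSubgroup_of_tendsto {ι : Type*} (l : Ultrafilter ι) {H : Subgroup G}
    (hH : IsClosed (H : Set G)) {v : ι → E} {ε : ι → ℝ} {V : E} (hε : ∀ᶠ i in l, 0 < ε i)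
    (hε0 : Tendsto ε l (𝓝 0)) (hV : Tendsto (fun i => (ε i)⁻¹ • v i) l (𝓝 V))
    (hmem : ∀ᶠ i in l, expChart G (v i) ∈ H) :
    ∃ φ : ℝ → G, IsOneParameterSubgroup (E := E) (G := G) V φ ∧ ∀ s, φ s ∈ H := by
  obtain ⟨C, hC, δ, hδ, r, hr, h1, h2⟩ := exists_pow_expChart (E := E) (G := G)
  let F : ℝ → ι → G := fun s i => expChart G (v i) ^ ⌊s / ε i⌋
  have hlim (s : ℝ) : ∃ g, Tendsto (F s) l (𝓝 g) := by
    obtain ⟨g, -, hg⟩ := isCompact_univ.ultrafilter_le_nhds (l.map (F s)) (by simp)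
    exact ⟨g, hg⟩
  choose φ hφ using hlim
  have hmemφ (s : ℝ) : φ s ∈ H := by
    refine hH.mem_of_tendsto (hφ s) (hmem.mono fun i hi => ?_)
    exact H.zpow_mem hi _
  have hv0 : Tendsto v l (𝓝 0) := by
    have := hε0.smul hV
    rw [zero_smul] at this
    refine this.congr' (hε.mono fun i hi => ?_)
    simp only [smul_smul]
    rw [mul_inv_cancel₀ hi.ne', one_smul]
  have hexp : Tendsto (fun i => expChart G (v i)) l (𝓝 1) := by
    have := (continuousAt_expChart (E := E) (G := G)).tendsto.comp hv0
    rwa [expChart_zero] at this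
  have hadd (s t : ℝ) : φ (s + t) = φ s * φ t := by
    -- The floor is additive up to `0` or `1`, and one extra factor tends to the identity, so the
    -- limit is a homomorphism.
    let d : ι → ℤ := fun i => ⌊(s + t) / ε i⌋ - ⌊s / ε i⌋ - ⌊t / ε i⌋
    have hd (i : ι) : d i = 0 ∨ d i = 1 := by
      have a1 := Int.le_floor_add (s / ε i) (t / ε i)
      have a2 := Int.le_floor_add_floor (s / ε i) (t / ε i)
      simp only [d, add_div]
      omega
    have hdl : Tendsto (fun i => expChart G (v i) ^ d i) l (𝓝 1) := by
      intro U hU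
      refine mem_map.2 (mem_of_superset (mem_map.1 (hexp hU)) fun i hi => ?_)
      rcases hd i with h | h
      · simpa [h] using mem_of_mem_nhds hU
      · simpa [h] using mem_preimage.1 hi
    have h3 := ((hφ s).mul (hφ t)).mul hdl
    rw [mul_one] at h3
    refine tendsto_nhds_unique (hφ (s + t)) (h3.congr fun i => ?_)
    simp only [F, d]
    rw [← zpow_add, ← zpow_add]
    congr 1
    ring
  have hk (s : ℝ) (hs : 0 ≤ s) :
      Tendsto (fun i => (⌊s / ε i⌋₊ : ℝ) • v i) l (𝓝 (s • V)) := by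
    have h3 : Tendsto (fun i => (⌊s / ε i⌋₊ : ℝ) * ε i) l (𝓝 s) := by
      have h4 : Tendsto (fun i => s - ε i) l (𝓝 s) := by
        simpa using tendsto_const_nhds.sub hε0
      refine tendsto_of_tendsto_of_tendsto_of_le_of_le' h4 tendsto_const_nhds
        (hε.mono fun i hi => ?_) (hε.mono fun i hi => ?_)
      · have := Nat.lt_floor_add_one (s / ε i)
        rw [div_lt_iff₀ hi] at this
        linarith
      · have := Nat.floor_le (div_nonneg hs hi.le)
        rwa [le_div_iff₀ hi] at this
    refine (h3.smul hV).congr' (hε.mono fun i hi => ?_)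
    rw [smul_smul, mul_assoc, mul_inv_cancel₀ hi.ne', mul_one]
  -- The uniform estimate on powers passes to the limit, the coordinates `q` converging in a compact
  -- ball. The resulting bound `O(s²)` yields the right derivative at `0`.
  have hest (s : ℝ) (hs : 0 ≤ s) (hsδ : s * ‖V‖ < δ) : ∃ q : E, ‖q‖ ≤ r ∧ φ s = expChart G q ∧
      ‖q - s • V‖ ≤ C * (s * ‖V‖) ^ 2 := by
    have h3 : Tendsto (fun i => (⌊s / ε i⌋₊ : ℝ) * ‖v i‖) l (𝓝 (s * ‖V‖)) := by
      have := (hk s hs).norm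
      simpa [norm_smul, abs_of_nonneg hs] using this
    have h4 : ∀ᶠ i in l, ∃ q : E, F s i = expChart G q ∧ ‖q‖ ≤ r ∧
        ‖q - (⌊s / ε i⌋₊ : ℝ) • v i‖ ≤ C * (⌊s / ε i⌋₊ * ‖v i‖) ^ 2 := by
      filter_upwards [h3.eventually (gt_mem_nhds hsδ), hε] with i hi hεi
      obtain ⟨q, hq⟩ := h2 (v i) ⌊s / ε i⌋₊ hi.le
      refine ⟨q, ?_, hq.2⟩
      rw [← hq.1]
      simp only [F]
      rw [← Int.natCast_floor_eq_floor (div_nonneg hs hεi.le), zpow_natCast]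
    obtain ⟨q, hq⟩ := h4.choice
    have hprop := FiniteDimensional.proper ℝ E
    obtain ⟨q₀, hq₀, hlq⟩ := (isCompact_closedBall (0 : E) r).ultrafilter_le_nhds (l.map q) (by
      simp only [Ultrafilter.coe_map, le_principal_iff, mem_map]
      filter_upwards [hq] with i hi
      simpa using hi.2.1)
    have hlq' : Tendsto q l (𝓝 q₀) := hlq
    have hq₀' : ‖q₀‖ ≤ r := by simpa using hq₀
    refine ⟨q₀, hq₀', ?_, ?_⟩
    · refine tendsto_nhds_unique (hφ s) ?_
      refine ((h1 q₀ hq₀').2.tendsto.comp hlq').congr' (hq.mono fun i hi => hi.1.symm)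
    · exact le_of_tendsto_of_tendsto (hlq'.sub (hk s hs)).norm ((h3.pow 2).const_mul C)
        (hq.mono fun i hi => hi.2.2)
  have h0 : φ 0 = 1 := by simpa using hadd 0 0
  have hsmall : ∀ᶠ s in 𝓝[Ici 0] (0 : ℝ), ∃ q : E, ‖q‖ ≤ r ∧ φ s = expChart G q ∧
      ‖q - s • V‖ ≤ C * (s * ‖V‖) ^ 2 := by
    have h3 : Tendsto (fun s : ℝ => s * ‖V‖) (𝓝[Ici 0] 0) (𝓝 0) :=
      tendsto_nhdsWithin_of_tendsto_nhds ((by fun_prop :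
        Continuous fun s : ℝ => s * ‖V‖).tendsto' _ _ (zero_mul _))
    filter_upwards [h3.eventually (gt_mem_nhds hδ), self_mem_nhdsWithin] with s hs hs'
    exact hest s hs' hs
  have hsmall' : ∀ᶠ s in 𝓝[Ici 0] (0 : ℝ), φ s = expChart G (logChart E (φ s)) ∧
      ‖logChart E (φ s) - s • V‖ ≤ C * (s * ‖V‖) ^ 2 := by
    filter_upwards [hsmall] with s ⟨q, hq1, hq2, hq3⟩
    rw [hq2, (h1 q hq1).1]
    exact ⟨rfl, hq3⟩
  have hderiv : HasDerivWithinAt (fun s => logChart E (φ s)) V (Ici 0) 0 := by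
    rw [hasDerivWithinAt_iff_isLittleO]
    simp only [h0, logChart_one, sub_zero]
    refine (Asymptotics.IsBigO.of_bound (C * ‖V‖ ^ 2) (g := fun s : ℝ => s ^ 2) ?_).trans_isLittleO
      ((Asymptotics.isLittleO_pow_id (by norm_num)).mono nhdsWithin_le_nhds)
    filter_upwards [hsmall'] with s hs
    refine hs.2.trans (le_of_eq ?_)
    rw [Real.norm_eq_abs, abs_of_nonneg (sq_nonneg s)]
    ring
  refine ⟨φ, isOneParameterSubgroup_of_right hadd ?_ hderiv, hmemφ⟩
  have h3 := hderiv.continuousWithinAt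
  have h4 : ContinuousWithinAt (fun s => expChart G (logChart E (φ s))) (Ici 0) 0 :=
    ContinuousAt.comp_continuousWithinAt (g := expChart G) (f := fun s => logChart E (φ s))
      (by rw [h0, logChart_one]; exact continuousAt_expChart) h3
  refine h4.congr_of_eventuallyEq (hsmall'.mono fun s hs => hs.1) (by simp [h0])

/-- Every element of the Lie algebra is the velocity of a one-parameter subgroup. -/
theorem exists_isOneParameterSubgroup (X : GroupLieAlgebra 𝓘(ℝ, E) G) :
    ∃ φ : ℝ → G, IsOneParameterSubgroup X φ := by
  have hX (n : ℕ) : (((n : ℝ) + 1)⁻¹)⁻¹ • ((n : ℝ) + 1)⁻¹ • (X : E) = X := by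
    rw [inv_inv, smul_smul, mul_inv_cancel₀ (by positivity), one_smul]
  obtain ⟨φ, hφ, -⟩ := exists_isOneParameterSubgroup_of_tendsto (E := E) (G := G)
    (hyperfilter ℕ) (H := ⊤) isClosed_univ (v := fun n => ((n : ℝ) + 1)⁻¹ • (X : E))
    (ε := fun n => ((n : ℝ) + 1)⁻¹) (V := X) (Eventually.of_forall fun n => by positivity)
    (((tendsto_one_div_add_atTop_nhds_zero_nat (𝕜 := ℝ)).mono_left Nat.hyperfilter_le_atTop).congr
      fun n => one_div _) (tendsto_const_nhds.congr fun n => (hX n).symm)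
    (Eventually.of_forall fun n => Subgroup.mem_top _)
  exact ⟨φ, hφ⟩

end PowerLimit

/-! ### Lie algebra and maximal tori -/

section Tori

variable {E : Type*} [NormedAddCommGroup E] [NormedSpace ℝ E] [CompleteSpace E]
  {G : Type*} [TopologicalSpace G] [ChartedSpace E G] [Group G] [LieGroup 𝓘(ℝ, E) ∞ G]
  [IsTopologicalGroup G] [T2Space G]

/-- The curve `s ↦ Ad (ψ s) X` has derivative `Ad (ψ s) ⁅Y, X⁆ = 0`, so it is constant. -/
theorem Ad_eq_self_of_bracket_eq_zero {X Y : GroupLieAlgebra 𝓘(ℝ, E) G} {ψ : ℝ → G}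
    (hψ : IsOneParameterSubgroup Y ψ) (h : ⁅Y, X⁆ = 0) (t : ℝ) : Ad (ψ t) X = X := by
  have h1 (t : ℝ) : HasDerivAt (F := E) (fun s => modelAd E (ψ s) X) 0 t := by
    have := hψ.hasDerivAt_Ad X t
    have h2 : modelBracket (E := E) G Y X = 0 := h
    rwa [h2, map_zero] at this
  have h3 : modelAd E (ψ t) X = modelAd E (ψ 0) X :=
    is_const_of_deriv_eq_zero (G := E) (fun s => (h1 s).differentiableAt) (fun s => (h1 s).deriv) t 0
  rw [hψ.map_zero] at h3
  exact h3.trans (Ad_one_apply (E := E) X)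

theorem commute_of_bracket_eq_zero {X Y : GroupLieAlgebra 𝓘(ℝ, E) G} {φ ψ : ℝ → G}
    (hφ : IsOneParameterSubgroup X φ) (hψ : IsOneParameterSubgroup Y ψ) (h : ⁅Y, X⁆ = 0)
    (s t : ℝ) : φ s * ψ t = ψ t * φ s := by
  have h1 := hφ.conj (ψ t)
  rw [Ad_eq_self_of_bracket_eq_zero hψ h] at h1
  have h2 := congrFun (h1.unique hφ) s
  exact (mul_inv_eq_iff_eq_mul.1 h2).symm

theorem expG_eq {X : GroupLieAlgebra 𝓘(ℝ, E) G} {φ : ℝ → G} (h : IsOneParameterSubgroup X φ) :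
    expG X = φ 1 := by
  have hu : ∃! φ : ℝ → G, IsOneParameterSubgroup X φ := ⟨φ, h, fun ψ hψ => hψ.unique h⟩
  rw [expG, dif_pos hu]
  rw [hu.choose_spec.1.unique h]

theorem expG_smul {X : GroupLieAlgebra 𝓘(ℝ, E) G} {φ : ℝ → G} (h : IsOneParameterSubgroup X φ)
    (s : ℝ) : expG (s • X) = φ s := by
  rw [expG_eq (h.smul s), mul_one]

/-- The left side undoes the expected rotation: its derivative in `s` vanishes and its value at `0`
is `u`. -/
theorem Ad_rotation_aux {X u v : GroupLieAlgebra 𝓘(ℝ, E) G} {φ : ℝ → G} {a : ℝ}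
    (hφ : IsOneParameterSubgroup X φ) (hu : ⁅X, u⁆ = a • v) (hv : ⁅X, v⁆ = -(a • u)) (s : ℝ) :
    Real.cos (a * s) • Ad (φ s) u - Real.sin (a * s) • Ad (φ s) v = u := by
  let u' : E := u
  let v' : E := v
  have h0 (s : ℝ) : HasDerivAt (fun s : ℝ => a * s) a s := by
    simpa using (hasDerivAt_id s).const_mul a
  have h1 (s : ℝ) : HasDerivAt (fun s => Real.cos (a * s) • modelAd E (φ s) u' -
      Real.sin (a * s) • modelAd E (φ s) v') 0 s := by
    have hu' : modelBracket (E := E) G X u' = a • v' := hu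
    have hv' : modelBracket (E := E) G X v' = -(a • u') := hv
    have h2 := hφ.hasDerivAt_Ad u' s
    have h3 := hφ.hasDerivAt_Ad v' s
    rw [hu', map_smul] at h2
    rw [hv', map_neg, map_smul] at h3
    convert ((h0 s).cos.smul h2).sub ((h0 s).sin.smul h3) using 1
    · rfl
    · module
  have h4 := is_const_of_deriv_eq_zero (fun s => (h1 s).differentiableAt)
    (fun s => (h1 s).deriv) s 0
  rw [hφ.map_zero] at h4
  have h5 : modelAd E (1 : G) u' = u' := Ad_one_apply (E := E) u
  rw [h5] at h4
  simp only [mul_zero, Real.cos_zero, one_smul, Real.sin_zero, zero_smul, sub_zero] at h4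
  exact h4

/-- If `ad X` rotates a plane then the one-parameter subgroup of `X` rotates it, too. -/
theorem Ad_rotation {X u v : GroupLieAlgebra 𝓘(ℝ, E) G} {φ : ℝ → G} {a : ℝ}
    (hφ : IsOneParameterSubgroup X φ) (hu : ⁅X, u⁆ = a • v) (hv : ⁅X, v⁆ = -(a • u)) (s : ℝ) :
    Ad (φ s) u = Real.cos (a * s) • u + Real.sin (a * s) • v := by
  have h1 := Ad_rotation_aux hφ hu hv s
  -- The pair `(v, -u)` is rotated in the same way; the two relations form a linear system with
  -- determinant `cos² + sin² = 1`.
  have h2 := Ad_rotation_aux (u := v) (v := -u) hφ (by rw [hv, smul_neg])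
    (by rw [lie_neg, hu]) s
  rw [map_neg, smul_neg, sub_neg_eq_add] at h2
  have h3 := Real.cos_sq_add_sin_sq (a * s)
  have h4 : Real.cos (a * s) • (Real.cos (a * s) • Ad (φ s) u - Real.sin (a * s) • Ad (φ s) v) +
      Real.sin (a * s) • (Real.cos (a * s) • Ad (φ s) v + Real.sin (a * s) • Ad (φ s) u) =
      (Real.cos (a * s) ^ 2 + Real.sin (a * s) ^ 2) • Ad (φ s) u := by module
  rw [h1, h2, h3, one_smul] at h4
  exact h4.symm

variable [CompactSpace G] [FiniteDimensional ℝ E]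

theorem Ad_lie (g : G) (X Y : GroupLieAlgebra 𝓘(ℝ, E) G) : Ad g ⁅X, Y⁆ = ⁅Ad g X, Ad g Y⁆ := by
  obtain ⟨φ, hφ⟩ := exists_isOneParameterSubgroup X
  have h1 := (hφ.conj g).hasDerivAt_Ad_zero (modelAd E g Y)
  have h2 := (modelAd E g).hasFDerivAt.comp_hasDerivAt (0 : ℝ) (hφ.hasDerivAt_Ad_zero (Y : E))
  have h3 : (fun s => modelAd E (g * φ s * g⁻¹) (modelAd E g Y)) =
      modelAd E g ∘ fun s => modelAd E (φ s) Y := by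
    ext s
    have (X : GroupLieAlgebra 𝓘(ℝ, E) G) :
        Ad (g * φ s * g⁻¹) (Ad g X) = Ad g (Ad (φ s) X) := by simp
    exact this Y
  rw [h3] at h1
  exact (h1.unique h2).symm

/-- Differentiate `B (Ad (φ s) X) Y = B X (Ad (φ (-s)) Y)` at `s = 0`. -/
theorem form_lie {B : LinearMap.BilinForm ℝ (GroupLieAlgebra 𝓘(ℝ, E) G)}
    (hB : ∀ (g : G) X Y, B (Ad g X) (Ad g Y) = B X Y) (Z X Y : GroupLieAlgebra 𝓘(ℝ, E) G) :
    B ⁅Z, X⁆ Y = -B X ⁅Z, Y⁆ := by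
  obtain ⟨φ, hφ⟩ := exists_isOneParameterSubgroup Z
  let ℓ : E →ₗ[ℝ] ℝ := B.flip Y
  let m : E →ₗ[ℝ] ℝ := B X
  have h1 := (LinearMap.toContinuousLinearMap ℓ).hasFDerivAt.comp_hasDerivAt (0 : ℝ)
    (hφ.hasDerivAt_Ad_zero (X : E))
  have h2 := (LinearMap.toContinuousLinearMap m).hasFDerivAt.comp_hasDerivAt (0 : ℝ)
    (hφ.hasDerivAt_Ad_zero (Y : E))
  have h3 := HasDerivAt.scomp (g₁ := LinearMap.toContinuousLinearMap m ∘ fun s => modelAd E (φ s) Y)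
    (h := fun s : ℝ => -s) (0 : ℝ) (by simpa only [neg_zero] using h2) (hasDerivAt_neg (0 : ℝ))
  have h4 : (LinearMap.toContinuousLinearMap ℓ ∘ fun s => modelAd E (φ s) X) =
      (LinearMap.toContinuousLinearMap m ∘ fun s => modelAd E (φ s) Y) ∘ fun s : ℝ => -s := by
    ext s
    have h5 : B (Ad (φ s) X) Y = B X (Ad (φ (-s)) Y) := by
      rw [hφ.map_neg, ← hB (φ s) X, Ad_Ad_inv]
    exact h5
  rw [h4] at h1
  have h6 := h1.unique h3
  rw [neg_smul, one_smul] at h6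
  exact h6

/-- The subgroup generated by the one-parameter subgroups contained in `T`. -/
def expSubgroup (E : Type*) [NormedAddCommGroup E] [NormedSpace ℝ E] [ChartedSpace E G]
    (T : Subgroup G) : Subgroup G :=
  Subgroup.closure {g | ∃ (X : GroupLieAlgebra 𝓘(ℝ, E) G) (φ : ℝ → G) (s : ℝ),
    IsOneParameterSubgroup X φ ∧ (∀ s, φ s ∈ T) ∧ g = φ s}

theorem expSubgroup_le (T : Subgroup G) : expSubgroup E T ≤ T := by
  refine (Subgroup.closure_le _).2 ?_
  rintro _ ⟨X, φ, s, -, h, rfl⟩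
  exact h s

/-- Otherwise elements `h` of `T` outside the closure `K` tend to `1`. Represent each coset `K h` by
its element with shortest coordinate vector `v ≠ 0`. The directions `v/‖v‖` have a limit `V`, which
generates a one-parameter subgroup of `T`, hence of `K`. Multiplying by its value at `-‖v‖` stays in
the coset and cancels `v` to leading order, contradicting minimality. -/
theorem closure_expSubgroup_mem_nhdsWithin {T : Subgroup G} (hT : IsClosed (T : Set G)) :
    ((expSubgroup E T).topologicalClosure : Set G) ∈ 𝓝[(T : Set G)] 1 := by
  set K := (expSubgroup E T).topologicalClosure with hKdef
  have hK : IsClosed (K : Set G) := Subgroup.isClosed_topologicalClosure _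
  have hKT : K ≤ T := Subgroup.topologicalClosure_minimal _ (expSubgroup_le T) hT
  have hprop := FiniteDimensional.proper ℝ E
  by_contra hcon
  have hne : (𝓝[(T : Set G)] 1 ⊓ 𝓟 ((K : Set G)ᶜ)).NeBot := by
    rw [neBot_iff]
    intro h
    exact hcon (by simpa using mem_iff_inf_principal_compl.2 h)
  let l : Ultrafilter G := Ultrafilter.of (𝓝[(T : Set G)] 1 ⊓ 𝓟 ((K : Set G)ᶜ))
  have hl : (l : Filter G) ≤ 𝓝[(T : Set G)] 1 ⊓ 𝓟 ((K : Set G)ᶜ) := Ultrafilter.of_le _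
  have hl1 : (l : Filter G) ≤ 𝓝 1 := hl.trans (inf_le_left.trans nhdsWithin_le_nhds)
  have hlT : ∀ᶠ h in l, h ∈ T := hl.trans inf_le_left self_mem_nhdsWithin
  have hlK : ∀ᶠ h in l, h ∉ K := hl.trans inf_le_right (mem_principal_self _)
  obtain ⟨C, hC, r, hr, h1, h2⟩ := exists_chart_ball (E := E) (G := G)
  have hlog : Tendsto (fun h : G => logChart E h) l (𝓝 0) := by
    have := (continuousAt_logChart (E := E) (G := G)).tendsto.mono_left hl1
    rwa [logChart_one] at this
  -- the displacement from `K` in the chart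
  have hmin : ∀ᶠ h in l, ∃ v : E, (‖v‖ ≤ r ∧ expChart G v * h⁻¹ ∈ K) ∧ ‖v‖ ≤ ‖logChart E h‖ ∧
      ∀ w : E, ‖w‖ ≤ r → expChart G w * h⁻¹ ∈ K → ‖v‖ ≤ ‖w‖ := by
    have h3 : ∀ᶠ h in (l : Filter G), ‖logChart E h‖ < r := by
      have := hlog.norm
      rw [norm_zero] at this
      exact this.eventually (gt_mem_nhds hr)
    filter_upwards [h3, hl1 (expChart_logChart (E := E) (G := G))] with h hh he
    have he : expChart G (logChart E h) = h := he
    let A : Set E := {v | v ∈ Metric.closedBall (0 : E) r ∧ expChart G v * h⁻¹ ∈ K}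
    have hA : IsCompact A := by
      refine (isCompact_closedBall (0 : E) r).of_isClosed_subset ?_ fun v hv => hv.1
      refine ContinuousOn.preimage_isClosed_of_isClosed (f := fun v => expChart G v * h⁻¹) ?_
        Metric.isClosed_closedBall hK
      intro v hv
      exact ((h1 v (by simpa using hv)).2.mul continuousAt_const).continuousWithinAt
    have hlogA : logChart E h ∈ A := ⟨by simpa using hh.le, by simp [he, one_mem]⟩
    obtain ⟨v, hv, hvm⟩ := hA.exists_isMinOn ⟨_, hlogA⟩ continuous_norm.continuousOn
    exact ⟨v, ⟨by simpa using hv.1, hv.2⟩, hvm hlogA,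
      fun w hw hwK => hvm (a := w) ⟨by simpa using hw, hwK⟩⟩
  obtain ⟨v, hv⟩ := hmin.choice
  have hv0 : Tendsto v l (𝓝 0) :=
    squeeze_zero_norm' (hv.mono fun h hh => hh.2.1) (by simpa using hlog.norm)
  have hvpos : ∀ᶠ h in l, 0 < ‖v h‖ := by
    filter_upwards [hv, hlK] with h hh hhK
    rw [norm_pos_iff]
    intro h0
    have := hh.1.2
    rw [h0, expChart_zero, one_mul] at this
    exact hhK (by simpa using this)
  have hvT : ∀ᶠ h in l, expChart G (v h) ∈ T := by
    filter_upwards [hv, hlT] with h hh hhT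
    simpa using T.mul_mem (hKT hh.1.2) hhT
  obtain ⟨V, -, hV⟩ := (isCompact_closedBall (0 : E) 1).ultrafilter_le_nhds
    (l.map fun h => ‖v h‖⁻¹ • v h) (by
      simp only [Ultrafilter.coe_map, le_principal_iff, mem_map]
      filter_upwards [hvpos] with h hh
      simp [norm_smul, inv_mul_cancel₀ hh.ne'])
  have hV' : Tendsto (fun h => ‖v h‖⁻¹ • v h) l (𝓝 V) := hV
  have hε0 : Tendsto (fun h => ‖v h‖) l (𝓝 0) := by simpa using hv0.norm
  obtain ⟨φ, hφ, hφT⟩ := exists_isOneParameterSubgroup_of_tendsto l hT hvpos hε0 hV' hvT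
  have hφK (s : ℝ) : φ s ∈ K :=
    Subgroup.le_topologicalClosure _ (Subgroup.subset_closure ⟨V, φ, s, hφ, hφT, rfl⟩)
  obtain ⟨-, hφc, hφd⟩ := isOneParameterSubgroup_iff.1 hφ
  -- moving by `φ` decreases the displacement
  let y : G → E := fun h => logChart E (φ (-‖v h‖))
  have hεneg : Tendsto (fun h => -‖v h‖) l (𝓝 0) := by simpa using hε0.neg
  have hye : ∀ᶠ h in l, expChart G (y h) = φ (-‖v h‖) := by
    have h3 : Tendsto (fun h => φ (-‖v h‖)) l (𝓝 1) := by
      have := hφc.tendsto.comp hεneg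
      rwa [hφ.map_zero] at this
    exact h3.eventually expChart_logChart
  have hy : Tendsto (fun h => ‖v h‖⁻¹ • y h) l (𝓝 (-V)) := by
    have h3 := hφd.tendsto_slope_zero
    simp only [zero_add, hφ.map_zero, logChart_one, sub_zero] at h3
    have h4 : Tendsto (fun h => -‖v h‖) l (𝓝[≠] 0) :=
      tendsto_nhdsWithin_iff.2 ⟨hεneg, hvpos.mono fun h hh => by
        simpa using norm_pos_iff.1 hh⟩
    refine (h3.comp h4).neg.congr fun h => ?_
    simp only [Function.comp, y, inv_neg, neg_smul, neg_neg]
  have hy0 : Tendsto y l (𝓝 0) := by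
    have := hε0.smul hy
    rw [zero_smul] at this
    refine this.congr' (hvpos.mono fun h hh => ?_)
    simp only [smul_smul]
    rw [mul_inv_cancel₀ hh.ne', one_smul]
  have hyr : ∀ᶠ h in l, ‖y h‖ ≤ r := by
    have := hy0.norm
    rw [norm_zero] at this
    exact (this.eventually (gt_mem_nhds hr)).mono fun h hh => le_of_lt hh
  have hlim : Tendsto (fun h => ‖‖v h‖⁻¹ • y h + ‖v h‖⁻¹ • v h‖ + C * ‖y h‖) l (𝓝 0) := by
    have h3 := (hy.add hV').norm.add (hy0.norm.const_mul C)
    simpa using h3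
  have hsmall := hlim.eventually (gt_mem_nhds (show (0 : ℝ) < 1 by norm_num))
  have hfalse : ∀ᶠ h in (l : Filter G), False := by
    filter_upwards [hv, hvpos, hye, hyr, hsmall] with h hh hpos he hyr hs
    obtain ⟨h3, h4⟩ := h2 (y h) (v h) hyr hh.1.1
    have h5 : ‖chartMul G (y h, v h)‖ < ‖v h‖ := by
      have h6 : ‖y h + v h‖ = ‖v h‖ * ‖‖v h‖⁻¹ • y h + ‖v h‖⁻¹ • v h‖ := by
        rw [← smul_add, norm_smul, norm_inv, norm_norm, mul_inv_cancel_left₀ hpos.ne']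
      have h7 : chartMul G (y h, v h) = (chartMul G (y h, v h) - y h - v h) + (y h + v h) := by
        abel
      rw [h7]
      refine (norm_add_le _ _).trans_lt ?_
      rw [h6]
      nlinarith
    have h8 := hh.2.2 _ (h5.le.trans hh.1.1) (by
      rw [← h3, he, mul_assoc]
      exact K.mul_mem (hφK _) hh.1.2)
    exact absurd h5 (not_lt.2 h8)
  exact hfalse.exists.elim fun _ h => h

/-- A closed connected subgroup is topologically generated by its one-parameter subgroups. -/
theorem le_closure_expSubgroup {T : Subgroup G} (hT : IsClosed (T : Set G))
    (hc : IsConnected (T : Set G)) : T ≤ (expSubgroup E T).topologicalClosure := by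
  have : ConnectedSpace T := isConnected_iff_connectedSpace.1 hc
  have h1 : ((expSubgroup E T).topologicalClosure.subgroupOf T : Set T) ∈ 𝓝 (1 : T) := by
    have := closure_expSubgroup_mem_nhdsWithin (E := E) hT
    exact mem_nhds_subtype_iff_nhdsWithin.2 (by
      refine mem_of_superset (inter_mem this self_mem_nhdsWithin) ?_
      rintro x ⟨hx, hxT⟩
      exact ⟨⟨x, hxT⟩, hx, rfl⟩)
  have h2 := Subgroup.isOpen_of_mem_nhds _ h1
  have h3 : ((expSubgroup E T).topologicalClosure.subgroupOf T : Set T) = univ :=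
    IsClopen.eq_univ ⟨Subgroup.isClosed_of_isOpen _ h2, h2⟩ ⟨1, one_mem _⟩
  intro x hx
  have : (⟨x, hx⟩ : T) ∈ ((expSubgroup E T).topologicalClosure.subgroupOf T : Set T) := by
    rw [h3]
    trivial
  exact this

/-- In a commutative group the product of two one-parameter subgroups is again one, with the sum of
the velocities, so the velocities already form a subspace. -/
theorem IsTorus.mem_torusLieAlgebra_iff {T : Subgroup G} (hT : IsTorus T)
    {X : GroupLieAlgebra 𝓘(ℝ, E) G} : X ∈ torusLieAlgebra T ↔
      ∃ φ : ℝ → G, IsOneParameterSubgroup X φ ∧ ∀ s, φ s ∈ T := by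
  refine ⟨fun h => ?_, fun h => Submodule.subset_span h⟩
  induction h using Submodule.span_induction with
  | mem X h => exact h
  | zero =>
    refine ⟨fun _ => 1, isOneParameterSubgroup_iff.2 ⟨by simp, continuousAt_const, ?_⟩,
      fun _ => one_mem T⟩
    exact hasDerivAt_const (F := E) _ _
  | add X Y _ _ hX hY =>
    obtain ⟨φ, hφ, hφT⟩ := hX
    obtain ⟨ψ, hψ, hψT⟩ := hY
    exact ⟨_, hφ.mul hψ fun s t => hT.2.2 _ (hφT s) _ (hψT t), fun s => T.mul_mem (hφT s) (hψT s)⟩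
  | smul c X _ hX =>
    obtain ⟨φ, hφ, hφT⟩ := hX
    exact ⟨_, hφ.smul c, fun s => hφT _⟩

/-- The Lie algebra of a maximal torus is its own centralizer. -/
theorem IsMaximalTorus.mem_of_lie_eq_zero {T : Subgroup G} (hT : IsMaximalTorus T)
    {X : GroupLieAlgebra 𝓘(ℝ, E) G} (h : ∀ Y ∈ torusLieAlgebra (E := E) T, ⁅Y, X⁆ = 0) :
    X ∈ torusLieAlgebra T := by
  obtain ⟨φ, hφ⟩ := exists_isOneParameterSubgroup X
  -- Vanishing brackets give commutation with the one-parameter subgroups of `T`. These generate `T`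
  -- topologically, and centralizers are closed.
  have hcomm (t : G) (ht : t ∈ T) (s : ℝ) : t * φ s = φ s * t := by
    have h1 : expSubgroup E T ≤ Subgroup.centralizer (range φ) := by
      refine (Subgroup.closure_le _).2 ?_
      rintro _ ⟨Y, ψ, t, hψ, hψT, rfl⟩
      refine Subgroup.mem_centralizer_iff.2 ?_
      rintro _ ⟨s, rfl⟩
      exact commute_of_bracket_eq_zero hφ hψ (h Y (hT.1.mem_torusLieAlgebra_iff.2 ⟨ψ, hψ, hψT⟩)) s t
    have h2 : (expSubgroup E T).topologicalClosure ≤ Subgroup.centralizer (range φ) :=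
      Subgroup.topologicalClosure_minimal _ h1 (by
        exact Set.isClosed_centralizer _)
    exact (Subgroup.mem_centralizer_iff.1 (h2 (le_closure_expSubgroup (E := E) hT.1.1 hT.1.2.1 ht))
      _ ⟨s, rfl⟩).symm
  -- The closure of `T · φ(ℝ)` is a torus containing `T`, so maximality forces `φ` into `T`.
  let S : Subgroup G :=
    { carrier := (fun q : G × ℝ => q.1 * φ q.2) '' ((T : Set G) ×ˢ univ)
      one_mem' := ⟨(1, 0), ⟨one_mem T, trivial⟩, by simp [hφ.map_zero]⟩
      mul_mem' := by
        rintro _ _ ⟨⟨t, s⟩, ⟨ht, -⟩, rfl⟩ ⟨⟨t', s'⟩, ⟨ht', -⟩, rfl⟩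
        refine ⟨(t * t', s + s'), ⟨T.mul_mem ht ht', trivial⟩, ?_⟩
        simp only [hφ.1]
        rw [mul_assoc, mul_assoc, ← mul_assoc (φ s), ← hcomm t' ht' s, mul_assoc]
      inv_mem' := by
        rintro _ ⟨⟨t, s⟩, ⟨ht, -⟩, rfl⟩
        refine ⟨(t⁻¹, -s), ⟨T.inv_mem ht, trivial⟩, ?_⟩
        simp only [hφ.map_neg, mul_inv_rev]
        rw [← hφ.map_neg, hcomm _ (T.inv_mem ht)] }
  have hScomm : ∀ x y : S, x * y = y * x := by
    rintro ⟨_, ⟨t, s⟩, ⟨ht, -⟩, rfl⟩ ⟨_, ⟨t', s'⟩, ⟨ht', -⟩, rfl⟩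
    ext
    simp only [Subgroup.coe_mul]
    rw [mul_assoc, mul_assoc, ← mul_assoc (φ s), ← hcomm t' ht' s, ← mul_assoc (φ s'),
      ← hcomm t ht s', mul_assoc, mul_assoc, ← hφ.1, ← hφ.1, add_comm, ← mul_assoc, ← mul_assoc,
      hT.1.2.2 t ht t' ht']
  have hS : IsTorus S.topologicalClosure := by
    refine ⟨S.isClosed_topologicalClosure, ?_, ?_⟩
    · have : IsConnected (S : Set G) := by
        refine (hT.1.2.1.prod isConnected_univ).image _ (Continuous.continuousOn ?_)
        exact continuous_fst.mul (hφ.continuous.comp continuous_snd)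
      exact this.closure
    · intro x hx y hy
      let _ := S.commGroupTopologicalClosure hScomm
      exact congrArg Subtype.val (mul_comm (⟨x, hx⟩ : S.topologicalClosure) ⟨y, hy⟩)
  have hTS : T ≤ S.topologicalClosure := fun t ht =>
    S.le_topologicalClosure ⟨(t, 0), ⟨ht, trivial⟩, by simp [hφ.map_zero]⟩
  have hST := hT.2 _ hS hTS
  refine hT.1.mem_torusLieAlgebra_iff.2 ⟨φ, hφ, fun s => ?_⟩
  rw [← hST]
  exact S.le_topologicalClosure ⟨(1, s), ⟨one_mem T, trivial⟩, by simp⟩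

end Tori

/-! ### Roots -/

section RootPairs

variable {E : Type*} [NormedAddCommGroup E] [NormedSpace ℝ E] [CompleteSpace E]
  {G : Type*} [TopologicalSpace G] [ChartedSpace E G] [Group G] [LieGroup 𝓘(ℝ, E) ∞ G]

section Complexification

variable {L : Type*} [AddCommGroup L] [Module ℝ L]

/-- The real part of an element of the complexification. -/
def tensorRe : ℂ ⊗[ℝ] L →ₗ[ℝ] L :=
  (TensorProduct.lid ℝ L).toLinearMap ∘ₗ LinearMap.rTensor L Complex.reLm

/-- The imaginary part of an element of the complexification. -/
def tensorIm : ℂ ⊗[ℝ] L →ₗ[ℝ] L :=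
  (TensorProduct.lid ℝ L).toLinearMap ∘ₗ LinearMap.rTensor L Complex.imLm

@[simp] theorem tensorRe_tmul (c : ℂ) (x : L) : tensorRe (c ⊗ₜ[ℝ] x) = c.re • x := by
  simp [tensorRe]

@[simp] theorem tensorIm_tmul (c : ℂ) (x : L) : tensorIm (c ⊗ₜ[ℝ] x) = c.im • x := by
  simp [tensorIm]

theorem tensor_eq_re_add_im (e : ℂ ⊗[ℝ] L) :
    e = (1 : ℂ) ⊗ₜ[ℝ] tensorRe e + Complex.I ⊗ₜ[ℝ] tensorIm e := by
  induction e using TensorProduct.induction_on with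
  | zero => simp
  | tmul c x =>
    rw [tensorRe_tmul, tensorIm_tmul, ← TensorProduct.smul_tmul, ← TensorProduct.smul_tmul,
      ← TensorProduct.add_tmul]
    congr 1
    simp [Complex.re_add_im]
  | add a b ha hb =>
    nth_rewrite 1 [ha, hb]
    simp only [map_add, TensorProduct.tmul_add]
    abel

theorem tensorRe_smul_I (a : ℝ) (e : ℂ ⊗[ℝ] L) :
    tensorRe (((a : ℂ) * Complex.I) • e) = -(a • tensorIm e) := by
  induction e using TensorProduct.induction_on with
  | zero => simp
  | tmul c x => simp [TensorProduct.smul_tmul', mul_smul]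
  | add e f he hf => rw [smul_add, map_add, he, hf, map_add, smul_add, neg_add]

theorem tensorIm_smul_I (a : ℝ) (e : ℂ ⊗[ℝ] L) :
    tensorIm (((a : ℂ) * Complex.I) • e) = a • tensorRe e := by
  induction e using TensorProduct.induction_on with
  | zero => simp
  | tmul c x => simp [TensorProduct.smul_tmul', mul_smul]
  | add e f he hf => rw [smul_add, map_add, he, hf, map_add, smul_add]

end Complexification

theorem tensorRe_lie {L : Type*} [LieRing L] [LieAlgebra ℝ L] (t : L) (e : ℂ ⊗[ℝ] L) :
    tensorRe ⁅(1 : ℂ) ⊗ₜ[ℝ] t, e⁆ = ⁅t, tensorRe e⁆ := by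
  induction e using TensorProduct.induction_on with
  | zero =>
    refine (congrArg tensorRe (lie_zero ((1 : ℂ) ⊗ₜ[ℝ] t))).trans ?_
    simp
  | tmul c x => simp
  | add e f he hf =>
    refine (congrArg tensorRe (lie_add ((1 : ℂ) ⊗ₜ[ℝ] t) e f)).trans ?_
    rw [map_add, he, hf, map_add, lie_add]

theorem tensorIm_lie {L : Type*} [LieRing L] [LieAlgebra ℝ L] (t : L) (e : ℂ ⊗[ℝ] L) :
    tensorIm ⁅(1 : ℂ) ⊗ₜ[ℝ] t, e⁆ = ⁅t, tensorIm e⁆ := by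
  induction e using TensorProduct.induction_on with
  | zero =>
    refine (congrArg tensorIm (lie_zero ((1 : ℂ) ⊗ₜ[ℝ] t))).trans ?_
    simp
  | tmul c x => simp
  | add e f he hf =>
    refine (congrArg tensorIm (lie_add ((1 : ℂ) ⊗ₜ[ℝ] t) e f)).trans ?_
    rw [map_add, he, hf, map_add, lie_add]

/-- The real and imaginary parts of a root vector. -/
def IsRootPair (T : Subgroup G) (α : Module.Dual ℝ (torusLieAlgebra (E := E) T))
    (x y : GroupLieAlgebra 𝓘(ℝ, E) G) : Prop :=
  ∀ τ : torusLieAlgebra (E := E) T,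
    ⁅(τ : GroupLieAlgebra 𝓘(ℝ, E) G), x⁆ = -(α τ • y) ∧
      ⁅(τ : GroupLieAlgebra 𝓘(ℝ, E) G), y⁆ = α τ • x

/-- Split `[τ, e] = iα(τ) e` with `e = x + iy` into real and imaginary parts; from here on
everything happens in the real Lie algebra. -/
theorem isRoot_iff {T : Subgroup G} {α : Module.Dual ℝ (torusLieAlgebra (E := E) T)} :
    IsRoot T α ↔ α ≠ 0 ∧ ∃ x y, (x ≠ 0 ∨ y ≠ 0) ∧ IsRootPair T α x y := by
  refine and_congr_right fun _ => ⟨?_, ?_⟩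
  · rintro ⟨e, he, h⟩
    refine ⟨tensorRe e, tensorIm e, ?_, fun τ => ?_⟩
    · by_contra! hcon
      rw [tensor_eq_re_add_im e, hcon.1, hcon.2] at he
      simp at he
    · rw [← tensorRe_lie, ← tensorIm_lie, h τ, tensorRe_smul_I, tensorIm_smul_I]
      exact ⟨rfl, rfl⟩
  · rintro ⟨x, y, hxy, h⟩
    refine ⟨(1 : ℂ) ⊗ₜ[ℝ] x + Complex.I ⊗ₜ[ℝ] y, fun h0 => ?_, fun τ => ?_⟩
    · have h1 := congrArg tensorRe h0
      have h2 := congrArg tensorIm h0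
      simp at h1 h2
      rcases hxy with h3 | h3
      · exact h3 h1
      · exact h3 h2
    · rw [tensor_eq_re_add_im ⁅_, _⁆, tensor_eq_re_add_im ((_ : ℂ) • _), tensorRe_lie, tensorIm_lie,
        tensorRe_smul_I, tensorIm_smul_I]
      simp [(h τ).1, (h τ).2]

end RootPairs

/-! ### The form on the Cartan algebra, reflections and integrality of roots -/

namespace CartanData

variable {E : Type*} [NormedAddCommGroup E] [NormedSpace ℝ E] [FiniteDimensional ℝ E]
  [CompleteSpace E]
  {G : Type*} [TopologicalSpace G] [ChartedSpace E G] [Group G] [LieGroup 𝓘(ℝ, E) ∞ G]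
  (D : CartanData E G)

/-- The invariant form identifies the Cartan algebra with its dual. -/
def cartanEquivDual : D.cartan ≃ₗ[ℝ] Module.Dual ℝ D.cartan :=
  LinearEquiv.ofInjectiveOfFinrankEq (D.form.domRestrict₁₂ D.cartan D.cartan) (by
    rw [← LinearMap.ker_eq_bot, LinearMap.ker_eq_bot']
    intro h hh
    by_contra h0
    have h1 := D.form_pos h (by simpa using h0)
    have h2 : D.form h h = 0 := congrArg (fun f : Module.Dual ℝ D.cartan => f h) hh
    exact h1.ne' h2) (Subspace.dual_finrank_eq).symm

/-- The element of the Cartan algebra representing a functional. -/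
def dualVec (α : Module.Dual ℝ D.cartan) : D.cartan := D.cartanEquivDual.symm α

theorem form_dualVec (α : Module.Dual ℝ D.cartan) (τ : D.cartan) :
    D.form (D.dualVec α) τ = α τ :=
  congrArg (fun f : Module.Dual ℝ D.cartan => f τ) (D.cartanEquivDual.apply_symm_apply α)

theorem eq_dualVec {α : Module.Dual ℝ D.cartan} {h : D.cartan}
    (hh : ∀ τ : D.cartan, D.form h τ = α τ) : h = D.dualVec α := by
  apply D.cartanEquivDual.injective
  rw [dualVec, LinearEquiv.apply_symm_apply]
  ext τ
  exact hh τ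

/-- The inner product of functionals on the Cartan algebra. -/
def ip (α β : Module.Dual ℝ D.cartan) : ℝ := β (D.dualVec α)

theorem ip_eq_form (α β : Module.Dual ℝ D.cartan) :
    D.ip α β = D.form (D.dualVec α) (D.dualVec β) := by
  rw [ip, D.form_symm, form_dualVec]

theorem ip_comm (α β : Module.Dual ℝ D.cartan) : D.ip α β = D.ip β α := by
  rw [ip_eq_form, D.form_symm, ip_eq_form]

theorem ip_self_pos {α : Module.Dual ℝ D.cartan} (h : α ≠ 0) : 0 < D.ip α α := by
  rw [ip_eq_form]
  apply D.form_pos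
  simpa [dualVec] using h

/-- The coroot `2α / (α, α)`, as an element of the Cartan algebra. -/
def coroot (α : Module.Dual ℝ D.cartan) : D.cartan := (2 / D.ip α α) • D.dualVec α

theorem apply_coroot (α β : Module.Dual ℝ D.cartan) :
    β (D.coroot α) = 2 * D.ip α β / D.ip α α := by
  rw [coroot, map_smul, smul_eq_mul, ip, ip]
  ring

/-- The functional `β - β(α^∨) α`. -/
def reflect (α β : Module.Dual ℝ D.cartan) : Module.Dual ℝ D.cartan := β - β (D.coroot α) • α

variable [IsTopologicalGroup G] [T2Space G] [CompactSpace G]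

theorem e_eq {τ : D.cartan} {φ : ℝ → G}
    (hφ : IsOneParameterSubgroup (τ : GroupLieAlgebra 𝓘(ℝ, E) G) φ) (s : ℝ) :
    D.e (s • τ) = φ (2 * Real.pi * s) := by
  rw [e, ← expG_smul hφ, Submodule.coe_smul, smul_smul]

theorem exists_oneParameterSubgroup (τ : D.cartan) : ∃ φ : ℝ → G,
    IsOneParameterSubgroup (τ : GroupLieAlgebra 𝓘(ℝ, E) G) φ ∧ ∀ s, φ s ∈ D.T :=
  D.isMaximalTorus.1.mem_torusLieAlgebra_iff.1 τ.2

section Pair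

variable {D} {β : Module.Dual ℝ D.cartan} {x y : GroupLieAlgebra 𝓘(ℝ, E) G}

/-- Some `τ` with `β τ ≠ 0` acts on the plane of `x`, `y` as an infinitesimal rotation, and it is
skew for the form. -/
theorem form_pair (hβ : β ≠ 0) (h : IsRootPair D.T β x y) :
    D.form x x = D.form y y ∧ D.form x y = 0 := by
  obtain ⟨τ, hτ⟩ : ∃ τ, β τ ≠ 0 := by
    by_contra! hcon
    exact hβ (LinearMap.ext hcon)
  have h1 := form_lie D.form_Ad (τ : GroupLieAlgebra 𝓘(ℝ, E) G) x y
  have h2 := form_lie D.form_Ad (τ : GroupLieAlgebra 𝓘(ℝ, E) G) x x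
  rw [(h τ).1, (h τ).2] at h1
  rw [(h τ).1] at h2
  simp only [map_neg, LinearMap.neg_apply, map_smul, LinearMap.smul_apply, smul_eq_mul,
    neg_neg, neg_inj, D.form_symm y x] at h1 h2
  refine ⟨(mul_left_cancel₀ hτ h1).symm, ?_⟩
  have h3 : β τ * D.form x y = 0 := by linarith
  exact (mul_eq_zero.1 h3).resolve_left hτ

theorem form_pair_pos (hβ : β ≠ 0) (hxy : x ≠ 0 ∨ y ≠ 0) (h : IsRootPair D.T β x y) :
    0 < D.form x x := by
  rcases hxy with hx | hy
  · exact D.form_pos x hx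
  · rw [(form_pair hβ h).1]
    exact D.form_pos y hy

/-- By the Jacobi identity `⁅x, y⁆` commutes with the Cartan algebra, hence lies in it. Invariance
of the form computes its pairing with each `τ`. -/
theorem lie_pair (hβ : β ≠ 0) (h : IsRootPair D.T β x y) :
    ⁅x, y⁆ = -(D.form x x • (D.dualVec β : GroupLieAlgebra 𝓘(ℝ, E) G)) := by
  have hK : ⁅x, y⁆ ∈ D.cartan := by
    refine D.isMaximalTorus.mem_of_lie_eq_zero fun Y hY => ?_
    rw [leibniz_lie, (h ⟨Y, hY⟩).1, (h ⟨Y, hY⟩).2]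
    simp
  have h1 : (⟨⁅x, y⁆, hK⟩ : D.cartan) = D.dualVec (-(D.form x x • β)) := by
    refine D.eq_dualVec fun τ => ?_
    have h2 := form_lie D.form_Ad x y (τ : GroupLieAlgebra 𝓘(ℝ, E) G)
    rw [← lie_skew x (τ : GroupLieAlgebra 𝓘(ℝ, E) G), (h τ).1] at h2
    simp only [neg_neg, map_smul, smul_eq_mul] at h2
    simp [h2, (form_pair hβ h).1, mul_comm]
  have h2 := congrArg (Subtype.val) h1
  simpa [dualVec] using h2

end Pair

/-- The reflection in a root is realized by an element of the group. -/
theorem exists_reflection {β : Module.Dual ℝ D.cartan} (hβ : IsRoot D.T β) :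
    ∃ g : G, (∀ τ : D.cartan, Ad g (τ : GroupLieAlgebra 𝓘(ℝ, E) G) =
      (τ - β τ • D.coroot β : D.cartan)) ∧ D.e (D.coroot β) = 1 := by
  obtain ⟨h0, x, y, hxy, h⟩ := isRoot_iff.1 hβ
  set N := D.form x x * D.ip β β with hN
  set L := D.form x x with hL
  have hLpos : 0 < L := form_pair_pos h0 hxy h
  have hipos : 0 < D.ip β β := D.ip_self_pos h0
  have hNpos : 0 < N := mul_pos hLpos hipos
  -- The angular speed of `ad x` on the plane of `H`, `y` and of `ad y` on the plane of `x`, `H`; in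
  -- both cases its square is `(x, x)(β, β)`.
  set a := Real.sqrt N with ha
  have hapos : 0 < a := Real.sqrt_pos.2 hNpos
  have haa : a * a = N := Real.mul_self_sqrt hNpos.le
  set H : GroupLieAlgebra 𝓘(ℝ, E) G := (D.dualVec β).1 with hH
  have hxy' : ⁅x, y⁆ = -(L • H) := lie_pair h0 h
  have hHx : ⁅H, x⁆ = -(D.ip β β • y) := (h (D.dualVec β)).1
  have hHy : ⁅H, y⁆ = D.ip β β • x := (h (D.dualVec β)).2
  have hxH : ⁅x, H⁆ = D.ip β β • y := by rw [← lie_skew, hHx, neg_neg]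
  have hyH : ⁅y, H⁆ = -(D.ip β β • x) := by rw [← lie_skew, hHy]
  have hyx : ⁅y, x⁆ = L • H := by rw [← lie_skew, hxy', neg_neg]
  obtain ⟨φ, hφ⟩ := exists_isOneParameterSubgroup x
  obtain ⟨ψ, hψ⟩ := exists_isOneParameterSubgroup y
  obtain ⟨χ, hχ, -⟩ := D.exists_oneParameterSubgroup (D.coroot β)
  have hi0 : D.ip β β ≠ 0 := hipos.ne'
  have ha0 : a ≠ 0 := hapos.ne'
  -- the element `g` reflects the Cartan algebra
  have hgH : Ad (φ (Real.pi / a)) H = -H := by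
    have h1 := Ad_rotation hφ (u := H) (v := (D.ip β β / a) • y) (a := a)
      (by rw [hxH, smul_smul]; congr 1; field_simp)
      (by
        rw [lie_smul, hxy', smul_neg, smul_smul]
        congr 2
        field_simp
        rw [pow_two, haa, hN, mul_comm]) (Real.pi / a)
    have h2 : a * (Real.pi / a) = Real.pi := by field_simp
    rw [h1, h2, Real.cos_pi, Real.sin_pi]
    simp
  have hgker (τ : D.cartan) (hτ : β τ = 0) :
      Ad (φ (Real.pi / a)) (τ : GroupLieAlgebra 𝓘(ℝ, E) G) = τ := by
    refine Ad_eq_self_of_bracket_eq_zero hφ ?_ _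
    rw [← lie_skew, (h τ).1, hτ]
    simp
  have hg (τ : D.cartan) : Ad (φ (Real.pi / a)) (τ : GroupLieAlgebra 𝓘(ℝ, E) G) =
      (τ - β τ • D.coroot β : D.cartan) := by
    have h1 := hgker (τ - (β τ / D.ip β β) • D.dualVec β) (by
      rw [map_sub, map_smul, smul_eq_mul]
      change β τ - β τ / D.ip β β * D.ip β β = 0
      field_simp
      ring)
    have h2 : (τ : GroupLieAlgebra 𝓘(ℝ, E) G) =
        ((τ - (β τ / D.ip β β) • D.dualVec β : D.cartan) : GroupLieAlgebra 𝓘(ℝ, E) G) +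
          (β τ / D.ip β β) • H := by
      simp [hH]
    rw [h2, map_add, h1, map_smul, hgH]
    simp only [coroot, Submodule.coe_sub, Submodule.coe_smul, ← hH]
    module
  refine ⟨φ (Real.pi / a), hg, ?_⟩
  -- conjugation by an element of the one-parameter subgroup of `y` takes `x` to the coroot
  have hux : Ad (ψ (Real.pi / 2 / a)) x = (a / 2) • (D.coroot β : GroupLieAlgebra 𝓘(ℝ, E) G) := by
    have h1 := Ad_rotation hψ (u := x) (v := (L / a) • H) (a := a)
      (by rw [hyx, smul_smul]; congr 1; field_simp)
      (by
        rw [lie_smul, hyH, smul_neg, smul_smul]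
        congr 2
        field_simp
        rw [pow_two, haa]) (Real.pi / 2 / a)
    have h2 : a * (Real.pi / 2 / a) = Real.pi / 2 := by field_simp
    rw [h1, h2, Real.cos_pi_div_two, Real.sin_pi_div_two, coroot, Submodule.coe_smul, ← hH,
      smul_smul, smul_smul, zero_smul, zero_add]
    congr 1
    field_simp
    rw [pow_two, haa]
  have hgy : Ad (φ (2 * Real.pi / a)) y = y := by
    have h1 := Ad_rotation hφ (u := y) (v := -((L / a) • H)) (a := a)
      (by rw [hxy', smul_neg, smul_smul]; congr 2; field_simp)
      (by
        rw [lie_neg, lie_smul, hxH, smul_smul]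
        congr 2
        field_simp
        rw [pow_two, haa]) (2 * Real.pi / a)
    have h2 : a * (2 * Real.pi / a) = 2 * Real.pi := by field_simp
    rw [h1, h2, Real.cos_two_pi, Real.sin_two_pi]
    simp
  have hcomm : ψ (Real.pi / 2 / a) * φ (2 * Real.pi / a) =
      φ (2 * Real.pi / a) * ψ (Real.pi / 2 / a) := by
    have h1 := hψ.conj (φ (2 * Real.pi / a))
    rw [hgy] at h1
    have h2 := congrFun (h1.unique hψ) (Real.pi / 2 / a)
    exact (mul_inv_eq_iff_eq_mul.1 h2).symm
  -- A full turn `φ (2π/a)` fixes `y`, so it commutes with `ψ`; conjugation by `ψ (π/2/a)`, which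
  -- takes `x` to a multiple of the coroot, turns it into `χ π`, so the two are equal. The half turn
  -- `φ (π/a)` commutes with this element but also inverts it. Hence `χ (2π) = 1`, as in `SU(2)`.
  have hsq : φ (2 * Real.pi / a) = χ Real.pi := by
    have h1 := hφ.conj (ψ (Real.pi / 2 / a))
    rw [hux] at h1
    have h2 := congrFun (h1.unique (hχ.smul (a / 2))) (2 * Real.pi / a)
    beta_reduce at h2
    rw [hcomm, mul_inv_cancel_right] at h2
    rw [h2]
    congr 1
    field_simp
  have hinv : φ (Real.pi / a) * χ Real.pi * (φ (Real.pi / a))⁻¹ = χ (-Real.pi) := by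
    have h1 := hχ.conj (φ (Real.pi / a))
    have h3 : Ad (φ (Real.pi / a)) (D.coroot β : GroupLieAlgebra 𝓘(ℝ, E) G) =
        (-1 : ℝ) • (D.coroot β : GroupLieAlgebra 𝓘(ℝ, E) G) := by
      rw [coroot, Submodule.coe_smul, map_smul, ← hH, hgH]
      module
    rw [h3] at h1
    have h2 := congrFun (h1.unique (hχ.smul (-1))) Real.pi
    beta_reduce at h2
    rw [h2, neg_one_mul]
  have h4 : χ (-Real.pi) = χ Real.pi := by
    rw [← hinv, ← hsq, ← hφ.1, ← hφ.map_neg, ← hφ.1]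
    congr 1
    ring
  have h5 := D.e_eq hχ 1
  rw [one_smul] at h5
  rw [h5, mul_one, two_mul, hχ.1]
  nth_rewrite 1 [← h4]
  rw [← hχ.1, neg_add_cancel, hχ.map_zero]

/-- The element `D.e c` rotates the plane of a root pair by the angle `2πγ(c)` up to sign, while a
central element acts trivially, so `cos (2πγ(c)) = 1`. -/
theorem exists_int_of_e_mem_center {γ : Module.Dual ℝ D.cartan} (hγ : IsRoot D.T γ) {c : D.cartan}
    (hc : D.e c ∈ Subgroup.center G) : ∃ n : ℤ, γ c = n := by
  obtain ⟨h0, x, y, hxy, h⟩ := isRoot_iff.1 hγ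
  obtain ⟨φ, hφ, -⟩ := D.exists_oneParameterSubgroup c
  have h1 := Ad_rotation hφ (u := x) (v := y) (a := -γ c) (by rw [(h c).1, neg_smul])
    (by rw [(h c).2, neg_smul, neg_neg]) (2 * Real.pi * 1)
  rw [← D.e_eq hφ, one_smul, Ad_of_mem_center hc] at h1
  have h2 := congrArg (fun v => D.form v x) h1
  have h3 := form_pair_pos h0 hxy h
  simp only [map_add, map_smul, LinearMap.add_apply, LinearMap.smul_apply, smul_eq_mul,
    D.form_symm y x, (form_pair h0 h).2, mul_zero, add_zero, mul_one] at h2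
  have h4 : Real.cos (-γ c * (2 * Real.pi)) = 1 := by
    have : (Real.cos (-γ c * (2 * Real.pi)) - 1) * D.form x x = 0 := by linarith
    have := (mul_eq_zero.1 this).resolve_right h3.ne'
    linarith
  obtain ⟨n, hn⟩ := (Real.cos_eq_one_iff _).1 h4
  refine ⟨-n, ?_⟩
  have h5 := mul_right_cancel₀ (by positivity) hn
  push_cast
  linarith

/-- A functional obtained from a root by the adjoint action of an element normalizing the Cartan
algebra is a root. -/
theorem isRoot_comp {β : Module.Dual ℝ D.cartan} (hβ : IsRoot D.T β) {g : G}
    {A : D.cartan →ₗ[ℝ] D.cartan}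
    (hA : ∀ τ : D.cartan, (A τ : GroupLieAlgebra 𝓘(ℝ, E) G) = Ad g (τ : GroupLieAlgebra 𝓘(ℝ, E) G)) :
    IsRoot D.T (β ∘ₗ A) := by
  obtain ⟨h0, x, y, hxy, h⟩ := isRoot_iff.1 hβ
  have hinj : Function.Injective A := by
    intro τ τ' hττ
    have h1 := congrArg (fun t : D.cartan => Ad g⁻¹ (t : GroupLieAlgebra 𝓘(ℝ, E) G)) hττ
    simp only [hA, Ad_inv_Ad] at h1
    exact Subtype.ext h1
  have hsurj : Function.Surjective A := LinearMap.injective_iff_surjective.1 hinj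
  refine isRoot_iff.2 ⟨fun hcon => h0 ?_, Ad g⁻¹ x, Ad g⁻¹ y, ?_, fun τ => ?_⟩
  · ext τ
    obtain ⟨τ, rfl⟩ := hsurj τ
    exact congrArg (fun f : Module.Dual ℝ D.cartan => f τ) hcon
  · have hne (v : GroupLieAlgebra 𝓘(ℝ, E) G) (hv : v ≠ 0) : Ad g⁻¹ v ≠ 0 := fun hcon => hv (by
      rw [← Ad_Ad_inv g v, hcon, map_zero])
    exact hxy.imp (hne x) (hne y)
  · have h1 (v : GroupLieAlgebra 𝓘(ℝ, E) G) :
        ⁅(τ : GroupLieAlgebra 𝓘(ℝ, E) G), Ad g⁻¹ v⁆ = Ad g⁻¹ ⁅(A τ : GroupLieAlgebra 𝓘(ℝ, E) G), v⁆ := by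
      rw [Ad_lie, hA, Ad_inv_Ad]
    rw [h1, h1, (h (A τ)).1, (h (A τ)).2, map_neg, map_smul, map_smul]
    exact ⟨rfl, rfl⟩

/-- The reflection `τ ↦ τ - α(τ) α^∨` comes from a group element, and composing `β` with it gives `β
- β(α^∨) α`. -/
theorem isRoot_reflect {α β : Module.Dual ℝ D.cartan} (hα : IsRoot D.T α) (hβ : IsRoot D.T β) :
    IsRoot D.T (D.reflect α β) := by
  obtain ⟨g, hg, -⟩ := D.exists_reflection hα
  have h1 := D.isRoot_comp hβ (g := g)
    (A := LinearMap.id - α.smulRight (D.coroot α)) (fun τ => by rw [hg]; simp)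
  have h2 : β ∘ₗ (LinearMap.id - α.smulRight (D.coroot α)) = D.reflect α β := by
    ext τ
    simp [reflect]
    ring
  rwa [h2] at h1

theorem isRoot_neg {β : Module.Dual ℝ D.cartan} (hβ : IsRoot D.T β) : IsRoot D.T (-β) := by
  obtain ⟨h0, x, y, hxy, h⟩ := isRoot_iff.1 hβ
  refine isRoot_iff.2 ⟨neg_ne_zero.2 h0, x, -y, by simpa using hxy, fun τ => ?_⟩
  rw [lie_neg, (h τ).1, (h τ).2]
  simp

theorem exists_int_apply_coroot {β γ : Module.Dual ℝ D.cartan} (hβ : IsRoot D.T β)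
    (hγ : IsRoot D.T γ) : ∃ n : ℤ, γ (D.coroot β) = n := by
  obtain ⟨g, -, h⟩ := D.exists_reflection hβ
  exact D.exists_int_of_e_mem_center hγ (by rw [h]; exact one_mem _)

end CartanData

namespace CartanData

variable {E : Type*} [NormedAddCommGroup E] [NormedSpace ℝ E] [FiniteDimensional ℝ E]
  [CompleteSpace E]
  {G : Type*} [TopologicalSpace G] [ChartedSpace E G] [Group G] [LieGroup 𝓘(ℝ, E) ∞ G]
  (D : CartanData E G)

/-! ### The coroot lattice -/

theorem dualVec_sub (α β : Module.Dual ℝ D.cartan) :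
    D.dualVec (α - β) = D.dualVec α - D.dualVec β := map_sub D.cartanEquivDual.symm α β

theorem dualVec_smul (c : ℝ) (α : Module.Dual ℝ D.cartan) :
    D.dualVec (c • α) = c • D.dualVec α := map_smul D.cartanEquivDual.symm c α

theorem dualVec_neg (α : Module.Dual ℝ D.cartan) : D.dualVec (-α) = -D.dualVec α :=
  map_neg D.cartanEquivDual.symm α

theorem coroot_neg (α : Module.Dual ℝ D.cartan) : D.coroot (-α) = -D.coroot α := by
  simp [coroot, ip, dualVec_neg]

theorem ip_reflect {α : Module.Dual ℝ D.cartan} (hα : α ≠ 0) (β : Module.Dual ℝ D.cartan) :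
    D.ip (D.reflect α β) (D.reflect α β) = D.ip β β := by
  have h0 := (D.ip_self_pos hα).ne'
  have h1 := D.ip_comm α β
  simp only [reflect, apply_coroot]
  simp only [ip, dualVec_sub, dualVec_smul, LinearMap.sub_apply, LinearMap.smul_apply, map_sub,
    map_smul, smul_eq_mul] at *
  rw [h1]
  field_simp
  ring

theorem coroot_reflect {α β : Module.Dual ℝ D.cartan} (hα : α ≠ 0) (hβ : β ≠ 0) :
    D.coroot (D.reflect α β) = D.coroot β - α (D.coroot β) • D.coroot α := by
  have h0 := (D.ip_self_pos hα).ne'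
  have h0' := (D.ip_self_pos hβ).ne'
  have h1 := D.ip_comm α β
  rw [apply_coroot]
  simp only [coroot, D.ip_reflect hα]
  rw [reflect, apply_coroot, dualVec_sub, dualVec_smul, smul_sub, smul_smul, smul_smul, h1]
  congr 2
  field_simp

theorem coroot_simpleRoot_mem (i : Fin D.r) : D.coroot (D.simpleRoot i) ∈ D.corootLattice := by
  refine AddSubgroup.subset_closure ⟨i, D.dualVec (D.simpleRoot i), D.form_dualVec _, ?_⟩
  rw [coroot, ip_eq_form]

theorem corootLattice_induction {p : D.cartan → Prop}
    (hs : ∀ i, p (D.coroot (D.simpleRoot i))) (h0 : p 0) (ha : ∀ x y, p x → p y → p (x + y))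
    (hn : ∀ x, p x → p (-x)) {c : D.cartan} (hc : c ∈ D.corootLattice) : p c := by
  refine AddSubgroup.closure_induction ?_ h0 (fun x y _ _ hx hy => ha x y hx hy)
    (fun x _ hx => hn x hx) hc
  rintro _ ⟨i, h, hh, rfl⟩
  have := hs i
  rwa [coroot, ip_eq_form, ← D.eq_dualVec hh] at this

theorem repr_sum (n : Fin D.r → ℕ) (j : Fin D.r) :
    D.simpleRoot.repr (∑ i, n i • D.simpleRoot i) j = n j := by
  simp [Finsupp.single_apply]

/-- Roots have integral coefficients in the simple roots. This indivisibility replaces reducedness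
of the root system: if `β` and `2β` were both roots, the coroot of `2β` would be half that of `β`
and could leave the lattice. -/
theorem not_isRoot_half_simpleRoot (i : Fin D.r) :
    ¬ IsRoot D.T ((1 / 2 : ℝ) • D.simpleRoot i) := by
  intro h
  obtain ⟨n, hn | hn⟩ := D.root_eq _ h
  · have h1 := congrArg (fun f => D.simpleRoot.repr f i) hn
    simp only [repr_sum] at h1
    simp at h1
    have h2 : (2 * n i : ℝ) = 1 := by rw [← h1]; norm_num
    have h3 : 2 * n i = 1 := by exact_mod_cast h2
    omega
  · have h1 := congrArg (fun f => D.simpleRoot.repr f i) hn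
    simp only [map_neg, Finsupp.neg_apply, repr_sum] at h1
    simp at h1
    have h2 : (0 : ℝ) ≤ n i := by positivity
    linarith

variable [IsTopologicalGroup G] [T2Space G] [CompactSpace G]

/-- Induction on the height `m`. As `(β, β) > 0`, some simple root `α_i` in the support of `β` has
`(β, α_i) > 0`, and reflecting in it lowers the height. The coroot changes by an integral multiple
of `α_i^∨`. -/
theorem coroot_sum_mem (m : ℕ) : ∀ n : Fin D.r → ℕ, ∑ i, n i = m →
    IsRoot D.T (∑ i, n i • D.simpleRoot i) →
    ¬ IsRoot D.T ((1 / 2 : ℝ) • ∑ i, n i • D.simpleRoot i) →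
    D.coroot (∑ i, n i • D.simpleRoot i) ∈ D.corootLattice := by
  induction m using Nat.strong_induction_on with
  | _ m ih =>
    intro n hm hβ hhalf
    set β := ∑ i, n i • D.simpleRoot i with hβdef
    have hpos := D.ip_self_pos hβ.1
    have hsum : D.ip β β = ∑ i, n i * D.ip β (D.simpleRoot i) := by
      conv_lhs => rw [ip, hβdef, LinearMap.sum_apply]
      simp [ip, ← hβdef]
    obtain ⟨i, -, hi⟩ : ∃ i ∈ Finset.univ, 0 < n i * D.ip β (D.simpleRoot i) := by
      rw [hsum] at hpos
      exact Finset.exists_lt_of_sum_lt (by simpa using hpos)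
    have hni : 0 < (n i : ℝ) := by
      refine lt_of_le_of_ne (by positivity) fun h => ?_
      rw [← h, zero_mul] at hi
      exact lt_irrefl _ hi
    have hii := D.ip_self_pos (D.isRoot_simpleRoot i).1
    have hc : 0 < β (D.coroot (D.simpleRoot i)) := by
      rw [apply_coroot, ip_comm]
      have := (pos_iff_pos_of_mul_pos hi).1 hni
      positivity
    obtain ⟨k, hk⟩ := D.exists_int_apply_coroot (D.isRoot_simpleRoot i) hβ
    obtain ⟨k', hk'⟩ := D.exists_int_apply_coroot hβ (D.isRoot_simpleRoot i)
    have hγ := D.isRoot_reflect (D.isRoot_simpleRoot i) hβ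
    obtain ⟨n', hn' | hn'⟩ := D.root_eq _ hγ
    · have hcoef (j : Fin D.r) : (n' j : ℝ) = n j - if j = i then (k : ℝ) else 0 := by
        rw [← D.repr_sum n' j, ← hn', reflect, hk, map_sub, map_smul, Finsupp.sub_apply, hβdef,
          repr_sum]
        simp [Finsupp.single_apply, eq_comm]
      have hlt : ∑ j, n' j < m := by
        have h1 : (∑ j, n' j : ℝ) = ∑ j, (n j : ℝ) - k := by
          simp [hcoef, Finset.sum_sub_distrib]
        have h2 : ((∑ j, n' j : ℕ) : ℝ) < m := by
          rw [← hm]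
          push_cast
          rw [h1]
          rw [hk] at hc
          linarith
        exact_mod_cast h2
      have hhalf' : ¬ IsRoot D.T ((1 / 2 : ℝ) • ∑ j, n' j • D.simpleRoot j) := by
        intro hcon
        rw [← hn'] at hcon
        have h1 := D.isRoot_reflect (D.isRoot_simpleRoot i) hcon
        apply hhalf
        convert h1 using 1
        have h2 : D.simpleRoot i (D.coroot (D.simpleRoot i)) = 2 := by
          rw [apply_coroot]
          field_simp
        simp only [reflect, LinearMap.smul_apply, LinearMap.sub_apply, smul_eq_mul, h2]
        module
      have h1 := ih _ hlt n' rfl (hn' ▸ hγ) hhalf'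
      rw [← hn', D.coroot_reflect (D.isRoot_simpleRoot i).1 hβ.1, hk'] at h1
      have h2 : D.coroot β = (D.coroot β - (k' : ℝ) • D.coroot (D.simpleRoot i)) +
          k' • D.coroot (D.simpleRoot i) := by
        rw [Int.cast_smul_eq_zsmul]
        abel
      rw [h2]
      exact add_mem h1 (zsmul_mem (D.coroot_simpleRoot_mem i) k')
    -- The reflection leaves the coefficients away from `i` unchanged, so a negative image forces `β
    -- = n_i α_i`. Then `n_i α_i(β^∨) = β(β^∨) = 2` leaves `n_i = 1`, or `n_i = 2`, which
    -- indivisibility excludes.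
    · have hcoef (j : Fin D.r) (hj : j ≠ i) : n j = 0 := by
        have h1 := congrArg (fun f => D.simpleRoot.repr f j) hn'
        simp only [reflect, map_sub, map_smul, Finsupp.sub_apply, hβdef, map_neg,
          Finsupp.neg_apply, repr_sum] at h1
        simp [hj.symm] at h1
        exact h1.1
      have hβi : β = n i • D.simpleRoot i := by
        rw [hβdef]
        refine Finset.sum_eq_single i (fun j _ hj => by simp [hcoef j hj]) (by simp)
      have h5 : (n i : ℝ) * k' = 2 := by
        have h6 : β (D.coroot β) = 2 := by
          rw [apply_coroot]
          field_simp
        nth_rewrite 1 [hβi] at h6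
        rw [LinearMap.smul_apply, hk'] at h6
        simpa using h6
      have h7 : (n i : ℤ) * k' = 2 := by exact_mod_cast h5
      have h8 : (n i : ℤ) ∣ 2 := ⟨k', h7.symm⟩
      have h9 : n i ∣ 2 := by exact_mod_cast h8
      rcases (Nat.dvd_prime Nat.prime_two).1 h9 with h10 | h10
      · rw [hβi, h10, one_smul]
        exact D.coroot_simpleRoot_mem i
      · refine absurd ?_ hhalf
        rw [hβi, h10]
        convert D.isRoot_simpleRoot i using 1
        module

/-- The coroot of an indivisible root belongs to the lattice of the simple coroots. -/
theorem coroot_mem {β : Module.Dual ℝ D.cartan} (hβ : IsRoot D.T β)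
    (hhalf : ¬ IsRoot D.T ((1 / 2 : ℝ) • β)) : D.coroot β ∈ D.corootLattice := by
  obtain ⟨n, rfl | rfl⟩ := D.root_eq _ hβ
  · exact D.coroot_sum_mem _ n rfl hβ hhalf
  · rw [coroot_neg]
    refine neg_mem (D.coroot_sum_mem _ n rfl (by simpa using D.isRoot_neg hβ) fun h => hhalf ?_)
    rw [smul_neg]
    exact D.isRoot_neg h

/-- The adjoint action of the normalizer of the Cartan subgroup preserves the Cartan algebra. -/
theorem Ad_mem {w : G} (hw : w ∈ Subgroup.normalizer (D.T : Set G)) (τ : D.cartan) :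
    Ad w (τ : GroupLieAlgebra 𝓘(ℝ, E) G) ∈ D.cartan := by
  obtain ⟨φ, hφ, hT⟩ := D.exists_oneParameterSubgroup τ
  exact D.isMaximalTorus.1.mem_torusLieAlgebra_iff.2
    ⟨_, hφ.conj w, fun s => (Subgroup.mem_normalizer_iff.1 hw (φ s)).1 (hT s)⟩

/-- The action of the normalizer of the Cartan subgroup on the Cartan algebra. -/
def weyl {w : G} (hw : w ∈ Subgroup.normalizer (D.T : Set G)) : D.cartan →ₗ[ℝ] D.cartan :=
  ((Ad w).toLinearMap ∘ₗ D.cartan.subtype).codRestrict D.cartan (D.Ad_mem hw)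

@[simp] theorem coe_weyl {w : G} (hw : w ∈ Subgroup.normalizer (D.T : Set G)) (τ : D.cartan) :
    (D.weyl hw τ : GroupLieAlgebra 𝓘(ℝ, E) G) = Ad w (τ : GroupLieAlgebra 𝓘(ℝ, E) G) := rfl

theorem weyl_weyl_inv {w : G} (hw : w ∈ Subgroup.normalizer (D.T : Set G)) (τ : D.cartan) :
    D.weyl hw (D.weyl (inv_mem hw) τ) = τ := by
  ext
  simp

theorem weyl_inv_weyl {w : G} (hw : w ∈ Subgroup.normalizer (D.T : Set G)) (τ : D.cartan) :
    D.weyl (inv_mem hw) (D.weyl hw τ) = τ := by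
  ext
  simp

theorem dualVec_weyl {w : G} (hw : w ∈ Subgroup.normalizer (D.T : Set G))
    (β : Module.Dual ℝ D.cartan) :
    D.dualVec (β ∘ₗ D.weyl (inv_mem hw)) = D.weyl hw (D.dualVec β) := by
  refine (D.eq_dualVec fun τ => ?_).symm
  rw [coe_weyl, LinearMap.comp_apply, ← D.form_dualVec, coe_weyl, ← D.form_Ad w (D.dualVec β),
    Ad_Ad_inv]

theorem coroot_weyl {w : G} (hw : w ∈ Subgroup.normalizer (D.T : Set G))
    (β : Module.Dual ℝ D.cartan) :
    D.coroot (β ∘ₗ D.weyl (inv_mem hw)) = D.weyl hw (D.coroot β) := by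
  rw [coroot, ip, dualVec_weyl, LinearMap.comp_apply, weyl_inv_weyl, coroot, map_smul, ip]

/-- The normalizer of the Cartan subgroup preserves the coroot lattice. -/
theorem weyl_mem_corootLattice {w : G} (hw : w ∈ Subgroup.normalizer (D.T : Set G)) {p : D.cartan}
    (hp : p ∈ D.corootLattice) : D.weyl hw p ∈ D.corootLattice := by
  refine D.corootLattice_induction (p := fun p => D.weyl hw p ∈ D.corootLattice) (fun i => ?_)
    (by simp) (fun x y hx hy => by rw [map_add]; exact add_mem hx hy)
    (fun x hx => by rw [map_neg]; exact neg_mem hx) hp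
  -- The image of a simple coroot is the coroot of the transported root. That root is indivisible,
  -- since transporting half of it back would make half a simple root a root.
  rw [← coroot_weyl]
  refine D.coroot_mem (D.isRoot_comp (D.isRoot_simpleRoot i) (D.coe_weyl (inv_mem hw)))
    fun h => D.not_isRoot_half_simpleRoot i ?_
  have h1 := D.isRoot_comp h (D.coe_weyl hw)
  convert h1 using 1
  ext τ
  simp only [LinearMap.comp_apply, LinearMap.smul_apply, weyl_inv_weyl]

/-! ### Integrality of the normalized form -/

theorem ip_highestRoot : D.ip D.highestRoot D.highestRoot = 2 := by
  rw [ip_eq_form]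
  exact D.length_highestRoot _ (D.form_dualVec _)

theorem ip_self_le {β : Module.Dual ℝ D.cartan} (hβ : IsRoot D.T β) : D.ip β β ≤ 2 := by
  rw [ip_eq_form]
  exact D.length_root_le β hβ _ (D.form_dualVec _)

/-- Cauchy–Schwarz, from the nonnegative norm of `α` minus its projection to `β`. -/
theorem ip_sq_le (α β : Module.Dual ℝ D.cartan) (hβ : D.ip β β = 2) :
    D.ip α β ^ 2 ≤ 2 * D.ip α α := by
  have h1 : 0 ≤ D.ip (α - (D.ip α β / 2) • β) (α - (D.ip α β / 2) • β) := by
    by_cases h : α - (D.ip α β / 2) • β = 0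
    · rw [h]
      simp [ip]
    · exact (D.ip_self_pos h).le
  have h2 := D.ip_comm β α
  simp only [ip, dualVec_sub, dualVec_smul, LinearMap.sub_apply, LinearMap.smul_apply, map_sub,
    map_smul, smul_eq_mul] at *
  rw [h2, hβ] at h1
  nlinarith

theorem mark_pos (j : Fin D.r) : 0 < D.mark j := by
  obtain ⟨n, hn⟩ := D.le_highestRoot _ (D.isRoot_simpleRoot j)
  have h := D.repr_sum n j
  rw [← hn] at h
  simp at h
  have h2 : D.mark j = 1 + (n j : ℝ) := by
    rw [mark]
    linarith
  rw [h2]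
  positivity

/-- A simple root not orthogonal to some long root `ψ` lies in the span `V` of the long roots, being
proportional to the difference of `ψ` and its reflection. The remaining part `u` of the highest root
is therefore both in `V` and orthogonal to `V`, so `u = 0`. As all marks are positive, no simple
root can be orthogonal to every long root. -/
theorem exists_long_root (i : Fin D.r) : ∃ ψ, IsRoot D.T ψ ∧ D.ip ψ ψ = 2 ∧
    D.ip ψ (D.simpleRoot i) ≠ 0 := by
  by_contra! hcon
  let S : Set (Module.Dual ℝ D.cartan) := {ψ | IsRoot D.T ψ ∧ D.ip ψ ψ = 2}
  let V := Submodule.span ℝ S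
  have hmem (j : Fin D.r) (hj : ∃ ψ ∈ S, D.ip ψ (D.simpleRoot j) ≠ 0) : D.simpleRoot j ∈ V := by
    obtain ⟨ψ, hψ, hne⟩ := hj
    have h1 : D.reflect (D.simpleRoot j) ψ ∈ S :=
      ⟨D.isRoot_reflect (D.isRoot_simpleRoot j) hψ.1,
        by rw [D.ip_reflect (D.isRoot_simpleRoot j).1]; exact hψ.2⟩
    have h2 : ψ (D.coroot (D.simpleRoot j)) ≠ 0 := by
      rw [apply_coroot, ip_comm]
      have := D.ip_self_pos (D.isRoot_simpleRoot j).1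
      positivity
    have h3 : ψ (D.coroot (D.simpleRoot j)) • D.simpleRoot j ∈ V := by
      have := sub_mem (Submodule.subset_span hψ : ψ ∈ V) (Submodule.subset_span h1)
      simpa [reflect] using this
    exact (Submodule.smul_mem_iff _ h2).1 h3
  have horth (v : Module.Dual ℝ D.cartan) (hv : v ∈ V) (w : Module.Dual ℝ D.cartan)
      (hw : ∀ ψ ∈ S, D.ip ψ w = 0) : D.ip v w = 0 := by
    induction hv using Submodule.span_induction with
    | mem x h => exact hw x h
    | zero => simp [ip, dualVec]
    | add x y _ _ hx hy => rw [D.ip_comm, ip, LinearMap.add_apply, ← ip, ← ip, D.ip_comm w, hx,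
        D.ip_comm w, hy, add_zero]
    | smul c x _ hx => rw [D.ip_comm, ip, LinearMap.smul_apply, ← ip, D.ip_comm w, hx, smul_zero]
  classical
  let J : Finset (Fin D.r) := Finset.univ.filter fun j => ∀ ψ ∈ S, D.ip ψ (D.simpleRoot j) = 0
  have hφ : D.highestRoot = ∑ j ∈ J, D.mark j • D.simpleRoot j +
      ∑ j ∈ Jᶜ, D.mark j • D.simpleRoot j := by
    rw [Finset.sum_add_sum_compl]
    exact (D.simpleRoot.sum_repr _).symm
  set u := ∑ j ∈ J, D.mark j • D.simpleRoot j with hu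
  have huV : u ∈ V := by
    have h1 : u = D.highestRoot - ∑ j ∈ Jᶜ, D.mark j • D.simpleRoot j := by
      rw [hφ]
      abel
    rw [h1]
    refine sub_mem (Submodule.subset_span ⟨D.isRoot_highestRoot, D.ip_highestRoot⟩)
      (Submodule.sum_mem _ fun j hj => Submodule.smul_mem _ _ (hmem j ?_))
    simpa [J] using hj
  have hu0 : u = 0 := by
    by_contra hne
    refine (D.ip_self_pos hne).ne' (horth u huV u fun ψ hψ => ?_)
    rw [ip, hu, LinearMap.sum_apply]
    refine Finset.sum_eq_zero fun j hj => ?_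
    have h1 : ∀ ψ ∈ S, D.ip ψ (D.simpleRoot j) = 0 := by simpa [J] using hj
    have h2 : D.simpleRoot j (D.dualVec ψ) = 0 := h1 ψ hψ
    rw [LinearMap.smul_apply, h2, smul_zero]
  have hiJ : i ∈ J := by
    simp only [J, Finset.mem_filter, Finset.mem_univ, true_and]
    exact fun ψ hψ => hcon ψ hψ.1 hψ.2
  exact (D.mark_pos i).ne'
    (linearIndependent_iff'.1 D.simpleRoot.linearIndependent J D.mark hu0 i hiJ)

/-- Take a long root `ψ` with `m = (ψ, α_i) ≠ 0`. Then `m = α_i(ψ^∨)` and `n = ψ(α_i^∨) = 2m / (α_i,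
α_i)` are integers, and Cauchy–Schwarz gives `m² ≤ 2(α_i, α_i) ≤ 4`. For `m = ±1` the quotient is
`±n`; for `m = ±2` equality holds and `α_i` is long. -/
theorem exists_int_two_div_ip (i : Fin D.r) :
    ∃ n : ℤ, 2 / D.ip (D.simpleRoot i) (D.simpleRoot i) = n := by
  obtain ⟨ψ, hψ, hψ2, hne⟩ := D.exists_long_root i
  have hα := D.isRoot_simpleRoot i
  have hpos := D.ip_self_pos hα.1
  have hle := D.ip_self_le hα
  obtain ⟨m, hm⟩ := D.exists_int_apply_coroot hψ hα
  obtain ⟨n, hn⟩ := D.exists_int_apply_coroot hα hψ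
  rw [apply_coroot, hψ2, mul_div_cancel_left₀ _ (by norm_num : (2 : ℝ) ≠ 0)] at hm
  rw [apply_coroot, D.ip_comm, hm] at hn
  have hsq := D.ip_sq_le (D.simpleRoot i) ψ hψ2
  rw [D.ip_comm, hm] at hsq
  rw [hm] at hne
  have hm0 : m ≠ 0 := by exact_mod_cast hne
  have hm4 : m ^ 2 ≤ 4 := by
    have : (m : ℝ) ^ 2 ≤ 4 := by linarith
    exact_mod_cast this
  have h1 : m ≤ 2 := by nlinarith
  have h2 : -2 ≤ m := by nlinarith
  set a := D.ip (D.simpleRoot i) (D.simpleRoot i) with ha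
  have h4 (h : (m : ℝ) ^ 2 = 4) : a = 2 := by linarith
  have h5 : m = -2 ∨ m = -1 ∨ m = 1 ∨ m = 2 := by omega
  rcases h5 with rfl | rfl | rfl | rfl
  · exact ⟨1, by rw [h4 (by norm_num)]; norm_num⟩
  · refine ⟨-n, ?_⟩
    push_cast at hn ⊢
    rw [← hn]
    ring
  · refine ⟨n, ?_⟩
    push_cast at hn ⊢
    rw [← hn]
    ring
  · exact ⟨1, by rw [h4 (by norm_num)]; norm_num⟩

/-- The coroot lattice pairs integrally with the elements whose exponential is central. -/
theorem exists_int_form {c p : D.cartan} (hc : D.e c ∈ Subgroup.center G)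
    (hp : p ∈ D.corootLattice) : ∃ n : ℤ, D.form c p = n := by
  refine D.corootLattice_induction (p := fun p => ∃ n : ℤ, D.form c p = n) (fun i => ?_)
    ⟨0, by simp⟩ ?_ ?_ hp
  · obtain ⟨m, hm⟩ := D.exists_int_two_div_ip i
    obtain ⟨k, hk⟩ := D.exists_int_of_e_mem_center (D.isRoot_simpleRoot i) hc
    refine ⟨m * k, ?_⟩
    rw [coroot, Submodule.coe_smul, map_smul, D.form_symm, form_dualVec, hm, hk]
    simp
  · rintro x y ⟨m, hm⟩ ⟨n, hn⟩
    exact ⟨m + n, by rw [Submodule.coe_add, map_add, hm, hn]; simp⟩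
  · rintro x ⟨m, hm⟩
    exact ⟨-m, by rw [Submodule.coe_neg, map_neg, hm]; simp⟩

end CartanData

/-! ### Functoriality of the universal cover and of unique choice -/

theorem coverMap_coverMap_of_leftInverse {K K' : Type*} [TopologicalSpace K] [Group K]
    [IsTopologicalGroup K] [TopologicalSpace K'] [Group K'] [IsTopologicalGroup K']
    {f : K →ₜ* K'} {g : K' →ₜ* K} (h : ∀ x, g (f x) = x) (x : UniversalCover K) :
    coverMap g (coverMap f x) = x := by
  induction x using Con.induction_on with
  | H γ =>
    refine congrArg (fun γ : BasedPath K => (γ : UniversalCover K)) (Subtype.ext ?_)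
    ext s
    exact h _

-- Unique choice with a default is natural under a bijection `f` that matches the predicates and the
-- defaults. No existence or uniqueness is assumed: if it fails on one side, it fails on both.
open Classical in
theorem choose_transport {A B : Type*} {P : A → Prop} {Q : B → Prop} {f : B → A}
    (hf : Function.Bijective f) (h : ∀ b, Q b ↔ P (f b)) (a₀ : A) (b₀ : B) (h₀ : f b₀ = a₀) :
    (if h : ∃! a, P a then h.choose else a₀) = f (if h : ∃! b, Q b then h.choose else b₀) := by
  have hiff : (∃! b, Q b) ↔ ∃! a, P a := by
    constructor
    · rintro ⟨b, hb, hu⟩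
      refine ⟨f b, (h b).1 hb, fun a ha => ?_⟩
      obtain ⟨b', rfl⟩ := hf.2 a
      rw [hu b' ((h b').2 ha)]
    · rintro ⟨a, ha, hu⟩
      obtain ⟨b, rfl⟩ := hf.2 a
      exact ⟨b, (h b).2 ha, fun b' hb' => hf.1 (hu _ ((h b').1 hb'))⟩
  by_cases hQ : ∃! b, Q b
  · have hP := hiff.1 hQ
    rw [dif_pos hP, dif_pos hQ]
    exact hP.unique hP.choose_spec.1 ((h _).1 hQ.choose_spec.1)
  · rw [dif_neg hQ, dif_neg fun hP => hQ (hiff.2 hP), h₀]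

/-! ### Conjugation of curves and rigidity of one-parameter subgroups -/

section LeftLogDeriv

variable {E : Type*} [NormedAddCommGroup E] [NormedSpace ℝ E] [CompleteSpace E]
  {G : Type*} [TopologicalSpace G] [ChartedSpace E G] [Group G] [LieGroup 𝓘(ℝ, E) ∞ G]

/-- The curve `t ↦ c(s)⁻¹ c(t)`, which is at the identity for `t = s`, is itself conjugated by `g`.
-/
theorem leftLogDeriv_conj (g : G) {c : ℝ → G} (hc : ContMDiff 𝓘(ℝ, ℝ) 𝓘(ℝ, E) 1 c) (s : ℝ) :
    leftLogDeriv (E := E) (fun t => g * c t * g⁻¹) s = Ad g (leftLogDeriv c s) := by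
  have h1 : MDifferentiableAt 𝓘(ℝ, ℝ) 𝓘(ℝ, E) (fun t : ℝ => (c s)⁻¹ * c t) s :=
    ((contMDiff_mul_left (I := 𝓘(ℝ, E)) (n := ∞) (a := (c s)⁻¹)).mdifferentiable (by simp) _).comp s
      (hc.mdifferentiable (by simp) s)
  have h2 := HasMFDerivAt.comp s (hasMFDerivAt_conj (E := E) g (inv_mul_cancel (c s)))
    h1.hasMFDerivAt
  have h3 : ((fun x : G => g * x * g⁻¹) ∘ fun t : ℝ => (c s)⁻¹ * c t) =
      fun t => (g * c s * g⁻¹)⁻¹ * (g * c t * g⁻¹) := by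
    ext t
    simp only [Function.comp]
    group
  rw [h3] at h2
  exact congrArg (fun L : ℝ →L[ℝ] E => L 1) h2.mfderiv

theorem contMDiff_conj_comp (g : G) {c : ℝ → G} (hc : ContMDiff 𝓘(ℝ, ℝ) 𝓘(ℝ, E) 1 c) :
    ContMDiff 𝓘(ℝ, ℝ) 𝓘(ℝ, E) 1 (fun t => g * c t * g⁻¹) :=
  ((contMDiff_conj (E := E) g).of_le (by exact_mod_cast le_top)).comp hc

/-- A one-parameter subgroup is determined by its values on an interval `[0, ε]`. -/
theorem IsOneParameterSubgroup.eq_of_eqOn {X Y : GroupLieAlgebra 𝓘(ℝ, E) G} {φ ψ : ℝ → G}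
    (hφ : IsOneParameterSubgroup X φ) (hψ : IsOneParameterSubgroup Y ψ) {ε : ℝ} (hε : 0 < ε)
    (h : EqOn φ ψ (Icc 0 ε)) : X = Y := by
  have h1 := (isOneParameterSubgroup_iff.1 hφ).2.2
  have h2 := (isOneParameterSubgroup_iff.1 hψ).2.2
  refine h1.unique (h2.congr_of_eventuallyEq ?_)
  filter_upwards [Ioo_mem_nhds (neg_lt_zero.2 hε) hε] with s hs
  have h3 : φ s = ψ s := by
    rcases le_total 0 s with h0 | h0
    · exact h ⟨h0, hs.2.le⟩
    · have h4 := h (x := -s) ⟨by linarith, by linarith [hs.1]⟩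
      rw [hφ.map_neg, hψ.map_neg] at h4
      exact inv_injective h4
  rw [h3]

end LeftLogDeriv

/-! ### The exponential on the Cartan algebra -/

namespace CartanData

variable {E : Type*} [NormedAddCommGroup E] [NormedSpace ℝ E] [FiniteDimensional ℝ E]
  [CompleteSpace E]
  {G : Type*} [TopologicalSpace G] [T2Space G] [CompactSpace G] [ChartedSpace E G] [Group G]
  [IsTopologicalGroup G] [LieGroup 𝓘(ℝ, E) ∞ G]
  (D : CartanData E G)

theorem e_zero : D.e 0 = 1 := by
  obtain ⟨φ, hφ, -⟩ := D.exists_oneParameterSubgroup 0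
  simpa [hφ.map_zero] using D.e_eq hφ 0

theorem e_add (x y : D.cartan) : D.e (x + y) = D.e x * D.e y := by
  obtain ⟨φ, hφ, hφT⟩ := D.exists_oneParameterSubgroup x
  obtain ⟨ψ, hψ, hψT⟩ := D.exists_oneParameterSubgroup y
  have h := hφ.mul hψ fun s t => D.isMaximalTorus.1.2.2 _ (hφT s) _ (hψT t)
  have h1 := D.e_eq (τ := x + y) h 1
  have h2 := D.e_eq hφ 1
  have h3 := D.e_eq hψ 1
  rw [one_smul] at h1 h2 h3
  rw [h1, h2, h3]

theorem conj_e {w : G} (hw : w ∈ Subgroup.normalizer (D.T : Set G)) (τ : D.cartan) :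
    w * D.e τ * w⁻¹ = D.e (D.weyl hw τ) := by
  obtain ⟨φ, hφ, -⟩ := D.exists_oneParameterSubgroup τ
  have h1 := D.e_eq hφ 1
  have h2 := D.e_eq (τ := D.weyl hw τ) (hφ.conj w) 1
  rw [one_smul] at h1 h2
  rw [h1, h2]

/-- The exponential is not injective, but agreement along whole segments from the origin fixes the
velocity there. -/
theorem eq_of_e_smul {x y : D.cartan} (h : ∀ t ∈ Icc (0 : ℝ) 1, D.e (t • x) = D.e (t • y)) :
    x = y := by
  obtain ⟨φ, hφ, -⟩ := D.exists_oneParameterSubgroup x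
  obtain ⟨ψ, hψ, -⟩ := D.exists_oneParameterSubgroup y
  refine Subtype.ext (hφ.eq_of_eqOn hψ Real.two_pi_pos fun s hs => ?_)
  have h1 := h (s / (2 * Real.pi)) ⟨div_nonneg hs.1 Real.two_pi_pos.le,
    (div_le_one Real.two_pi_pos).2 hs.2⟩
  rwa [D.e_eq hφ, D.e_eq hψ, mul_div_cancel₀ _ Real.two_pi_pos.ne'] at h1

theorem form_weyl {w : G} (hw : w ∈ Subgroup.normalizer (D.T : Set G)) (x y : D.cartan) :
    D.form (D.weyl hw x) (D.weyl hw y) = D.form x y := by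
  rw [coe_weyl, coe_weyl, D.form_Ad]

theorem zero_mem_alcove : (0 : D.cartan) ∈ D.alcove := D.vertex_mem_alcove 0

/-! ### The affine action of the centre on the alcove -/

namespace CentreAction

variable {D} {z : G} (a : D.CentreAction z)

theorem e_act_zero (hz : z ∈ Subgroup.center G) : D.e (a.act 0) = z := by
  have h := a.mul_e 0 D.zero_mem_alcove
  rw [D.e_zero, mul_one] at h
  have h2 : D.e (a.act 0) = a.w * z * a.w⁻¹ := by
    have h3 := congrArg (fun g => a.w * g * a.w⁻¹) h
    simpa [mul_assoc] using h3.symm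
  rw [h2, Subgroup.mem_center_iff.1 hz, mul_inv_cancel_right]

/-- The relation defining `w` is known only after exponentiation and only on the alcove. The alcove
is convex and contains `0`, so the relation holds along the segment from `0` to `τ`. After the
central factor `z` is cancelled, `eq_of_e_smul` identifies the linear part with `Ad w` on `τ`. -/
theorem act_eq (hz : z ∈ Subgroup.center G) {τ : D.cartan} (hτ : τ ∈ D.alcove) :
    a.act τ = D.weyl a.w_mem τ + a.act 0 := by
  have hdecomp (x : D.cartan) : a.act x = a.act.linear x + a.act 0 := by
    have := a.act.map_vadd 0 x
    simpa using this
  rw [hdecomp τ]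
  refine congrArg (· + a.act 0) (D.eq_of_e_smul fun t ht => ?_)
  have hmem : t • τ ∈ D.alcove := by
    have := D.convex_alcove D.zero_mem_alcove hτ (sub_nonneg.2 ht.2) ht.1 (sub_add_cancel 1 t)
    simpa using this
  have h1 := a.mul_e _ hmem
  rw [hdecomp, D.e_add, a.e_act_zero hz] at h1
  have hz' := Subgroup.mem_center_iff.1 hz
  rw [← map_smul, ← map_smul, ← D.conj_e, ← mul_left_inj z]
  calc D.e (a.act.linear (t • τ)) * z
      = a.w * (a.w⁻¹ * (D.e (a.act.linear (t • τ)) * z) * a.w) * a.w⁻¹ := by group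
    _ = a.w * D.e (t • τ) * a.w⁻¹ * z := by
      rw [← h1, ← mul_assoc, hz', mul_assoc, mul_assoc, ← hz']
      simp only [mul_assoc]

theorem vertex_eq (hz : z ∈ Subgroup.center G) (i : Fin (D.r + 1)) :
    D.vertex i = D.weyl a.w_mem (D.vertex (a.idx i)) + a.act 0 := by
  rw [← a.act_eq hz (D.vertex_mem_alcove _), a.act_vertex, idx, Equiv.apply_symm_apply]

theorem conj_inv_mem (hz : z ∈ Subgroup.center G) (i j : Fin (D.r + 1)) {γ : G}
    (hγ : γ ∈ D.stab (a.idx i) (a.idx j)) : a.w * γ * a.w⁻¹ ∈ D.stab i j := by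
  rw [stab, Subgroup.mem_centralizer_iff] at hγ ⊢
  rintro _ ⟨τ', hτ', rfl⟩
  obtain ⟨τ, hτ, rfl⟩ : τ' ∈ a.act '' openSegment ℝ (D.vertex (a.idx i)) (D.vertex (a.idx j)) := by
    rw [image_openSegment, a.act_vertex, a.act_vertex]
    simpa [idx] using hτ'
  have hA : τ ∈ D.alcove :=
    D.convex_alcove.openSegment_subset (D.vertex_mem_alcove _) (D.vertex_mem_alcove _) hτ
  have hc := hγ _ ⟨_, hτ, rfl⟩
  have he : D.e (a.act τ) = a.w * (z * D.e τ) * a.w⁻¹ := by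
    rw [a.mul_e τ hA]
    group
  have hz' := Subgroup.mem_center_iff.1 hz
  rw [he]
  calc a.w * (z * D.e τ) * a.w⁻¹ * (a.w * γ * a.w⁻¹)
      = a.w * (z * (D.e τ * γ)) * a.w⁻¹ := by group
    _ = a.w * (γ * z * D.e τ) * a.w⁻¹ := by rw [hc, hz' γ, mul_assoc z]
    _ = a.w * γ * a.w⁻¹ * (a.w * (z * D.e τ) * a.w⁻¹) := by group

/-- The inverse `γ ↦ w γ w⁻¹` of the isomorphism from `Gᵢⱼ` to `G_{i_z j_z}`. -/
def conjInv (hz : z ∈ Subgroup.center G) (i j : Fin (D.r + 1)) :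
    D.stab (a.idx i) (a.idx j) →ₜ* D.stab i j where
  toFun γ := ⟨a.w * γ * a.w⁻¹, a.conj_inv_mem hz i j γ.2⟩
  map_one' := by
    ext
    simp
  map_mul' x y := by
    ext
    simp [mul_assoc]
  continuous_toFun := by fun_prop

theorem conjInv_conj (hz : z ∈ Subgroup.center G) (i j : Fin (D.r + 1)) (γ : D.stab i j) :
    a.conjInv hz i j (a.conj hz i j γ) = γ := by
  refine Subtype.ext ?_
  change a.w * (a.w⁻¹ * γ * a.w) * a.w⁻¹ = γ
  group

theorem conj_conjInv (hz : z ∈ Subgroup.center G) (i j : Fin (D.r + 1))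
    (γ : D.stab (a.idx i) (a.idx j)) : a.conj hz i j (a.conjInv hz i j γ) = γ := by
  refine Subtype.ext ?_
  change a.w⁻¹ * (a.w * γ * a.w⁻¹) * a.w = γ
  group

theorem conjInv_conjCover (hz : z ∈ Subgroup.center G) (i j : Fin (D.r + 1)) (x : D.cover i j) :
    coverMap (a.conjInv hz i j) (a.conjCover hz i j x) = x :=
  coverMap_coverMap_of_leftInverse (a.conjInv_conj hz i j) x

theorem conjCover_conjInv (hz : z ∈ Subgroup.center G) (i j : Fin (D.r + 1))
    (x : D.cover (a.idx i) (a.idx j)) :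
    a.conjCover hz i j (coverMap (a.conjInv hz i j) x) = x :=
  coverMap_coverMap_of_leftInverse (a.conj_conjInv hz i j) x

theorem bijective_conjCover (hz : z ∈ Subgroup.center G) (i j : Fin (D.r + 1)) :
    Function.Bijective (a.conjCover hz i j) :=
  ⟨Function.LeftInverse.injective (a.conjInv_conjCover hz i j),
    Function.RightInverse.surjective (a.conjCover_conjInv hz i j)⟩

theorem bijective_conjDeck (hz : z ∈ Subgroup.center G) (i : Fin (D.r + 1)) :
    Function.Bijective (a.conjDeck hz i) := by
  constructor
  · intro x y h
    exact Subtype.ext ((a.bijective_conjCover hz i i).1 (congrArg Subtype.val h))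
  · rintro ⟨x, hx⟩
    refine ⟨⟨coverMap (a.conjInv hz i i) x, ?_⟩, Subtype.ext (a.conjCover_conjInv hz i i x)⟩
    have hx' : coverProj _ x = 1 := hx
    change coverProj _ (coverMap (a.conjInv hz i i) x) = 1
    rw [coverProj_coverMap, hx', map_one]

/-! ### Invariance of the characters -/

theorem isCoverExp_conjCover_iff (hz : z ∈ Subgroup.center G) (i j : Fin (D.r + 1))
    (p : D.cartan) (x : D.cover i j) :
    D.IsCoverExp (a.idx i) (a.idx j) (D.weyl (inv_mem a.w_mem) p) (a.conjCover hz i j x) ↔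
      D.IsCoverExp i j p x := by
  constructor
  · rintro ⟨γ, hγ, hx⟩
    refine ⟨basedPathMap (a.conjInv hz i j) γ, fun s => ?_, ?_⟩
    · change a.w * ((γ.1 s : D.stab (a.idx i) (a.idx j)) : G) * a.w⁻¹ = _
      rw [hγ, D.conj_e a.w_mem, map_smul, weyl_weyl_inv]
    · rw [← a.conjInv_conjCover hz i j x, ← hx]
      rfl
  · rintro ⟨γ, hγ, rfl⟩
    refine ⟨basedPathMap (a.conj hz i j) γ, fun s => ?_, rfl⟩
    change a.w⁻¹ * ((γ.1 s : D.stab i j) : G) * a.w = _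
    have h := D.conj_e (inv_mem a.w_mem) ((s : ℝ) • p)
    rw [inv_inv, map_smul] at h
    rw [hγ, h]

/-- By `vertex_eq` and invariance of the form, the two pairings differ by `tr (z0) p`, an integer
because `z0` exponentiates to the central element `z`. -/
theorem exp_form_vertex (hz : z ∈ Subgroup.center G) (i : Fin (D.r + 1)) {p : D.cartan}
    (hp : p ∈ D.corootLattice) :
    Circle.exp (2 * Real.pi * D.form (D.vertex (a.idx i)) (D.weyl (inv_mem a.w_mem) p)) =
      Circle.exp (2 * Real.pi * D.form (D.vertex i) p) := by
  obtain ⟨n, hn⟩ := D.exists_int_form (c := a.act 0) (by rwa [a.e_act_zero hz]) hp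
  have h : D.form (D.vertex i) p =
      D.form (D.vertex (a.idx i)) (D.weyl (inv_mem a.w_mem) p) + n := by
    rw [← hn, ← D.form_weyl a.w_mem (D.vertex (a.idx i)), weyl_weyl_inv]
    nth_rewrite 1 [a.vertex_eq hz i]
    rw [Submodule.coe_add, map_add, LinearMap.add_apply]
  rw [h, mul_add, Circle.exp_add, Circle.exp_two_pi_mul_int, mul_one]

theorem chi_conjDeck (hz : z ∈ Subgroup.center G) (i : Fin (D.r + 1)) (ζ : D.deck i) :
    D.chi (a.idx i) (a.conjDeck hz i ζ) = D.chi i ζ := by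
  have hbij := a.bijective_conjDeck hz i
  have h : D.chi i = (D.chi (a.idx i)).comp (a.conjDeck hz i) := by
    -- Precomposition with `conjDeck` is a bijection of characters and takes the trivial default to
    -- the trivial default. The two defining properties match because both `w` and `w⁻¹` preserve
    -- the coroot lattice.
    refine choose_transport
      (f := fun χ : D.deck (a.idx i) →* Circle => χ.comp (a.conjDeck hz i)) ⟨?_, ?_⟩ (fun χ => ?_)
      _ _ (MonoidHom.one_comp _)
    · exact fun χ χ' h => (MonoidHom.cancel_right hbij.2).1 h
    · intro χ
      refine ⟨χ.comp (MulEquiv.ofBijective _ hbij).symm.toMonoidHom, ?_⟩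
      ext ζ
      exact congrArg (fun ζ => (χ ζ : ℂ)) ((MulEquiv.ofBijective _ hbij).symm_apply_apply ζ)
    · constructor
      · intro hχ p hp ζ hζ
        rw [← a.exp_form_vertex hz i hp]
        exact hχ _ (D.weyl_mem_corootLattice _ hp) _ ((a.isCoverExp_conjCover_iff hz i i p _).2 hζ)
      · intro hχ p hp ζ hζ
        obtain ⟨ζ, rfl⟩ := hbij.2 ζ
        have hp' := D.weyl_mem_corootLattice a.w_mem hp
        have hwp := D.weyl_inv_weyl a.w_mem p
        rw [← hwp] at hζ
        have h1 := hχ _ hp' ζ ((a.isCoverExp_conjCover_iff hz i i _ _).1 hζ)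
        rw [← a.exp_form_vertex hz i hp', hwp] at h1
        exact h1
  rw [h]
  rfl

/-- The translation part of the affine action drops out of the difference of vertices, and the
remaining `Ad w` on both arguments is absorbed by the form. -/
theorem form_leftLogDeriv_conj (hz : z ∈ Subgroup.center G) (i j : Fin (D.r + 1)) {c : ℝ → G}
    (hc : ContMDiff 𝓘(ℝ, ℝ) 𝓘(ℝ, E) 1 c) (s : ℝ) :
    D.form ((D.vertex j - D.vertex i : D.cartan) : GroupLieAlgebra 𝓘(ℝ, E) G)
        (leftLogDeriv (fun t => a.w * c t * a.w⁻¹) s) =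
      D.form ((D.vertex (a.idx j) - D.vertex (a.idx i) : D.cartan) : GroupLieAlgebra 𝓘(ℝ, E) G)
        (leftLogDeriv c s) := by
  rw [a.vertex_eq hz i, a.vertex_eq hz j, add_sub_add_right_eq_sub, ← map_sub, coe_weyl,
    leftLogDeriv_conj a.w hc, D.form_Ad]

theorem chi₂_conjCover (hz : z ∈ Subgroup.center G) (i j : Fin (D.r + 1)) (γ : D.cover i j) :
    D.chi₂ (a.idx i) (a.idx j) (a.conjCover hz i j γ) = D.chi₂ i j γ := by
  have hbij := a.bijective_conjCover hz i j
  have h : D.chi₂ i j = D.chi₂ (a.idx i) (a.idx j) ∘ a.conjCover hz i j := by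
    refine choose_transport
      (f := fun χ : D.cover (a.idx i) (a.idx j) → Circle => χ ∘ a.conjCover hz i j)
      ⟨hbij.2.injective_comp_right, hbij.1.surjective_comp_right⟩ (fun χ => ?_) _ _ rfl
    constructor
    -- Conjugation by `w⁻¹` turns test curves in `G_ij` into test curves in `G_{i_z j_z}` with the
    -- same integrand; the converse conjugates by `w`.
    · intro hχ c γ hc hγ
      have hc' := contMDiff_conj_comp a.w⁻¹ hc
      have h1 := hχ _ (basedPathMap (a.conj hz i j) γ) hc' fun s => by
        rw [← hγ, inv_inv]
        rfl
      refine h1.trans (congrArg Circle.exp (intervalIntegral.integral_congr fun s _ => ?_))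
      rw [← a.form_leftLogDeriv_conj hz i j hc']
      simp [mul_assoc]
    · intro hχ c γ hc hγ
      have h1 := hχ _ (basedPathMap (a.conjInv hz i j) γ) (contMDiff_conj_comp a.w hc) fun s => by
        rw [← hγ]
        rfl
      simp only [a.form_leftLogDeriv_conj hz i j hc] at h1
      rw [← h1]
      exact congrArg χ (a.conjCover_conjInv hz i j γ).symm
  rw [h]
  rfl

end CentreAction

end CartanData

end BasicGerbe

end

theorem lemma1 {E : Type*} [NormedAddCommGroup E] [NormedSpace ℝ E] [FiniteDimensional ℝ E]
    [CompleteSpace E]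
    {G : Type*} [TopologicalSpace G] [T2Space G] [CompactSpace G] [SimplyConnectedSpace G]
    [ChartedSpace E G] [Group G] [IsTopologicalGroup G] [LieGroup 𝓘(ℝ, E) ∞ G]
    [LieAlgebra.IsSimple ℝ (GroupLieAlgebra 𝓘(ℝ, E) G)]
    (D : BasicGerbe.CartanData E G)
    (Z : Subgroup G) (hZ : Z ≤ Subgroup.center G) (z : G) (hz : z ∈ Z)
    (a : D.CentreAction z) :
    (∀ (i : Fin (D.r + 1)) (ζ : D.deck i),
      D.chi (a.idx i) (a.conjDeck (hZ hz) i ζ) = D.chi i ζ) ∧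
    (∀ (i j : Fin (D.r + 1)) (γ : D.cover i j),
      D.chi₂ (a.idx i) (a.idx j) (a.conjCover (hZ hz) i j γ) = D.chi₂ i j γ) :=
  ⟨fun i ζ => a.chi_conjDeck (hZ hz) i ζ, fun i j γ => a.chi₂_conjCover (hZ hz) i j γ⟩
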